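/- Let $\Lambda$ be the Conway–Wales lattice, a $\mathbb Z[i]$-lattice of rank $28$ with positive definite Hermitian form $(\cdot,\cdot)$, linear in the first argument, on $\mathfrak r=\mathbb C\otimes_{\mathbb Z[i]}\Lambda$. Let $\widetilde R=\mathrm{Aut}(\Lambda)$ be the group of unitary transformations of $\mathfrak r$ preserving $\Lambda$; it is a central product $4\circ(2.\mathrm{Ru})$ of the scalars $\langle i\rangle$ with the perfect double cover of the Rudvalis group. Let $R=[\widetilde R,\widetilde R]$, which is the unique subgroup of $\widetilde R$ isomorphic to $2.\mathrm{Ru}$, so that $\mathrm{Ru}\cong R/\{\pm\mathrm{Id}\}$. Since $-\mathrm{Id}$ acts trivially on $\bigwedge^{14}(\mathfrak r)$, the group $\mathrm{Ru}$ acts on this space. Put $\Lambda_2=\{\lambda\in\Lambda:(\lambda,\lambda)=4\}$. **M-sets.** For $X\subset\Lambda_2$ let $\Gamma(X)$ be the undirected graph on $X$ with $\lambda,\lambda'$ joined when $(\lambda,\lambda')=1$, and $\Delta(X)$ the directed graph on $X$ with an arc $\lambda\to\lambda'$ when $(\lambda,\lambda')=i$. A set $B\subset\Lambda_2$ is an *M-set*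 if $\Gamma(B)$ is the $1$-skeleton of a triangulated Möbius band with $13$ triangles and $\Delta(B)$ is a directed cycle of length $13$ through all of $B$. A labeling $B=\{\beta^1,\dots,\beta^{13}\}$ is *oriented* if $(\beta^k,\beta^{k+1})=i$ for $1\le k\le 12$. **Neighbors and complements.** Vectors $\mu,\mu'\in\Lambda_2$ are the *first* and *second neighbor* to $B$ if $(\beta,\mu)=(\beta,\mu')=1$ for all $\beta\in B$ and $(\mu,\mu')=i$. A vector $\lambda\in\Lambda_2$ with $(\beta,\lambda)=0$ for all $\beta\in B$ is a *positive* (respectively *negative*) *complement* to $B$ if $(\lambda,\mu)/(\lambda,\mu')$ is $+1$ (respectively $-1$) for the neighbors $\mu,\mu'$ to $B$. The *right partner* to $B$ is the set of all $\gamma\in\Lambda_2$ for which the sequence $((\beta^k,\gamma))_{k=1}^{13}$, for an oriented labeling of $B$, is a cyclic permutation of $(-i,-i,0,0,i,-i,0,0,0,0,-i,i,0)$. **The graph $\Xi$.** Its vertices are the pairs $[\lambda,B]$ with $B$ an M-set and $\lambda$ a positive complement to $B$. Vertices $[\lambda_0,B_0]$ and $[\lambda_1,B_1]$ are joined by an undirected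 edge if one of the following holds, in one order or the other: (1) $\lambda_0=u\lambda_1$ and $B_0=\bar uB_1$ for a unit $u\in\mathbb Z[i]$; (2) $\lambda_0=\lambda_1$ and $(\lambda_0,\mu_0)=(\lambda_0,\mu_1)$ for the first neighbors $\mu_0,\mu_1$ to $B_0,B_1$; (3) $\lambda_1$ is a negative complement to $B_0$ with $(\lambda_0,\lambda_1)=-i$ and $B_1$ is the right partner to $B_0$. Put $a_{[\lambda,B]}=\lambda\wedge\beta^1\wedge\dots\wedge\beta^{13}\in\bigwedge^{14}(\mathfrak r)$ for any oriented labeling of $B$ (all oriented labelings give the same element). **The vector $\varrho$.** Let $\Xi_*$ be the connected component of $\Xi$ containing $[\lambda_*,B_*]$, and $$\varrho=\sum_{[\lambda,B]\in\Xi_*}a_{[\lambda,B]}.$$ Here $\Lambda$ is written in its coordinates as $7$-tuples of complex quaternions, a vector being a $7\times4$ array with form $\sum x_p\overline{y_p}$; all coordinates of $\lambda_*$ vanish except for a $2$ in row $2$, column $1$, and $B_*=\{\beta^1_*,\dots,\beta^{13}_*\}$ is the following M-set, where the array of the doubled vector is listed row by row and a bar denotes the negative: - $2\beta_*^{1}$: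 $0000\,|\,0000\,|\,4000\,|\,0000\,|\,0000\,|\,0000\,|\,0000$ - $2\beta_*^{2}$: $0000\,|\,0000\,|\,\bar i\bar1i\bar1\,|\,0000\,|\,11\bar ii\,|\,1ii\bar1\,|\,\bar1\bar1\bar1\bar1$ - $2\beta_*^{3}$: $\bar1i00\,|\,00i\bar i\,|\,0i0\bar1\,|\,0i\bar i0\,|\,0\bar101\,|\,\bar111\bar i\,|\,0i\bar10$ - $2\beta_*^{4}$: $00i\bar1\,|\,00\bar1\bar1\,|\,010i\,|\,i00i\,|\,0i0\bar i\,|\,i\bar1ii\,|\,0i\bar10$ - $2\beta_*^{5}$: $0ii0\,|\,0\bar101\,|\,11i1\,|\,0i\bar10\,|\,00\bar i\bar1\,|\,\bar ii00\,|\,010i$ - $2\beta_*^{6}$: $100\bar1\,|\,0101\,|\,1\bar11\bar i\,|\,01i0\,|\,1i00\,|\,001\bar1\,|\,i0\bar10$ - $2\beta_*^{7}$: $\bar100i\,|\,001\bar i\,|\,001\bar1\,|\,0\bar10i\,|\,0i\bar i0\,|\,0i0\bar i\,|\,1\bar1i\bar1$ - $2\beta_*^{8}$: $iii\bar1\,|\,0i\bar10\,|\,00\bar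 i\bar1\,|\,00\bar ii\,|\,010\bar i\,|\,0110\,|\,\bar i0\bar i0$ - $2\beta_*^{9}$: $100i\,|\,00\bar1\bar i\,|\,1100\,|\,0\bar10i\,|\,0\bar1\bar10\,|\,10\bar10\,|\,\bar11\bar1i$ - $2\beta_*^{10}$: $10i0\,|\,0\bar ii0\,|\,1010\,|\,\bar1i\bar i\bar i\,|\,01\bar i0\,|\,00i\bar1\,|\,i\bar i00$ - $2\beta_*^{11}$: $\bar i010\,|\,0\bar i\bar i0\,|\,0\bar10\bar1\,|\,1i\bar1\bar1\,|\,0i\bar10\,|\,001\bar i\,|\,00\bar1\bar1$ - $2\beta_*^{12}$: $\bar1\bar11i\,|\,0i\bar10\,|\,001i\,|\,00\bar ii\,|\,i010\,|\,\bar100\bar1\,|\,10\bar10$ - $2\beta_*^{13}$: $0i\bar10\,|\,00\bar1\bar i\,|\,i\bar i00\,|\,i0\bar10\,|\,\bar i00\bar i\,|\,0i0i\,|\,\bar i\bar i\bar1i$ **Theorem.** For every $g\in R$ and every vertex $[\lambda,B]$ of $\Xi$, the pair $[g\lambda,gB]$ is a vertex of $\Xi$ in the same connected component as $[\lambda,B]$.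 The vector $\varrho$ is invariant for the action of the Rudvalis group $\mathrm{Ru}$ on $\bigwedge^{14}(\mathfrak r)$. -/

import Mathlib

open scoped ComplexConjugate

noncomputable section

namespace ConwayWales

/-! ## The Conway–Wales lattice -/

/-- The complex space `𝔯 = ℂ ⊗ Λ` of dimension 28, in the coordinates in which a vector is a
7-tuple of complexified quaternions (row = quaternionic coordinate, column = coefficient of
`1, j, k, l`). -/
abbrev V : Type := EuclideanSpace ℂ (Fin 7 × Fin 4)

/-- The Hermitian form `(x, y) = ∑ xₖ * conj yₖ`, linear in the FIRST argument. -/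
def herm (x y : V) : ℂ := inner ℂ y x

/-- `7 × 4` arrays of Gaussian integers; they hold the DOUBLED coordinates of vectors. -/
abbrev Array74 : Type := Matrix (Fin 7) (Fin 4) GaussianInt

/-- The vector `½ M`. -/
def toV (M : Array74) : V :=
  WithLp.toLp 2 fun p => GaussianInt.toComplex (M p.1 p.2) / 2

/-- The Gaussian integer `i`. -/
abbrev i : GaussianInt := ⟨0, 1⟩

/-- Twice the vectors `β_*¹, …, β_*¹³` of the M-set `B_*`. -/
def betaArr : Fin 13 → Array74 :=
  ![!![0, 0, 0, 0; 0, 0, 0, 0; 4, 0, 0, 0; 0, 0, 0, 0; 0, 0, 0, 0; 0, 0, 0, 0; 0, 0, 0, 0],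
    !![0, 0, 0, 0; 0, 0, 0, 0; -i, -1, i, -1; 0, 0, 0, 0; 1, 1, -i, i; 1, i, i, -1; -1, -1, -1, -1],
    !![-1, i, 0, 0; 0, 0, i, -i; 0, i, 0, -1; 0, i, -i, 0; 0, -1, 0, 1; -1, 1, 1, -i; 0, i, -1, 0],
    !![0, 0, i, -1; 0, 0, -1, -1; 0, 1, 0, i; i, 0, 0, i; 0, i, 0, -i; i, -1, i, i; 0, i, -1, 0],
    !![0, i, i, 0; 0, -1, 0, 1; 1, 1, i, 1; 0, i, -1, 0; 0, 0, -i, -1; -i, i, 0, 0; 0, 1, 0, i],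
    !![1, 0, 0, -1; 0, 1, 0, 1; 1, -1, 1, -i; 0, 1, i, 0; 1, i, 0, 0; 0, 0, 1, -1; i, 0, -1, 0],
    !![-1, 0, 0, i; 0, 0, 1, -i; 0, 0, 1, -1; 0, -1, 0, i; 0, i, -i, 0; 0, i, 0, -i; 1, -1, i, -1],
    !![i, i, i, -1; 0, i, -1, 0; 0, 0, -i, -1; 0, 0, -i, i; 0, 1, 0, -i; 0, 1, 1, 0; -i, 0, -i, 0],
    !![1, 0, 0, i; 0, 0, -1, -i; 1, 1, 0, 0; 0, -1, 0, i; 0, -1, -1, 0; 1, 0, -1, 0; -1, 1, -1, i],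
    !![1, 0, i, 0; 0, -i, i, 0; 1, 0, 1, 0; -1, i, -i, -i; 0, 1, -i, 0; 0, 0, i, -1; i, -i, 0, 0],
    !![-i, 0, 1, 0; 0, -i, -i, 0; 0, -1, 0, -1; 1, i, -1, -1; 0, i, -1, 0; 0, 0, 1, -i; 0, 0, -1, -1],
    !![-1, -1, 1, i; 0, i, -1, 0; 0, 0, 1, i; 0, 0, -i, i; i, 0, 1, 0; -1, 0, 0, -1; 1, 0, -1, 0],
    !![0, i, -1, 0; 0, 0, -1, -i; i, -i, 0, 0; i, 0, -1, 0; -i, 0, 0, -i; 0, i, 0, i; -i, -i, -1, i]]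

/-- Twice the vectors `γ_*¹, …, γ_*¹³` of the M-set `C_*`. -/
def gammaArr : Fin 13 → Array74 :=
  ![!![0, 0, 1, 1; 0, i, 0, -1; i, 0, 0, -i; -1, 0, -1, 0; 1, i, -i, i; i, 0, 0, 1; 0, 0, -i, 1],
    !![-1, -i, 0, 0; 0, 0, -1, 1; i, 0, -1, 0; -1, 0, 0, 1; 0, 1, 0, 1; 1, -1, 1, -i; 0, 1, i, 0],
    !![0, -i, 0, -1; 0, -1, 1, 0; 0, 1, 0, -1; i, -i, -1, -i; i, 0, 0, 1; 0, 0, -i, -1; 0, 0, -i, i],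
    !![0, 0, i, 1; 0, 0, -i, i; 0, -i, 0, -1; 0, -1, 1, 0; 0, -1, 0, 1; -i, i, 1, i; i, 0, 0, 1],
    !![0, 1, 0, i; 0, 1, -1, 0; -i, 0, i, 0; -1, -1, -1, -i; 0, i, 1, 0; 0, 0, -i, 1; 0, 0, -i, -i],
    !![i, -i, i, 1; 0, i, -1, 0; i, -1, 0, 0; 0, 0, i, -i; -1, 0, -i, 0; i, 0, 0, -i; 0, i, 0, i],
    !![-1, -1, 0, 0; 0, -i, 0, 1; 0, i, -i, 0; 0, -i, 0, -i; i, i, -i, 1; 1, 0, 0, i; -i, 1, 0, 0],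
    !![0, 1, 0, -i; 0, -1, -1, 0; 0, 1, 0, -1; -i, -i, i, -1; i, 0, 0, 1; -1, i, 0, 0; i, -i, 0, 0],
    !![0, 0, 1, i; 0, 0, i, i; 0, -i, 0, 1; -1, 0, 0, -1; 0, -1, 0, 1; 1, i, 1, 1; 0, -1, -i, 0],
    !![0, 0, -1, 1; 0, i, 0, -1; 0, -1, -1, 0; -1, 0, -1, 0; i, i, 1, -i; 1, 0, 0, -i; i, 1, 0, 0],
    !![0, -i, i, 0; 0, 1, 0, 1; i, i, -1, i; 0, -i, -1, 0; 0, 0, -i, 1; -i, -i, 0, 0; 0, -1, 0, i],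
    !![0, -1, 0, -i; 0, -i, -i, 0; -i, 0, -i, 0; -1, -1, i, 1; i, 0, 0, 1; -1, i, 0, 0; 0, 0, -i, i],
    !![-i, 1, i, i; 0, -i, -1, 0; 0, 0, -1, -i; 0, 0, 1, -1; i, 0, 1, 0; 0, i, -i, 0; 0, -1, 0, 1]]

/-- Twice the first neighbor `μ_*` of `B_*`. -/
def muArr : Array74 :=
  !![0, i, 0, -1; i, 0, 0, -i; 1, 0, 1, 0; 1, i, -i, i; -i, 0, 0, -1; 0, 0, i, -1; 0, 0, -1, -1]

/-- Twice the second neighbor `μ_*'` of `B_*`. -/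
def muArr' : Array74 :=
  !![0, 0, i, i; i, 0, -1, 0; 1, 0, 0, -1; -1, 0, -1, 0; i, i, -i, 1; 0, i, 1, 0; 0, 0, -1, i]

/-- Twice the positive complement `λ_*` of `B_*`. -/
def lambdaArr : Array74 :=
  !![0, 0, 0, 0; 4, 0, 0, 0; 0, 0, 0, 0; 0, 0, 0, 0; 0, 0, 0, 0; 0, 0, 0, 0; 0, 0, 0, 0]

/-- Twice the negative complement `λ_*'` of `B_*`. -/
def lambdaArr' : Array74 :=
  !![-1, 1, 1, -i; 1, 0, 0, -i; 0, 0, -i, 1; 1, -1, 0, 0; -i, 0, 1, 0; 1, 0, 0, -1; i, 0, -i, 0]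

/-- `𝔯` as a module over the Gaussian integers. -/
instance : Module GaussianInt V := Module.compHom V GaussianInt.toComplex

/-- Twice the coordinate vector `2 e_p`. -/
def coordArr (p : Fin 7 × Fin 4) : Array74 := Matrix.single p.1 p.2 4

/-- The Conway–Wales lattice `Λ`: the `ℤ[i]`-module generated by the 28 vectors `2 e_p` and the
vectors tabulated above. It is the unimodular Hermitian `ℤ[i]`-lattice of rank 28 with minimal norm
`4` and `4 · 4060` vectors of norm `4`. -/
def lattice : Submodule GaussianInt V :=
  Submodule.span GaussianInt
    (Set.range (fun p => toV (coordArr p)) ∪ Set.range (fun k => toV (betaArr k)) ∪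
      Set.range (fun k => toV (gammaArr k)) ∪
      {toV muArr, toV muArr', toV lambdaArr, toV lambdaArr'})

/-- The set `Λ₂` of type 2 ("sacred") vectors: those `x ∈ Λ` with `(x, x) = 4`. -/
def sacred : Set V := {x | x ∈ lattice ∧ herm x x = 4}

/-- `R̃ = Aut(Λ)`: the unitary transformations of `𝔯` that preserve the set `Λ`. -/
def autLattice : Subgroup (V ≃ₗᵢ[ℂ] V) where
  carrier := {g | ∀ x, g x ∈ lattice ↔ x ∈ lattice}
  one_mem' := fun _ => Iff.rfl
  mul_mem' := fun {_ h} hg hh x => (hg (h x)).trans (hh x)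
  inv_mem' := fun {g} hg x => by
    have := hg (g.symm x)
    rw [g.apply_symm_apply] at this
    exact this.symm

/-- The subgroup `R ≅ 2.Ru` of `R̃`. Since `R̃ = 4 ∘ (2.Ru)` is the central product of the group
of scalars `⟨i⟩` and the perfect group `2.Ru`, its only subgroup isomorphic to `2.Ru` is its
commutator subgroup. -/
def R : Subgroup (V ≃ₗᵢ[ℂ] V) := ⁅autLattice, autLattice⁆

/-- The central subgroup `{± Id}` of `R`. -/
def signs : Subgroup R := (Subgroup.zpowers (LinearIsometryEquiv.neg ℂ (E := V))).subgroupOf R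

lemma mem_signs (g : R) (hg : g ∈ signs) :
    (g : V ≃ₗᵢ[ℂ] V) = 1 ∨ (g : V ≃ₗᵢ[ℂ] V) = LinearIsometryEquiv.neg ℂ := by
  obtain ⟨n, hn⟩ := Subgroup.mem_zpowers_iff.1 (Subgroup.mem_subgroupOf.1 hg)
  have h2 : (LinearIsometryEquiv.neg ℂ (E := V)) ^ (2 : ℤ) = 1 := by
    rw [zpow_ofNat, pow_two]
    ext1 x
    exact neg_neg x
  rcases Int.even_or_odd n with ⟨m, hm⟩ | ⟨m, hm⟩
  · left
    rw [← hn, hm, ← two_mul, zpow_mul, h2, one_zpow]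
  · right
    rw [← hn, hm, zpow_add, zpow_mul, h2, one_zpow, one_mul, zpow_one]

instance : signs.Normal where
  conj_mem := fun n hn g => by
    have : g * n * g⁻¹ = n := by
      have hc : g * n = n * g := by
        apply Subtype.ext
        rcases mem_signs n hn with h | h
        · simp [h]
        · simp only [Subgroup.coe_mul, h]
          ext1 x
          exact map_neg (g : V ≃ₗᵢ[ℂ] V) x
      rw [hc, mul_inv_cancel_right]
    rwa [this]

/-- The Rudvalis group, `Ru = R / {± Id}`. -/
abbrev Ru : Type := R ⧸ signs

/-! ## The graphs `Γ(X)` and `Δ(X)`, and M-sets -/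

/-- `Γ(X)`: vertices the elements of `X`, with `x`, `y` joined when `(x, y) = 1`. -/
def Gamma (X : Set V) : SimpleGraph X where
  Adj x y := x ≠ y ∧ herm x y = 1
  symm := ⟨fun x y h => ⟨h.1.symm, by
    have := congrArg conj h.2
    simpa [herm, inner_conj_symm] using this⟩⟩
  loopless := ⟨fun _ h => h.1 rfl⟩

/-- `Δ(X)`: vertices the elements of `X`, with an arc from `x` to `y` when `(x, y) = i`. -/
def Delta (X : Set V) : Digraph X where
  Adj x y := herm x y = Complex.I

/-- The 1-skeleton of the 2-dimensional complex whose triangles are the members of `T`. -/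
def skeleton {n : ℕ} (T : Finset (Finset (Fin n))) : SimpleGraph (Fin n) where
  Adj x y := x ≠ y ∧ ∃ t ∈ T, x ∈ t ∧ y ∈ t
  symm := ⟨fun _ _ ⟨h, t, ht, hx, hy⟩ => ⟨h.symm, t, ht, hy, hx⟩⟩
  loopless := ⟨fun _ h => h.1 rfl⟩

/-- The triangles of `T` can be coherently oriented: `P x y z` says that the cyclic order
`x → y → z → x` is the chosen orientation of the triangle `{x, y, z}`, and two triangles that share
an edge induce opposite directions on it. -/
def IsOrientable {n : ℕ} (T : Finset (Finset (Fin n))) : Prop :=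
  ∃ P : Fin n → Fin n → Fin n → Prop,
    (∀ x y z, {x, y, z} ∈ T → P x y z → P y z x) ∧
    (∀ x y z, {x, y, z} ∈ T → Xor (P x y z) (P y x z)) ∧
    (∀ x y z z', {x, y, z} ∈ T → {x, y, z'} ∈ T → P x y z → P x y z' → z = z')

/-- The simplicial complex with vertex set `Fin n` and triangles `T` is a triangulated Möbius band:
a connected compact surface (edges lie in at most two triangles, vertex links are connected) with
non-empty boundary, Euler characteristic `0`, and not orientable. -/
structure IsMobiusBand {n : ℕ} (T : Finset (Finset (Fin n))) : Prop where
  card_triangle : ∀ t ∈ T, t.card = 3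
  covers : ∀ x, ∃ t ∈ T, x ∈ t
  connected : (skeleton T).Connected
  edge_le_two : ∀ x y, x ≠ y → (T.filter fun t => x ∈ t ∧ y ∈ t).card ≤ 2
  link_connected : ∀ x, ∀ S ⊆ T.filter (fun t => x ∈ t), S.Nonempty →
    S ≠ T.filter (fun t => x ∈ t) →
      ∃ s ∈ S, ∃ t ∈ T.filter (fun t => x ∈ t), t ∉ S ∧ (s ∩ t).card = 2
  boundary : ∃ x y, x ≠ y ∧ (T.filter fun t => x ∈ t ∧ y ∈ t).card = 1
  euler : (n : ℤ) - ((Finset.univ.powersetCard 2).filter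
    fun e : Finset (Fin n) => ∃ t ∈ T, e ⊆ t).card + T.card = 0
  not_orientable : ¬ IsOrientable T

/-- An M-set: a set `B` of sacred vectors such that `Γ(B)` is a triangulation of a Möbius band with
13 triangles, and `Δ(B)` is an oriented triangulation of a circle with 13 arcs. -/
structure IsMSet (B : Set V) : Prop where
  subset : B ⊆ sacred
  gamma : ∃ (n : ℕ) (T : Finset (Finset (Fin n))),
    IsMobiusBand T ∧ T.card = 13 ∧ Nonempty (Gamma B ≃g skeleton T)
  delta : ∃ e : Fin 13 ≃ B, ∀ j k, (Delta B).Adj (e j) (e k) ↔ k = j + 1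

/-- `b` is an oriented labeling `β¹, …, β¹³` of `B`. -/
structure IsOrientedLabeling (b : Fin 13 → V) (B : Set V) : Prop where
  injective : Function.Injective b
  range_eq : Set.range b = B
  oriented : ∀ k : Fin 12, herm (b k.castSucc) (b k.succ) = Complex.I

lemma IsMSet.exists_labeling {B : Set V} (hB : IsMSet B) : ∃ b, IsOrientedLabeling b B := by
  obtain ⟨e, he⟩ := hB.delta
  refine ⟨fun k => (e k : V), ?_, ?_, ?_⟩
  · exact Subtype.val_injective.comp e.injective
  · have h : (fun k => (e k : V)) = Subtype.val ∘ e := rfl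
    rw [h, e.surjective.range_comp, Subtype.range_coe]
  · intro k
    refine (he k.castSucc k.succ).2 ?_
    revert k
    decide

/-! ## Neighbors, complements, right partners -/

/-- `μ` is a sacred vector with `(B, μ) = {1}`. -/
def IsNeighbor (μ : V) (B : Set V) : Prop := μ ∈ sacred ∧ ∀ β ∈ B, herm β μ = 1

/-- `μ` is the first and `μ'` the second neighbor to `B`. -/
def AreNeighbors (μ μ' : V) (B : Set V) : Prop :=
  IsNeighbor μ B ∧ IsNeighbor μ' B ∧ herm μ μ' = Complex.I

/-- `μ` is the first neighbor to `B`. -/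
def IsFirstNeighbor (μ : V) (B : Set V) : Prop := ∃ μ', AreNeighbors μ μ' B

/-- `x` is a complement to `B`: a sacred vector with `(B, x) = {0}`. -/
def IsComplement (x : V) (B : Set V) : Prop := x ∈ sacred ∧ ∀ β ∈ B, herm β x = 0

/-- `x` is a positive complement to `B`: `(x, μ) / (x, μ') = 1` for the neighbors `μ`, `μ'`. -/
def IsPosComplement (x : V) (B : Set V) : Prop :=
  IsComplement x B ∧ ∃ μ μ', AreNeighbors μ μ' B ∧ herm x μ / herm x μ' = 1

/-- `x` is a negative complement to `B`: `(x, μ) / (x, μ') = -1` for the neighbors `μ`, `μ'`. -/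
def IsNegComplement (x : V) (B : Set V) : Prop :=
  IsComplement x B ∧ ∃ μ μ', AreNeighbors μ μ' B ∧ herm x μ / herm x μ' = -1

/-- The sequence `(-i, -i, 0, 0, i, -i, 0, 0, 0, 0, -i, i, 0)`. -/
def partnerSeq : Fin 13 → ℂ :=
  ![-Complex.I, -Complex.I, 0, 0, Complex.I, -Complex.I, 0, 0, 0, 0, -Complex.I, Complex.I, 0]

/-- `C` is the right partner to `B`: it consists of all the sacred vectors `γ` for which the
sequence `(βᵏ, γ)` is a cyclic permutation of `partnerSeq`. -/
def IsRightPartner (C B : Set V) : Prop :=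
  ∃ b, IsOrientedLabeling b B ∧
    C = {γ | γ ∈ sacred ∧ ∃ s : Fin 13, ∀ k : Fin 13, herm (b k) γ = partnerSeq (k + s)}

/-! ## The graph `Ξ` and the vector `ϱ` -/

/-- The vertices `[λ, B]` of `Ξ`: an M-set `B` with a positive complement `λ`. -/
@[ext]
structure XiVertex where
  vec : V
  set : Set V
  isMSet : IsMSet set
  isPos : IsPosComplement vec set

/-- Condition `(Ξ1)`: `λ₀ = u λ₁` and `B₀ = ū B₁` for a unit `u` of `ℤ[i]`. -/
def Xi1 (v w : XiVertex) : Prop :=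
  ∃ u : GaussianIntˣ, v.vec = GaussianInt.toComplex u • w.vec ∧
    v.set = (fun x => conj (GaussianInt.toComplex u) • x) '' w.set

/-- Condition `(Ξ2)`: `λ₀ = λ₁` and `(λ₀, μ₀) = (λ₀, μ₁)` for the first neighbors `μ₀`, `μ₁`. -/
def Xi2 (v w : XiVertex) : Prop :=
  v.vec = w.vec ∧ ∃ μ₀ μ₁, IsFirstNeighbor μ₀ v.set ∧ IsFirstNeighbor μ₁ w.set ∧
    herm v.vec μ₀ = herm v.vec μ₁

/-- Condition `(Ξ3)`: `λ₁` is the negative complement to `B₀` with `(λ₀, λ₁) = -i`, and `B₁` is the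
right partner to `B₀`. -/
def Xi3 (v w : XiVertex) : Prop :=
  IsNegComplement w.vec v.set ∧ herm v.vec w.vec = -Complex.I ∧ IsRightPartner w.set v.set

/-- The undirected graph `Ξ`. -/
def Xi : SimpleGraph XiVertex := SimpleGraph.fromRel fun v w => Xi1 v w ∨ Xi2 v w ∨ Xi3 v w

/-- `a_{[λ, B]} = λ ∧ β¹ ∧ ⋯ ∧ β¹³` in `⋀¹⁴ 𝔯`, for any oriented labeling of `B`
(see `wedge_eq`). -/
def wedge (v : XiVertex) : ⋀[ℂ]^14 V :=
  exteriorPower.ιMulti ℂ 14 (Matrix.vecCons v.vec v.isMSet.exists_labeling.choose)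

/-- Oriented labelings of an M-set agree up to a cyclic permutation. -/
lemma IsMSet.labeling_cyclic {B : Set V} (hB : IsMSet B) {b b' : Fin 13 → V}
    (hb : IsOrientedLabeling b B) (hb' : IsOrientedLabeling b' B) :
    ∃ s : Fin 13, ∀ k, b' k = b (k + s) := by
  obtain ⟨e, he⟩ := hB.delta
  have key : ∀ c : Fin 13 → V, IsOrientedLabeling c B →
      ∃ s : Fin 13, ∀ k : Fin 13, c k = (e (k + s) : V) := by
    intro c hc
    have hmem : ∀ k, c k ∈ B := fun k => hc.range_eq ▸ Set.mem_range_self k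
    choose f hf using fun k => e.surjective ⟨c k, hmem k⟩
    have hf' : ∀ k, (e (f k) : V) = c k := fun k => congrArg Subtype.val (hf k)
    have hstep : ∀ k : Fin 12, f k.succ = f k.castSucc + 1 := by
      intro k
      refine (he _ _).1 ?_
      change herm (e (f k.castSucc) : V) (e (f k.succ) : V) = Complex.I
      rw [hf', hf']
      exact hc.oriented k
    have hsucc : ∀ k : Fin 12, k.succ = k.castSucc + 1 := by decide
    have hall : ∀ k, f k = k + f 0 := by
      intro k
      induction k using Fin.induction with
      | zero => exact (zero_add (f 0)).symm
      | succ k ih => rw [hstep, ih, hsucc, add_right_comm]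
    exact ⟨f 0, fun k => by rw [← hall k, hf']⟩
  obtain ⟨s, hs⟩ := key b hb
  obtain ⟨s', hs'⟩ := key b' hb'
  refine ⟨s' - s, fun k => ?_⟩
  rw [hs', hs]
  congr 2
  abel

lemma sign_addRight (s : Fin 13) : Equiv.Perm.sign (Equiv.addRight s) = 1 := by
  revert s
  decide +kernel

/-- `a_{[λ, B]}` does not depend on the oriented labeling. -/
lemma wedge_eq (v : XiVertex) {b : Fin 13 → V} (hb : IsOrientedLabeling b v.set) :
    wedge v = exteriorPower.ιMulti ℂ 14 (Matrix.vecCons v.vec b) := by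
  obtain ⟨s, hs⟩ := v.isMSet.labeling_cyclic hb v.isMSet.exists_labeling.choose_spec
  have h1 : v.isMSet.exists_labeling.choose = b ∘ Equiv.addRight s := funext hs
  have h2 := ((exteriorPower.ιMulti ℂ 14 (M := V)).curryLeft v.vec).map_perm b (Equiv.addRight s)
  rw [sign_addRight, one_smul] at h2
  rw [wedge, h1]
  exact h2

lemma exists_coord {x : V} (hx : x ∈ lattice) (p : Fin 7 × Fin 4) :
    ∃ z : GaussianInt, x p = GaussianInt.toComplex z / 2 := by
  induction hx using Submodule.span_induction with
  | mem x hx =>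
    have : ∃ M, x = toV M := by
      rcases hx with ((⟨q, rfl⟩ | ⟨q, rfl⟩) | ⟨q, rfl⟩) | rfl | rfl | rfl | rfl <;> exact ⟨_, rfl⟩
    obtain ⟨M, rfl⟩ := this
    exact ⟨M p.1 p.2, rfl⟩
  | zero => exact ⟨0, by simp⟩
  | add x y _ _ hx hy =>
    obtain ⟨z, hz⟩ := hx
    obtain ⟨w, hw⟩ := hy
    exact ⟨z + w, by simp [hz, hw, add_div]⟩
  | smul c x _ hx =>
    obtain ⟨z, hz⟩ := hx
    refine ⟨c * z, ?_⟩
    change GaussianInt.toComplex c * x p = _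
    rw [hz, map_mul, mul_div_assoc]

/-- There are only finitely many sacred vectors. -/
lemma finite_sacred : sacred.Finite := by
  let F : (Fin 7 × Fin 4 → Set.Icc (-4 : ℤ) 4 × Set.Icc (-4 : ℤ) 4) → V := fun f =>
    WithLp.toLp 2 fun p => GaussianInt.toComplex ⟨(f p).1, (f p).2⟩ / 2
  refine (Set.finite_range F).subset fun x hx => ?_
  choose z hz using exists_coord hx.1
  have hnorm : ‖x‖ ^ 2 = 4 := by
    have h := hx.2
    rw [herm, inner_self_eq_norm_sq_to_K] at h
    have h' : ((‖x‖ ^ 2 : ℝ) : ℂ) = ((4 : ℝ) : ℂ) := by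
      push_cast
      exact h
    exact Complex.ofReal_injective h'
  have hb : ∀ p, (z p).re * (z p).re + (z p).im * (z p).im ≤ 16 := by
    intro p
    have h1 : ‖x p‖ ^ 2 ≤ 4 := by
      rw [← hnorm, EuclideanSpace.norm_sq_eq]
      exact Finset.single_le_sum (f := fun q => ‖x q‖ ^ 2) (fun q _ => sq_nonneg _)
        (Finset.mem_univ p)
    rw [hz p, norm_div, div_pow, ← Complex.normSq_eq_norm_sq, Complex.normSq_apply,
      ← GaussianInt.intCast_re, ← GaussianInt.intCast_im, Complex.norm_two] at h1
    have h2 : ((z p).re : ℝ) * (z p).re + (z p).im * (z p).im ≤ 16 := by linarith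
    exact_mod_cast h2
  refine ⟨fun p => (⟨(z p).re, ?_, ?_⟩, ⟨(z p).im, ?_, ?_⟩), ?_⟩
  · nlinarith [hb p]
  · nlinarith [hb p]
  · nlinarith [hb p]
  · nlinarith [hb p]
  · ext p
    exact (hz p).symm

instance : Finite XiVertex := by
  have h1 : Finite sacred := finite_sacred
  have h2 : Finite (𝒫 sacred) := finite_sacred.finite_subsets
  refine Finite.of_injective (β := sacred × 𝒫 sacred)
    (fun v => (⟨v.vec, v.isPos.1.1⟩, ⟨v.set, v.isMSet.subset⟩)) fun v w h => ?_
  exact XiVertex.ext (congrArg (fun q => (q.1 : V)) h) (congrArg (fun q => (q.2 : Set V)) h)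

/-! ## The distinguished vertex `[λ_*, B_*]` -/

/-- The set `B_*`. -/
def BStar : Set V := Set.range fun k => toV (betaArr k)

/-- The Hermitian product of two arrays. -/
def ipArr (M N : Array74) : GaussianInt := ∑ r, ∑ c, M r c * star (N r c)

lemma toComplex_four : GaussianInt.toComplex 4 = 4 := map_ofNat _ 4

lemma herm_toV (M N : Array74) (z : GaussianInt) (h : ipArr M N = 4 * z) :
    herm (toV M) (toV N) = GaussianInt.toComplex z := by
  have h1 : herm (toV M) (toV N) = GaussianInt.toComplex (ipArr M N) / 4 := by
    simp only [herm, toV, PiLp.inner_apply, ipArr, map_sum, map_mul, Fintype.sum_prod_type,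
      RCLike.inner_apply, Finset.sum_div]
    refine Finset.sum_congr rfl fun r _ => Finset.sum_congr rfl fun c _ => ?_
    rw [GaussianInt.toComplex_star, map_div₀, Complex.conj_ofNat]
    ring
  rw [h1, h, map_mul, toComplex_four, mul_div_cancel_left₀ _ (by norm_num)]

/-- The inner products `(β_*ʲ, β_*ᵏ)` as a function of `k - j`. -/
def betaSeq : Fin 13 → GaussianInt := ![4, i, 0, 0, 1, 1, 0, 0, 1, 1, 0, 0, -i]

lemma herm_beta (j k : Fin 13) :
    herm (toV (betaArr j)) (toV (betaArr k)) = GaussianInt.toComplex (betaSeq (k - j)) := by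
  refine herm_toV _ _ _ ?_
  revert j k
  decide +kernel

lemma beta_injective : Function.Injective fun k => toV (betaArr k) := by
  intro j k h
  have h0 : ∀ j k : Fin 13, betaSeq (j - j) = betaSeq (k - j) → j = k := by decide +kernel
  have h1 := herm_beta j k
  rw [show toV (betaArr k) = toV (betaArr j) from h.symm, herm_beta, GaussianInt.toComplex_inj] at h1
  exact h0 j k h1

lemma beta_mem (k : Fin 13) : toV (betaArr k) ∈ sacred := by
  refine ⟨Submodule.subset_span (Or.inl (Or.inl (Or.inr ⟨k, rfl⟩))), ?_⟩
  rw [herm_toV _ _ 4 (by revert k; decide +kernel), toComplex_four]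

/-- The labeling of `B_*`. -/
def betaEquiv : Fin 13 ≃ BStar := Equiv.ofInjective _ beta_injective

lemma coe_betaEquiv (k : Fin 13) : (betaEquiv k : V) = toV (betaArr k) := rfl

/-- The 13 triangles of `Γ(B_*)`. -/
def strip : Finset (Finset (Fin 13)) := Finset.univ.image fun x => {x, x + 4, x + 8}

lemma strip_mem (x : Fin 13) : {x, x + 4, x + 8} ∈ strip :=
  Finset.mem_image_of_mem _ (Finset.mem_univ x)

lemma strip_not_orientable : ¬ IsOrientable strip := by
  rintro ⟨P, h1, h2, h3⟩
  have m1 : ∀ x : Fin 13, {x, x + 4, x + 8} ∈ strip := by decide +kernel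
  have m2 : ∀ x : Fin 13, {x + 4, x + 8, x} ∈ strip := by decide +kernel
  have m3 : ∀ x : Fin 13, {x + 4, x + 8, x + 12} ∈ strip := by decide +kernel
  have m4 : ∀ x : Fin 13, {x + 4, x, x + 8} ∈ strip := by decide +kernel
  have m5 : ∀ x : Fin 13, {x, x + 8, x + 4} ∈ strip := by decide +kernel
  have m6 : ∀ x : Fin 13, {x + 8, x + 4, x} ∈ strip := by decide +kernel
  have m7 : ∀ x : Fin 13, {x + 8, x + 4, x + 12} ∈ strip := by decide +kernel
  have hne : ∀ x : Fin 13, x ≠ x + 12 := by decide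
  have step : ∀ x : Fin 13, P (x + 4) (x + 8) (x + 12) ↔ ¬ P x (x + 4) (x + 8) := by
    intro x
    constructor
    · intro h h'
      exact hne x (h3 _ _ _ _ (m2 x) (m3 x) (h1 _ _ _ (m1 x) h') h)
    · intro h
      by_contra h'
      have a1 : P (x + 4) x (x + 8) := by
        rcases h2 _ _ _ (m1 x) with h | h
        · exact absurd h.1 (by assumption)
        · exact h.1
      have a2 : P (x + 8) (x + 4) (x + 12) := by
        rcases h2 _ _ _ (m3 x) with h | h
        · exact absurd h.1 (by assumption)
        · exact h.1
      exact hne x (h3 _ _ _ _ (m6 x) (m7 x) (h1 _ _ _ (m5 x) (h1 _ _ _ (m4 x) a1)) a2)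
  have two : ∀ x : Fin 13, P (x + 8) (x + 12) (x + 3) ↔ P x (x + 4) (x + 8) := by
    intro x
    have e1 : x + 4 + 4 = x + 8 := by rw [add_assoc]; rfl
    have e2 : x + 4 + 8 = x + 12 := by rw [add_assoc]; rfl
    have e3 : x + 4 + 12 = x + 3 := by rw [add_assoc]; rfl
    have h := step (x + 4)
    rw [e1, e2, e3, step x, not_not] at h
    exact h
  have s := step 0
  have t1 := two 0
  have t2 := two 8
  have t3 := two 3
  have t4 := two 11
  have t5 := two 6
  have t6 := two 1
  have t7 := two 9
  simp only [Fin.reduceAdd, zero_add] at s t1 t2 t3 t4 t5 t6 t7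
  have h := ((((((t7.trans t6).trans t5).trans t4).trans t3).trans t2).trans t1)
  exact iff_not_self (h.symm.trans s)

lemma skeleton_strip_connected : (skeleton strip).Connected := by
  have hadj : ∀ x : Fin 13, (skeleton strip).Adj x (x + 4) := fun x =>
    ⟨by revert x; decide, _, strip_mem x, by simp, by simp⟩
  have hr : ∀ k : Fin 13, (skeleton strip).Reachable 0 (4 * k) := by
    intro k
    induction k using Fin.induction with
    | zero => rfl
    | succ k ih =>
      have e : ∀ k : Fin 12, 4 * k.succ = 4 * k.castSucc + 4 := by decide
      rw [e]
      exact ih.trans (hadj _).reachable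
  have hr0 : ∀ x, (skeleton strip).Reachable 0 x := by
    intro x
    have e : ∀ x : Fin 13, 4 * (10 * x) = x := by decide
    rw [← e x]
    exact hr _
  exact { preconnected := fun x y => (hr0 x).symm.trans (hr0 y), nonempty := ⟨0⟩ }

lemma strip_isMobiusBand : IsMobiusBand strip where
  card_triangle := by
    have h : ∀ x : Fin 13, ({x, x + 4, x + 8} : Finset (Fin 13)).card = 3 := by decide
    intro t ht
    obtain ⟨x, _, rfl⟩ := Finset.mem_image.1 ht
    exact h x
  covers := by decide +kernel
  connected := skeleton_strip_connected
  edge_le_two := by decide +kernel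
  link_connected := by
    have hmid : ∀ x : Fin 13, {x + 9, x, x + 4} ∈ strip.filter (fun t => x ∈ t) := by
      decide +kernel
    have hcard : ∀ x : Fin 13, ∀ t ∈ strip.filter (fun t => x ∈ t), t ≠ {x + 9, x, x + 4} →
        (t ∩ {x + 9, x, x + 4}).card = 2 := by
      have h : ∀ x y : Fin 13, x ∈ ({y, y + 4, y + 8} : Finset (Fin 13)) →
          ({y, y + 4, y + 8} : Finset (Fin 13)) ≠ {x + 9, x, x + 4} →
          (({y, y + 4, y + 8} : Finset (Fin 13)) ∩ {x + 9, x, x + 4}).card = 2 := by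
        decide +kernel
      intro x t ht
      obtain ⟨ht, hx⟩ := Finset.mem_filter.1 ht
      obtain ⟨y, _, rfl⟩ := Finset.mem_image.1 ht
      exact h x y hx
    intro x S hS hne hS'
    by_cases hm : {x + 9, x, x + 4} ∈ S
    · obtain ⟨t, ht, htS⟩ := Finset.exists_of_ssubset (hS.ssubset_of_ne hS')
      refine ⟨_, hm, t, ht, htS, ?_⟩
      rw [Finset.inter_comm]
      exact hcard x t ht fun h => htS (h ▸ hm)
    · obtain ⟨s, hs⟩ := hne
      exact ⟨s, hs, _, hmid x, hm, hcard x s (hS hs) fun h => hm (h ▸ hs)⟩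
  boundary := by decide +kernel
  euler := by decide +kernel
  not_orientable := strip_not_orientable

lemma BStar_isMSet : IsMSet BStar where
  subset := by
    rintro _ ⟨k, rfl⟩
    exact beta_mem k
  gamma := by
    refine ⟨13, strip, strip_isMobiusBand, by decide +kernel, ⟨RelIso.symm ⟨betaEquiv, ?_⟩⟩⟩
    intro j k
    have h : ∀ j k : Fin 13, (j ≠ k ∧ betaSeq (k - j) = 1) ↔
        (j ≠ k ∧ ∃ t ∈ strip, j ∈ t ∧ k ∈ t) := by
      decide +kernel
    change betaEquiv j ≠ betaEquiv k ∧ herm (toV (betaArr j)) (toV (betaArr k)) = 1 ↔ _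
    rw [herm_beta, ← map_one GaussianInt.toComplex, GaussianInt.toComplex_inj,
      betaEquiv.injective.ne_iff]
    exact h j k
  delta := by
    refine ⟨betaEquiv, fun j k => ?_⟩
    have h : ∀ j k : Fin 13, betaSeq (k - j) = i ↔ k = j + 1 := by decide +kernel
    change herm (toV (betaArr j)) (toV (betaArr k)) = Complex.I ↔ _
    rw [herm_beta, show Complex.I = GaussianInt.toComplex i by simp [GaussianInt.toComplex_def],
      GaussianInt.toComplex_inj]
    exact h j k

lemma mem_sacred_of {M : Array74} (h : toV M ∈ ({toV muArr, toV muArr', toV lambdaArr,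
    toV lambdaArr'} : Set V)) (hM : ipArr M M = 4 * 4) : toV M ∈ sacred :=
  ⟨Submodule.subset_span (Or.inr h), by rw [herm_toV _ _ _ hM, toComplex_four]⟩

/-- The vertex `[λ_*, B_*]` of `Ξ`. -/
def xiStar : XiVertex where
  vec := toV lambdaArr
  set := BStar
  isMSet := BStar_isMSet
  isPos := by
    refine ⟨⟨mem_sacred_of (by simp) (by decide +kernel), ?_⟩, toV muArr, toV muArr',
      ⟨⟨mem_sacred_of (by simp) (by decide +kernel), ?_⟩,
        ⟨mem_sacred_of (by simp) (by decide +kernel), ?_⟩, ?_⟩, ?_⟩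
    · rintro _ ⟨k, rfl⟩
      rw [herm_toV _ _ 0 (by revert k; decide +kernel), map_zero]
    · rintro _ ⟨k, rfl⟩
      rw [herm_toV _ _ 1 (by revert k; decide +kernel), map_one]
    · rintro _ ⟨k, rfl⟩
      rw [herm_toV _ _ 1 (by revert k; decide +kernel), map_one]
    · rw [herm_toV _ _ i (by decide +kernel)]
      simp [GaussianInt.toComplex_def]
    · rw [herm_toV _ _ (-i) (by decide +kernel), herm_toV _ _ (-i) (by decide +kernel)]
      simp [GaussianInt.toComplex_def]

/-- The connected component `Ξ_*` of `Ξ` that contains `[λ_*, B_*]`. -/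
def XiStar : Set XiVertex := (Xi.connectedComponentMk xiStar).supp

/-- The vector `ϱ`, the sum of the `a_{[λ, B]}` over the vertices `[λ, B]` of `Ξ_*`. -/
def rho : ⋀[ℂ]^14 V := ∑ v ∈ (Set.toFinite XiStar).toFinset, wedge v

/-! ## The action of `Ru` on `⋀¹⁴ 𝔯` -/

/-- The natural action of `R` on `⋀¹⁴ 𝔯`. -/
def extRep : Representation ℂ R (⋀[ℂ]^14 V) where
  toFun g := exteriorPower.map 14 (g : V ≃ₗᵢ[ℂ] V).toLinearEquiv.toLinearMap
  map_one' := by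
    ext m
    simp only [LinearMap.compAlternatingMap_apply, exteriorPower.map_apply_ιMulti]
    rfl
  map_mul' g h := by
    ext m
    simp only [LinearMap.compAlternatingMap_apply, exteriorPower.map_apply_ιMulti,
      Module.End.mul_apply]
    rfl

lemma extRep_signs (g : R) (hg : g ∈ signs) : extRep g = 1 := by
  rcases mem_signs g hg with h | h
  · have : g = 1 := Subtype.ext h
    rw [this, map_one]
  · ext m : 2
    simp only [extRep, MonoidHom.coe_mk, OneHom.coe_mk, LinearMap.compAlternatingMap_apply,
      exteriorPower.map_apply_ιMulti, h]
    have h1 : (⇑(LinearIsometryEquiv.neg ℂ (E := V)).toLinearEquiv.toLinearMap ∘ m) =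
        fun k => (-1 : ℂ) • m k := by
      ext1 k
      simp
    rw [h1]
    have h2 := (exteriorPower.ιMulti ℂ 14 (M := V)).toMultilinearMap.map_smul_univ
      (fun _ => (-1 : ℂ)) m
    rw [Finset.prod_const, Finset.card_univ, Fintype.card_fin,
      Even.neg_one_pow (by decide), one_smul] at h2
    exact h2

/-- The action of the Rudvalis group on `⋀¹⁴ 𝔯`: since `-Id` acts trivially, the action of `R`
factors through `Ru = R / {± Id}`. -/
def ruRep : Representation ℂ Ru (⋀[ℂ]^14 V) := QuotientGroup.lift signs extRep extRep_signs

end ConwayWales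

end

open ConwayWales

open scoped ComplexConjugate
noncomputable section
namespace ConwayWales

/-! ## Vectors of doubled coordinates -/

/-- Doubled coordinates of a vector of `𝔯`, as a list of 28 Gaussian integers. -/
abbrev GVec : Type := Fin 28 → GaussianInt

/-- The position of an entry of an array, read row by row. -/
def ix : Fin 7 × Fin 4 ≃ Fin 28 := finProdFinEquiv

/-- The array with the given entries, read row by row. -/
def toArr (v : GVec) : Array74 := fun r c => v (ix (r, c))

/-- The entries of an array, read row by row. -/
def flat (M : Array74) : GVec := fun p => M (ix.symm p).1 (ix.symm p).2

/-- The vector with the given doubled coordinates. -/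
def vec (v : GVec) : V := toV (toArr v)

lemma toArr_flat (M : Array74) : toArr (flat M) = M := by
  funext r c
  simp [toArr, flat]

lemma vec_flat (M : Array74) : vec (flat M) = toV M := by rw [vec, toArr_flat]

lemma vec_apply (v : GVec) (q : Fin 7 × Fin 4) :
    vec v q = GaussianInt.toComplex (v (ix q)) / 2 := rfl

lemma gsmul_apply (c : GaussianInt) (x : V) (q : Fin 7 × Fin 4) :
    (c • x) q = GaussianInt.toComplex c * x q := rfl

/-- `vec` as a linear map over the Gaussian integers. -/
def vecL : GVec →ₗ[GaussianInt] V where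
  toFun := vec
  map_add' v w := by
    ext q
    simp [vec_apply, add_div]
  map_smul' c v := by
    ext q
    simp [vec_apply, gsmul_apply, mul_div_assoc]

lemma vecL_apply (v : GVec) : vecL v = vec v := rfl

lemma vec_injective : Function.Injective vec := by
  intro v w h
  funext p
  have h1 := congrArg (fun x : V => x (ix.symm p)) h
  simp only [vec_apply, Equiv.apply_symm_apply] at h1
  have h2 : GaussianInt.toComplex (v p) = GaussianInt.toComplex (w p) := by
    have := congrArg (· * (2 : ℂ)) h1
    simpa using this
  exact GaussianInt.toComplex_inj.1 h2

lemma vec_smul (c : GaussianInt) (v : GVec) : vec (c • v) = GaussianInt.toComplex c • vec v :=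
  vecL.map_smul c v

lemma vec_add (v w : GVec) : vec (v + w) = vec v + vec w := vecL.map_add v w

/-- The Hermitian product of doubled coordinate vectors. -/
def ipv (v w : GVec) : GaussianInt := ∑ p, v p * star (w p)

lemma herm_vec_mul (v w : GVec) :
    4 * herm (vec v) (vec w) = GaussianInt.toComplex (ipv v w) := by
  rw [ipv, map_sum, ← ix.sum_comp]
  simp only [herm, vec, toV, PiLp.inner_apply, RCLike.inner_apply, map_mul, Finset.mul_sum, toArr]
  refine Finset.sum_congr rfl fun q _ => ?_
  rw [GaussianInt.toComplex_star, map_div₀, Complex.conj_ofNat]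
  ring

lemma herm_vec (v w : GVec) (z : GaussianInt) (h : ipv v w = 4 * z) :
    herm (vec v) (vec w) = GaussianInt.toComplex z := by
  have h1 := herm_vec_mul v w
  rw [h, map_mul, toComplex_four] at h1
  exact mul_left_cancel₀ (by norm_num) h1

lemma ipv_of_herm (v w : GVec) (z : GaussianInt)
    (h : herm (vec v) (vec w) = GaussianInt.toComplex z) : ipv v w = 4 * z := by
  have h1 := herm_vec_mul v w
  rw [h, ← toComplex_four, ← map_mul] at h1
  exact (GaussianInt.toComplex_inj.1 h1).symm

lemma ipv_add_left (u v w : GVec) : ipv (u + v) w = ipv u w + ipv v w := by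
  simp [ipv, add_mul, Finset.sum_add_distrib]

lemma ipv_smul_left (c : GaussianInt) (v w : GVec) : ipv (c • v) w = c * ipv v w := by
  simp [ipv, Finset.mul_sum, mul_assoc]

lemma star_ipv (v w : GVec) : star (ipv v w) = ipv w v := by
  simp [ipv, mul_comm]

lemma ipv_smul_right (c : GaussianInt) (v w : GVec) : ipv v (c • w) = star c * ipv v w := by
  rw [← star_ipv, ipv_smul_left, star_mul, star_ipv, mul_comm]

/-! ## The lattice in doubled coordinates -/

/-- The Gaussian integer encoded by two bits for each of its two coordinates, taken between
`-1` and `2`. -/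
def decNib (n : ℕ) : GaussianInt :=
  ⟨if n % 4 = 3 then -1 else (n % 4 : ℕ), if n / 4 % 4 = 3 then -1 else (n / 4 % 4 : ℕ)⟩

/-- The vector encoded by the hexadecimal digits of a number. -/
def dec (n : ℕ) : GVec := fun p => decNib (n / 16 ^ (p : ℕ))

/-- Codes of the tabulated generators of the lattice. -/
def genCode : Fin 28 → ℕ :=
  ![0x333334414c110000343c00000000,
    0x0340c11310300c403040c4000043,
    0x03404434c0404004401033003400,
    0x4010004c3c000340141110300440,
    0x0304310000410410c13110103001,
    0x3431c0400c4040303100c1004003,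
    0x0c0c0110c0104c003c0003403444,
    0x43130301033040300011c3004001,
    0x00c434000c10cc43010104c00401,
    0x3300c1000340334130300cc0010c,
    0x0301300301044c00410003404133,
    0x43cc4040c00c030400c4c3000340,
    0x1c0010044c410303c00430401100,
    0x0410c131101010030304130000c3,
    0x4c003c001004c3c43010013030c0,
    0x1004414c1030013030c04c001400,
    0xcc001c000140c333040c03104010,
    0x4040c0040c03c4000034034014c4,
    0x001c40011c44c0c00c4010c00033,
    0x00c40043100434cc30100330c010,
    0x0c3011411030300310c044004100,
    0x0014c001c1440303033030401300,
    0x403000cc1c0003c04344101004c0,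
    0x4c000043100414330c0c0cc0c030,
    0x10300c4001043100c30003c0441c,
    0x33003400300c4c410101c0043040,
    0x430001401c440303300103044400,
    0x0c043001010c00311c00c001c113]

/-- The vector `4 eₚ`, with doubled coordinates. -/
def frame (p : Fin 28) : GVec := Pi.single p 4

/-- The lattice in doubled coordinates. -/
def D : Submodule GaussianInt GVec := lattice.comap vecL

lemma mem_D {v : GVec} : v ∈ D ↔ vec v ∈ lattice := Iff.rfl

lemma toV_coordArr (q : Fin 7 × Fin 4) : toV (coordArr q) = vec (frame (ix q)) := by
  rw [← vec_flat]
  congr 1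
  funext p
  obtain ⟨q', rfl⟩ := ix.surjective p
  by_cases h : q' = q
  · subst h
    simp [flat, coordArr, frame]
  · have h' : ¬ (q.1 = q'.1 ∧ q.2 = q'.2) := fun h' => h (Prod.ext h'.1.symm h'.2.symm)
    rw [frame, Pi.single_eq_of_ne (by simpa using h), flat, coordArr, Equiv.symm_apply_apply,
      Matrix.single_apply_of_ne _ _ _ _ _ h']

lemma flat_beta (k : Fin 12) : flat (betaArr k.succ) = dec (genCode (Fin.castLE (by decide) k)) := by
  revert k
  decide +kernel

lemma flat_beta_zero : flat (betaArr 0) = frame 8 := by decide +kernel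

lemma flat_gamma (k : Fin 13) :
    flat (gammaArr k) = dec (genCode (Fin.castLE (by decide) (Fin.natAdd 12 k))) := by
  revert k
  decide +kernel

lemma flat_mu : flat muArr = dec (genCode 25) := by decide +kernel
lemma flat_mu' : flat muArr' = dec (genCode 26) := by decide +kernel
lemma flat_lambda : flat lambdaArr = frame 4 := by decide +kernel
lemma flat_lambda' : flat lambdaArr' = dec (genCode 27) := by decide +kernel

lemma lattice_eq : lattice = (Submodule.span GaussianInt
    (Set.range frame ∪ Set.range fun k => dec (genCode k))).map vecL := by
  apply le_antisymm
  · rw [lattice, Submodule.span_le]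
    have hf : ∀ p, vec (frame p) ∈ (Submodule.span GaussianInt
        (Set.range frame ∪ Set.range fun k => dec (genCode k))).map vecL := fun p =>
      ⟨_, Submodule.subset_span (Or.inl ⟨p, rfl⟩), rfl⟩
    have hg : ∀ k, vec (dec (genCode k)) ∈ (Submodule.span GaussianInt
        (Set.range frame ∪ Set.range fun k => dec (genCode k))).map vecL := fun k =>
      ⟨_, Submodule.subset_span (Or.inr ⟨k, rfl⟩), rfl⟩
    rintro x (((⟨q, rfl⟩ | ⟨k, rfl⟩) | ⟨k, rfl⟩) | rfl | rfl | rfl | rfl)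
    · simp only [toV_coordArr]
      exact hf _
    · simp only [← vec_flat]
      cases k using Fin.cases with
      | zero => rw [flat_beta_zero]; exact hf _
      | succ k => rw [flat_beta]; exact hg _
    · simp only [← vec_flat, flat_gamma]
      exact hg _
    · rw [← vec_flat, flat_mu]; exact hg _
    · rw [← vec_flat, flat_mu']; exact hg _
    · rw [← vec_flat, flat_lambda]; exact hf _
    · rw [← vec_flat, flat_lambda']; exact hg _
  · rw [Submodule.map_le_iff_le_comap, Submodule.span_le]
    rintro v (⟨p, rfl⟩ | ⟨k, rfl⟩)
    · refine Submodule.subset_span (Or.inl (Or.inl (Or.inl ⟨ix.symm p, ?_⟩)))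
      simp only [toV_coordArr, Equiv.apply_symm_apply]
      rfl
    · have key : ∀ k : Fin 28, (∃ j : Fin 12, k = Fin.castLE (by decide) j) ∨
          (∃ j : Fin 13, k = Fin.castLE (by decide) (Fin.natAdd 12 j)) ∨ k = 25 ∨ k = 26 ∨
            k = 27 := by decide +kernel
      rcases key k with ⟨j, rfl⟩ | ⟨j, rfl⟩ | rfl | rfl | rfl
      · simp only [← flat_beta]
        exact Submodule.subset_span (Or.inl (Or.inl (Or.inr ⟨j.succ, (vec_flat _).symm⟩)))
      · simp only [← flat_gamma]
        exact Submodule.subset_span (Or.inl (Or.inr ⟨j, (vec_flat _).symm⟩))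
      · simp only [← flat_mu]
        refine Submodule.subset_span (Or.inr ?_)
        rw [vecL_apply, vec_flat]
        simp
      · simp only [← flat_mu']
        refine Submodule.subset_span (Or.inr ?_)
        rw [vecL_apply, vec_flat]
        simp
      · simp only [← flat_lambda']
        refine Submodule.subset_span (Or.inr ?_)
        rw [vecL_apply, vec_flat]
        simp

lemma D_eq_span : D = Submodule.span GaussianInt
    (Set.range frame ∪ Set.range fun k => dec (genCode k)) := by
  rw [D, lattice_eq, Submodule.comap_map_eq_of_injective vec_injective]

lemma frame_mem (p : Fin 28) : frame p ∈ D := by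
  rw [D_eq_span]
  exact Submodule.subset_span (Or.inl ⟨p, rfl⟩)

lemma gen_mem (k : Fin 28) : dec (genCode k) ∈ D := by
  rw [D_eq_span]
  exact Submodule.subset_span (Or.inr ⟨k, rfl⟩)

lemma exists_vec {x : V} (hx : x ∈ lattice) : ∃ v ∈ D, x = vec v := by
  have h := hx
  rw [lattice_eq, ← D_eq_span] at h
  obtain ⟨v, hv, rfl⟩ := h
  exact ⟨v, hv, rfl⟩

/-- The doubled coordinates of sacred vectors. -/
def IsSacred (v : GVec) : Prop := v ∈ D ∧ ipv v v = 16

lemma vec_mem_sacred {v : GVec} : vec v ∈ sacred ↔ IsSacred v := by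
  refine and_congr Iff.rfl ⟨fun h => ?_, fun h => ?_⟩
  · exact ipv_of_herm v v 4 (by rw [h, toComplex_four])
  · rw [herm_vec v v 4 h, toComplex_four]

lemma exists_vec_of_sacred {x : V} (hx : x ∈ sacred) : ∃ v, IsSacred v ∧ x = vec v := by
  obtain ⟨v, -, rfl⟩ := exists_vec hx.1
  exact ⟨v, vec_mem_sacred.1 hx, rfl⟩

lemma ipv_self (v : GVec) : ipv v v = ((∑ p, (v p).norm : ℤ) : GaussianInt) := by
  rw [ipv, Int.cast_sum]
  refine Finset.sum_congr rfl fun p _ => ?_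
  exact (Zsqrtd.norm_eq_mul_conj (v p)).symm

lemma IsSacred.norm_sum {v : GVec} (h : IsSacred v) : ∑ p, (v p).norm = 16 := by
  have h1 := h.2
  rw [ipv_self] at h1
  exact_mod_cast h1

/-! ## Unimodularity -/

/-- The number with the given code, with coordinates between `-512` and `511`. -/
def decWide (n : ℕ) : GaussianInt := ⟨(n % 1024 : ℕ) - 512, (n / 1024 % 1024 : ℕ) - 512⟩

/-- Codes of a basis of the lattice. -/
def basisCode : Fin 28 → ℕ :=
  ![0xa2ca14de229724e90ed6735b274d9268a1a70a08875e07d9fb7f9f480202806037fa0580a0180a00805ff7fa008020080200801ff7fe018060080200801ff802008020080201,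
    0x7260684e1b825f9875e67ee0d7e60e8420481e067f1fe7fe057fa0180e00802007fe0380201809ff801fe7fe0080201802007fdff802008020080200801ff802008020180200,
    0x80a0a825f37e20b7f20581204831f980600801fe812037f9ff7fdfe80a0380dfe7fa008020180601806017fe00801ff80200806007fe018060080200801ff802018020080200,
    0x54959786938fdcea2a0a6fe076be127ea457da2a7b9e87ea077f2007fe028020480dff7fdfe802017fdfe801ff802008020080200801ff7fe008020080601802008020080200,
    0xcf172539988a2646a2b08559f84d8f699d8731de899f37edfa811fb7fdfe7ea028060580dff80200801fe802008020080200801ff80201801ff8020180200802008020080200,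
    0x7faa4985c96f9fc715b788a268de2789ddd871f07fa18815ff8120080601809fe7f1fe7fe0380601806017fdff8020080200802007fdff806018020080200802008020080200,
    0x737d7bc18a5d5cf5d12095a5598e6a9d1bf92de27ba3482e038160b81200801f97f5fa7f6028020180603805ff7fa0080200805ff80601802008020080200802008020080200,
    0x6a97773e548dde893a1d761f3721f579e307be187ddeb7f5ff7f2007f2008060381601805fd7f5ff7fa0080601805ff802008020280200802008020080200802008020080200,
    0x4453d7eeb78e9b8ad20469e1c68a1f816567f2377a5e97f2067f1fe7fe0381202809fc7f9fe8020280201801ff801ff802018020080200802008020080200802008020080200,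
    0xf15f459d267ba8d4daa392d9b95d8b6a99e759ba8d207805f2821fb7f5fc7e6017f60580e017fdff805ff8020080601802008020080200802008020080200802008020080200,
    0x881bc742108720081a2a7c5e77b5ed7a6097c603805f77fdff806017f5ff7fa0281200801fe7fa007fa0080a0080200802008020080200802008020080200802008020080200,
    0x8d2928f9b271a0a6e1d289e158ce11865d7855eb81615815fd80e01805ff801fc7f1fe802028020080a028020080200802008020080200802008020080200802008020080200,
    0x5e9787ba6c8a1e09ba0e72e0b7160b7fe357e6217d1f07f2047f1fe8020280e01805ff7fdff80601802008020080200802008020080200802008020080200802008020080200,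
    0xb458360dc586e4173e85811be821b2701ec769ee865f77f5fb80dfb7fdff7fa028020280a0080200802008020080200802008020080200802008020080200802008020080200,
    0x5f9cc83a50871da941ea77e1375e1382e2580e197cdf77f6057f6018060180a0080a008020080200802008020080200802008020080200802008020080200802008020080200,
    0xb49e66d1aa7ea386a25885dcd885cb75ddb7a5e585603805fb815fd7fdff7fa02802008020080200802008020080200802008020080200802008020080200802008020080200,
    0x79e1783e057fdf980def80a068020882202812027f6017fe017fe018060180200802008020080200802008020080200802008020080200802008020080200802008020080200,
    0x68e258ae1d7f5e5875cd7f6197de1b8560d836097da00802027fa028020080200802008020080200802008020080200802008020080200802008020080200802008020080200,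
    0x7c627865f77cdfb7dde78260b8260b825fb81dfd7fa0480a00802008020080200802008020080200802008020080200802008020080200802008020080200802008020080200,
    0x7e1e07da0e829fe8420c7d9fe7e1fc7ea067f204801fc80200802008020080200802008020080200802008020080200802008020080200802008020080200802008020080200,
    0x7f1fa7fa0480a00812027fa007fa0080202802028020080200802008020080200802008020080200802008020080200802008020080200802008020080200802008020080200,
    0x811fc7fa0280a02802047f9fe80200809fe802008020080200802008020080200802008020080200802008020080200802008020080200802008020080200802008020080200,
    0x811fa7f20280a0080a047f9fe7f9fe80200802008020080200802008020080200802008020080200802008020080200802008020080200802008020080200802008020080200,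
    0x801f88020480200812047f2008020080200802008020080200802008020080200802008020080200802008020080200802008020080200802008020080200802008020080200,
    0x7f9fa7fa0280a0280a02802008020080200802008020080200802008020080200802008020080200802008020080200802008020080200802008020080200802008020080200,
    0x81204801fc7f20080200802008020080200802008020080200802008020080200802008020080200802008020080200802008020080200802008020080200802008020080200,
    0x80204801fc8020080200802008020080200802008020080200802008020080200802008020080200802008020080200802008020080200802008020080200802008020080200,
    0x801fc802008020080200802008020080200802008020080200802008020080200802008020080200802008020080200802008020080200802008020080200802008020080200]

/-- A triangular basis of the lattice. -/
def latBasis (k : Fin 28) : GVec := fun p => decWide (basisCode k / 1048576 ^ (p : ℕ))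

/-- Codes of the coordinates, modulo 4, of the basis in the generators. -/
def coeffCode : Fin 28 → ℕ :=
  ![0x1c010024e1c7dbdee22fdb0,
    0x71500b3af07287b7574bc4,
    0x40f0081b80552a13d20f73,
    0x100d0e00210d329a8a43df6f6,
    0xc103d30009754e869bf1da3176,
    0x20d00f415cbea2038a2b77,
    0x103607002d6f79140312cfc22,
    0x141b00df8c4ab2b0232f07f,
    0x10060a008cc74940eb1eac1a2,
    0x1031300077a9dac757a428980,
    0xa130080910cc8bc2e0706f,
    0x103434006687ff0e83c0b2e3a,
    0x10333500668de7a25d066af32,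
    0x100f3000012d3846210014345,
    0x11f00df8c53b3ec93d9ab6,
    0x70f0091bd3d73a842bdfe9,
    0x103e380026cefc5379e6dd2df,
    0x10363b0093852f857a7d548c1,
    0x1034030071c821bf15bbbcb01,
    0x1b040093b01e343f41eb28b,
    0x10053a0022322e9735c8ea51e,
    0x1b040093b01e343f41eb28b,
    0x103c02005d246dd0b773a4ff3,
    0x0,
    0x10333b0062cd2ce8a8e691f16,
    0x0,
    0x0,
    0x0]

/-- Codes of the dual basis. -/
def dualCode : Fin 28 → ℕ :=
  ![0x0,
    0x0,
    0x0,
    0xaaaa,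
    0x0,
    0xaa2828,
    0xaa0a0a0,
    0x28828822,
    0x0,
    0xaa82282828,
    0x808ff777575,
    0x5577fff588aa,
    0xa0aa02aa2a8a2,
    0x88d7f557df0028,
    0x820802a5dd577ff,
    0xd7d782005d5d0028,
    0xadf7f0aaa00aad77d,
    0xdfe369520d8082ce6e,
    0x8f5161e580d77fd66ee,
    0x3b66005541e35d552f27,
    0x2a72de6463e4b0a002a57,
    0x7d3333144143346ec482ff,
    0xf07d8d2cce6f070dfa01c43,
    0xc4131cc3c4b37050f8f01443,
    0x58103c0a44740d2c911503004,
    0xc47031305108d0d1f15c1030c2,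
    0x340c11310300c403040c4000043,
    0x333334414c110000343c00000000]

/-- The basis dual to `latBasis`. -/
def dualVec (k : Fin 28) : GVec := if dualCode k = 0 then frame k else dec (dualCode k)

lemma latBasis_sub (k p : Fin 28) :
    (latBasis k p - ∑ j, dec (coeffCode k) j * dec (genCode j) p).re % 4 = 0 ∧
    (latBasis k p - ∑ j, dec (coeffCode k) j * dec (genCode j) p).im % 4 = 0 := by
  revert k p
  decide +kernel

lemma dual_identity (p q : Fin 28) :
    ∑ k, star (dualVec k p) * latBasis k q = if p = q then 4 else 0 := by
  revert p q
  decide +kernel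

lemma mem_D_of_four_dvd {v : GVec} (h : ∀ p, 4 ∣ v p) : v ∈ D := by
  choose w hw using h
  have : v = ∑ p, w p • frame p := by
    funext q
    rw [hw, Finset.sum_apply, Finset.sum_eq_single q]
    · simp [frame, mul_comm]
    · intro b _ hb
      simp [frame, Pi.single_eq_of_ne hb.symm]
    · simp
  rw [this]
  exact Submodule.sum_mem _ fun p _ => Submodule.smul_mem _ _ (frame_mem p)

lemma four_dvd {z : GaussianInt} (h : z.re % 4 = 0 ∧ z.im % 4 = 0) : 4 ∣ z :=
  ⟨⟨z.re / 4, z.im / 4⟩, by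
    apply Zsqrtd.ext
    · simp only [Zsqrtd.re_mul, Zsqrtd.re_ofNat, Zsqrtd.im_ofNat]; omega
    · simp only [Zsqrtd.im_mul, Zsqrtd.re_ofNat, Zsqrtd.im_ofNat]; omega⟩

lemma latBasis_mem (k : Fin 28) : latBasis k ∈ D := by
  have h1 : latBasis k = (latBasis k - ∑ j, dec (coeffCode k) j • dec (genCode j)) +
      ∑ j, dec (coeffCode k) j • dec (genCode j) := by abel
  rw [h1]
  refine D.add_mem (mem_D_of_four_dvd fun p => four_dvd ?_)
    (Submodule.sum_mem _ fun j _ => D.smul_mem _ (gen_mem j))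
  have h2 := latBasis_sub k p
  simpa only [Pi.sub_apply, Finset.sum_apply, Pi.smul_apply, smul_eq_mul] using h2

/-- A vector whose products with a dual basis are integral belongs to the lattice. -/
lemma mem_D_of_dual {v : GVec} (h : ∀ k, 4 ∣ ipv v (dualVec k)) : v ∈ D := by
  choose z hz using h
  have h1 : (4 : GaussianInt) • v = (4 : GaussianInt) • ∑ k, z k • latBasis k := by
    funext q
    simp only [Pi.smul_apply, Finset.sum_apply, smul_eq_mul, Finset.mul_sum]
    calc 4 * v q = ∑ p, v p * (if p = q then 4 else 0) := by simp [mul_comm]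
      _ = ∑ p, v p * ∑ k, star (dualVec k p) * latBasis k q := by simp only [dual_identity]
      _ = ∑ k, ipv v (dualVec k) * latBasis k q := by
        simp only [Finset.mul_sum, ipv, Finset.sum_mul]
        rw [Finset.sum_comm]
        exact Finset.sum_congr rfl fun k _ => Finset.sum_congr rfl fun p _ => by ring
      _ = _ := Finset.sum_congr rfl fun k _ => by rw [hz, mul_assoc]
  have h2 : v = ∑ k, z k • latBasis k := by
    have h4 : (4 : GaussianInt) ≠ 0 := by decide
    exact smul_right_injective GVec h4 h1
  rw [h2]
  exact Submodule.sum_mem _ fun k _ => D.smul_mem _ (latBasis_mem k)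

/-! ## Digits in base `2 ^ 16` -/

/-- The digit of `n` of index `f` in base `2 ^ 16`. -/
def dig (f n : ℕ) : ℕ := n / 65536 ^ f % 65536

lemma dig_zero_right (f : ℕ) : dig f 0 = 0 := by simp [dig]

lemma dig_zero_left (n : ℕ) : dig 0 n = n % 65536 := by simp [dig]

lemma dig_succ (f n : ℕ) : dig (f + 1) n = dig f (n / 65536) := by
  rw [dig, dig, pow_succ', Nat.div_div_eq_div_mul]

/-- Digits add up as long as there is no carry. -/
lemma dig_add {m n : ℕ} (h : ∀ f, dig f m + dig f n < 65536) (f : ℕ) :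
    dig f (m + n) = dig f m + dig f n := by
  induction f generalizing m n with
  | zero =>
    have := h 0
    simp only [dig_zero_left] at *
    omega
  | succ f ih =>
    have h0 := h 0
    simp only [dig_zero_left] at h0
    have h1 : (m + n) / 65536 = m / 65536 + n / 65536 := by omega
    rw [dig_succ, dig_succ, dig_succ, h1]
    refine ih fun g => ?_
    have := h (g + 1)
    rwa [dig_succ, dig_succ] at this

lemma dig_mul {x n : ℕ} (h : ∀ f, x * dig f n < 65536) : ∀ f, dig f (x * n) = x * dig f n := by
  induction x with
  | zero => simp [dig_zero_right]
  | succ x ih =>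
    have h' : ∀ f, x * dig f n + dig f n < 65536 := fun f => by
      have := h f
      rwa [add_mul, one_mul] at this
    have ih' := ih fun f => by
      have := h' f
      omega
    intro f
    rw [add_mul, one_mul, add_mul, one_mul, dig_add, ih' f]
    intro f
    rw [ih' f]
    exact h' f

lemma and_mask_succ (n m : ℕ) :
    n &&& (3 + 65536 * m) = 0 ↔ n % 4 = 0 ∧ n / 65536 &&& m = 0 := by
  have h1 : (n &&& (3 + 65536 * m)) % 2 ^ 16 = n % 4 := by
    rw [Nat.and_mod_two_pow, show (3 + 65536 * m) % 2 ^ 16 = 2 ^ 2 - 1 by omega,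
      Nat.and_two_pow_sub_one_eq_mod]
    omega
  have h2 : (n &&& (3 + 65536 * m)) / 2 ^ 16 = n / 65536 &&& m := by
    rw [Nat.and_div_two_pow, show (3 + 65536 * m) / 2 ^ 16 = m by omega]
  constructor
  · intro h
    rw [h] at h1 h2
    exact ⟨by omega, by simpa using h2.symm⟩
  · rintro ⟨h3, h4⟩
    rw [h3] at h1
    rw [h4] at h2
    omega

/-- The mask of the two low bits of `k` digits. -/
def testMask : ℕ → ℕ
  | 0 => 0
  | k + 1 => 3 + 65536 * testMask k

/-- The mask of the eight low bits of `k` digits. -/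
def byteMask : ℕ → ℕ
  | 0 => 0
  | k + 1 => 255 + 65536 * byteMask k

lemma dig_mod_of_mask {k n : ℕ} (h : n &&& testMask k = 0) {f : ℕ} (hf : f < k) :
    dig f n % 4 = 0 := by
  induction k generalizing n f with
  | zero => omega
  | succ k ih =>
    obtain ⟨h1, h2⟩ := (and_mask_succ _ _).1 h
    cases f with
    | zero =>
      rw [dig_zero_left]
      omega
    | succ f =>
      rw [dig_succ]
      exact ih h2 (by omega)

lemma and_two_eq_zero {d n : ℕ} (h1 : dig d n % 4 = 0) (h2 : dig (d + 1) n % 4 = 0) :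
    (n >>> (16 * d)) &&& 196611 = 0 := by
  have h3 : n >>> (16 * d) = n / 65536 ^ d := by
    rw [Nat.shiftRight_eq_div_pow, pow_mul]
    norm_num
  rw [h3, show 196611 = 3 + 65536 * (3 + 65536 * 0) by norm_num, and_mask_succ, and_mask_succ]
  rw [dig] at h1 h2
  rw [pow_succ, ← Nat.div_div_eq_div_mul] at h2
  refine ⟨by omega, by omega, by simp⟩

lemma dig_le_of_byteMask {k n : ℕ} (h : n &&& byteMask k = n) (f : ℕ) : dig f n ≤ 255 := by
  induction k generalizing n f with
  | zero =>
    simp only [byteMask, Nat.and_zero] at h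
    rw [← h, dig_zero_right]
    omega
  | succ k ih =>
    have h1 : n % 2 ^ 16 ≤ 255 := by
      rw [← h, Nat.and_mod_two_pow, byteMask]
      refine Nat.and_le_right.trans ?_
      omega
    have h2 : n / 65536 &&& byteMask k = n / 65536 := by
      have h3 := congrArg (· / 2 ^ 16) h
      simp only [byteMask] at h3
      rw [Nat.and_div_two_pow, show (255 + 65536 * byteMask k) / 2 ^ 16 = byteMask k by omega] at h3
      exact h3
    cases f with
    | zero =>
      rw [dig_zero_left]
      exact h1
    | succ f =>
      rw [dig_succ]
      exact ih h2 f

lemma dig_eq_zero_of_shiftRight {d n : ℕ} (h : n >>> (16 * d) = 0) {f : ℕ} (hf : d ≤ f) :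
    dig f n = 0 := by
  have h3 : n / 65536 ^ d = 0 := by
    rw [Nat.shiftRight_eq_div_pow, pow_mul] at h
    exact h
  obtain ⟨e, rfl⟩ := Nat.exists_eq_add_of_le hf
  rw [dig, pow_add, ← Nat.div_div_eq_div_mul, h3, Nat.zero_div, Nat.zero_mod]

/-! ## A search with packed congruences -/

/-- Evaluates the number `n` before it is substituted into `f`. -/
def force {α : Type} (n : ℕ) (f : ℕ → α) : α := Nat.rec (f 0) (fun m _ => f (Nat.succ m)) n

lemma force_eq {α : Type} (n : ℕ) (f : ℕ → α) : force n f = f n := by cases n <;> rfl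

/-- `f a` holds for all members `a` of a list. -/
def allL {α : Type} (f : α → Bool) (l : List α) : Bool :=
  List.rec true (fun a _ ih => Bool.rec false ih (f a)) l

lemma allL_iff {α : Type} (f : α → Bool) (l : List α) : allL f l = true ↔ ∀ a ∈ l, f a = true := by
  induction l with
  | nil => simp [allL]
  | cons a l ih =>
    have h : allL f (a :: l) = Bool.rec false (allL f l) (f a) := rfl
    rw [h]
    cases hf : f a <;> simp [hf, ih]

/-- The entry of a list with a given index. -/
def pick {α : Type} (l : List (List α)) : ℕ → List α :=
  List.rec (fun _ => []) (fun a _ ih n => Nat.rec a (fun m _ => ih m) n) l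

/-- A row `(s, c, c')` stands for the coordinate of index `s / 4`; the digits of `c` and `c'` are
the coefficients of its real and imaginary part in the test sums. -/
abbrev Row : Type := ℕ × ℕ × ℕ

/-- A value `(n, x, y)` stands for the Gaussian integers congruent to `x + i y`, at the cost `n`. -/
abbrev Val : Type := ℕ × ℕ × ℕ

/-- Depth first search over the values of the coordinates in the order of the rows. The value lists
depend on the hexadecimal digits of `R₀`. A branch is cut when the test sums which are complete are
not divisible by `4` or the budget is exceeded. At the leaves, `Q` is applied to the code of the
values and the rest of the budget. -/
def search (sel : ℕ → List Val) (R₀ : ℕ) (Q : ℕ → ℕ → Bool) (rows : List Row) :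
    ℕ → ℕ → ℕ → ℕ → Bool :=
  List.rec (motive := fun _ => ℕ → ℕ → ℕ → ℕ → Bool) (fun _ _ bud R => Q R bud)
    (fun r _ ih sh acc bud R => Prod.rec (fun s cc => Prod.rec (fun c c' =>
      allL (fun v => Prod.rec (fun n xy => Prod.rec (fun x y =>
        Bool.rec true
          (force (Nat.add acc (Nat.add (Nat.mul x c) (Nat.mul y c'))) fun acc' =>
            Bool.rec true
              (force (Nat.sub bud n) fun bud' => force (Nat.sub sh 32) fun sh' =>
                force (Nat.add R (Nat.shiftLeft (Nat.add x (Nat.mul 4 y)) s)) fun R' =>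
                  ih sh' acc' bud' R')
              (Nat.beq (Nat.land (Nat.shiftRight acc' sh) 196611) 0))
          (Nat.ble n bud)) xy) v)
        (sel (Nat.land (Nat.shiftRight R₀ s) 15))) cc) r)
    rows

lemma search_cons {sel : ℕ → List Val} {R₀ : ℕ} {Q : ℕ → ℕ → Bool} {s c c' : ℕ} {rows : List Row}
    {sh acc bud R : ℕ} (h : search sel R₀ Q ((s, c, c') :: rows) sh acc bud R = true)
    {n x y : ℕ} (hv : (n, x, y) ∈ sel (R₀ >>> s &&& 15)) (hn : n ≤ bud)
    (ht : (acc + (x * c + y * c')) >>> sh &&& 196611 = 0) :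
    search sel R₀ Q rows (sh - 32) (acc + (x * c + y * c')) (bud - n)
      (R + (x + 4 * y) <<< s) = true := by
  have h2 : Nat.ble n bud = true := Nat.ble_eq_true_of_le hn
  have h3 : Nat.beq (Nat.land (Nat.shiftRight (Nat.add acc (Nat.add (Nat.mul x c) (Nat.mul y c')))
      sh) 196611) 0 = true := by
    rw [Nat.beq_eq]
    exact ht
  have h1 : Bool.rec true
      (force (Nat.add acc (Nat.add (Nat.mul x c) (Nat.mul y c'))) fun acc' =>
        Bool.rec true
          (force (Nat.sub bud n) fun bud' => force (Nat.sub sh 32) fun sh' =>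
            force (Nat.add R (Nat.shiftLeft (Nat.add x (Nat.mul 4 y)) s)) fun R' =>
              search sel R₀ Q rows sh' acc' bud' R')
          (Nat.beq (Nat.land (Nat.shiftRight acc' sh) 196611) 0))
      (Nat.ble n bud) = true := (allL_iff _ _).1 h _ hv
  rw [h2] at h1
  simp only [force_eq] at h1
  rw [h3] at h1
  exact h1

/-- The digit bounds and the vanishing of digits on which the search is based. -/
def RowsOK : List Row → Prop
  | [] => True
  | r :: rows => (∀ f, dig f r.2.1 ≤ 255 ∧ dig f r.2.2 ≤ 255) ∧
      (∀ f, 2 * (rows.length + 1) + 2 ≤ f → dig f r.2.1 = 0 ∧ dig f r.2.2 = 0) ∧ RowsOK rows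

lemma RowsOK.dig_eq_zero {rows : List Row} (h : RowsOK rows) {r : Row} (hr : r ∈ rows) {f : ℕ}
    (hf : 2 * rows.length + 2 ≤ f) : dig f r.2.1 = 0 ∧ dig f r.2.2 = 0 := by
  induction rows with
  | nil => simp at hr
  | cons r' rows ih =>
    rw [List.length_cons] at hf
    rcases List.mem_cons.1 hr with rfl | hr
    · exact h.2.1 f hf
    · exact ih h.2.2 hr (by omega)

lemma dig_combination {acc x y c c' B : ℕ} (hacc : ∀ f, dig f acc ≤ B) (hB : B + 1530 < 65536)
    (hx : x ≤ 3) (hy : y ≤ 3) (hc : ∀ f, dig f c ≤ 255 ∧ dig f c' ≤ 255) (f : ℕ) :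
    dig f (acc + (x * c + y * c')) = dig f acc + (x * dig f c + y * dig f c') := by
  have h1 : ∀ f, x * dig f c ≤ 765 := fun f => Nat.mul_le_mul hx (hc f).1
  have h2 : ∀ f, y * dig f c' ≤ 765 := fun f => Nat.mul_le_mul hy (hc f).2
  have h3 := dig_mul (x := x) (n := c) fun f => (h1 f).trans_lt (by norm_num)
  have h4 := dig_mul (x := y) (n := c') fun f => (h2 f).trans_lt (by norm_num)
  have h5 : ∀ f, dig f (x * c + y * c') = x * dig f c + y * dig f c' := fun f => by
    rw [dig_add, h3, h4]
    intro f
    rw [h3, h4]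
    have := h1 f
    have := h2 f
    omega
  rw [dig_add, h5]
  intro f
  rw [h5]
  have := h1 f
  have := h2 f
  have := hacc f
  omega

/-- The search visits the leaf that belongs to an admissible choice of values. -/
lemma search_sound_aux {sel : ℕ → List Val} {R₀ : ℕ} {Q : ℕ → ℕ → Bool} (v : ℕ → Val)
    {rows : List Row} (hrows : RowsOK rows) {acc bud R B : ℕ} (hacc : ∀ f, dig f acc ≤ B)
    (hB : B + 1530 * rows.length < 65536)
    (htot : ∀ f, 2 ≤ f → 4 ∣ dig f acc +
      (rows.map fun r => (v r.1).2.1 * dig f r.2.1 + (v r.1).2.2 * dig f r.2.2).sum)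
    (hv : ∀ r ∈ rows, v r.1 ∈ sel (R₀ >>> r.1 &&& 15) ∧ (v r.1).2.1 ≤ 3 ∧ (v r.1).2.2 ≤ 3)
    (hb : (rows.map fun r => (v r.1).1).sum ≤ bud)
    (h : search sel R₀ Q rows (32 * rows.length) acc bud R = true) :
    Q (R + (rows.map fun r => ((v r.1).2.1 + 4 * (v r.1).2.2) <<< r.1).sum)
      (bud - (rows.map fun r => (v r.1).1).sum) = true := by
  induction rows generalizing acc bud R B with
  | nil => exact h
  | cons r rows ih =>
    obtain ⟨s, c, c'⟩ := r
    obtain ⟨hv1, hx, hy⟩ : v s ∈ sel (R₀ >>> s &&& 15) ∧ (v s).2.1 ≤ 3 ∧ (v s).2.2 ≤ 3 :=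
      hv _ (List.mem_cons_self ..)
    simp only [List.map_cons, List.sum_cons, List.length_cons] at hb hB htot ⊢
    have hB1 : B + 1530 < 65536 := lt_of_le_of_lt
      (Nat.add_le_add_left (Nat.le_mul_of_pos_right _ (Nat.succ_pos _)) B) hB
    have hd : ∀ f, dig f (acc + ((v s).2.1 * c + (v s).2.2 * c')) =
        dig f acc + ((v s).2.1 * dig f c + (v s).2.2 * dig f c') :=
      dig_combination hacc hB1 hx hy hrows.1
    have hd' : ∀ f, dig f (acc + ((v s).2.1 * c + (v s).2.2 * c')) ≤ B + 1530 := by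
      intro f
      rw [hd f]
      have h1 : (v s).2.1 * dig f c ≤ 3 * 255 := Nat.mul_le_mul hx (hrows.1 f).1
      have h2 : (v s).2.2 * dig f c' ≤ 3 * 255 := Nat.mul_le_mul hy (hrows.1 f).2
      have := hacc f
      omega
    have hzero : ∀ f, 2 * rows.length + 2 ≤ f →
        (rows.map fun r => (v r.1).2.1 * dig f r.2.1 + (v r.1).2.2 * dig f r.2.2).sum = 0 := by
      intro f hf
      refine List.sum_eq_zero fun t ht => ?_
      obtain ⟨r, hr, rfl⟩ := List.mem_map.1 ht
      obtain ⟨h1, h2⟩ := hrows.2.2.dig_eq_zero hr hf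
      rw [h1, h2, mul_zero, mul_zero, add_zero]
    have htest : ∀ f, 2 * rows.length + 2 ≤ f →
        dig f (acc + ((v s).2.1 * c + (v s).2.2 * c')) % 4 = 0 := by
      intro f hf
      have h1 := htot f (by omega)
      rw [hzero f hf, add_zero] at h1
      have h2 := hd f
      omega
    have hn : (v s).1 ≤ bud := by omega
    have hsh : 32 * (rows.length + 1) = 16 * (2 * rows.length + 2) := by ring
    have h1 := search_cons h hv1 hn (by
      rw [List.length_cons, hsh]
      exact and_two_eq_zero (htest _ le_rfl) (htest _ (by omega)))
    rw [List.length_cons, show 32 * (rows.length + 1) - 32 = 32 * rows.length by omega] at h1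
    have h2 := ih hrows.2.2 (B := B + 1530) hd' (by omega) (fun f hf => ?_)
      (fun r hr => hv r (List.mem_cons_of_mem _ hr)) (by omega) h1
    · rw [add_assoc, Nat.sub_sub] at h2
      exact h2
    · have h3 := htot f hf
      rw [hd f]
      rwa [add_assoc]

/-! ## Packed hexadecimal digits -/

/-- The number with the given hexadecimal digits. -/
def pack {n : ℕ} (w : Fin n → ℕ) : ℕ := ∑ p, w p <<< (4 * (p : ℕ))

lemma pack_succ {n : ℕ} (w : Fin (n + 1) → ℕ) : pack w = w 0 + 16 * pack fun p => w p.succ := by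
  rw [pack, Fin.sum_univ_succ, pack, Finset.mul_sum]
  congr 1
  refine Finset.sum_congr rfl fun p _ => ?_
  simp only [Nat.shiftLeft_eq, Fin.val_succ, mul_add, pow_add]
  ring

lemma nib_pack {n : ℕ} {w : Fin n → ℕ} (hw : ∀ p, w p < 16) (p : Fin n) :
    pack w >>> (4 * (p : ℕ)) &&& 15 = w p := by
  rw [show 15 = 2 ^ 4 - 1 by norm_num, Nat.and_two_pow_sub_one_eq_mod, Nat.shiftRight_eq_div_pow]
  induction n with
  | zero => exact p.elim0
  | succ n ih =>
    rw [pack_succ]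
    have h0 := hw 0
    cases p using Fin.cases with
    | zero =>
      simp only [Fin.val_zero, mul_zero, pow_zero, Nat.div_one]
      omega
    | succ p =>
      rw [Fin.val_succ, mul_add, mul_one, pow_add, mul_comm (2 ^ (4 * (p : ℕ))),
        ← Nat.div_div_eq_div_mul]
      rw [show (w 0 + 16 * pack fun p => w p.succ) / 2 ^ 4 = pack fun p => w p.succ by omega]
      exact ih (fun p => hw p.succ) p

/-! ## Verification of the tables -/

/-- The coordinate with index `s / 4`. -/
def ent (M : GVec) (s : ℕ) : GaussianInt := if h : s / 4 < 28 then M ⟨s / 4, h⟩ else 0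

lemma ent_mul (M : GVec) (p : Fin 28) : ent M (4 * (p : ℕ)) = M p := by
  have h : 4 * (p : ℕ) / 4 = p := by omega
  simp [ent, h]

lemma ent_add (M N : GVec) (s : ℕ) : ent (M + N) s = ent M s + ent N s := by
  unfold ent
  split <;> simp

lemma ent_smul (c : GaussianInt) (M : GVec) (s : ℕ) : ent (c • M) s = c * ent M s := by
  unfold ent
  split <;> simp

/-- The test sum with index `f`. -/
def testSum (rows : List Row) (f : ℕ) (M : GVec) : ℤ :=
  (rows.map fun r => (ent M r.1).re * (dig f r.2.1 : ℤ) + (ent M r.1).im * (dig f r.2.2 : ℤ)).sum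

lemma testSum_add (rows : List Row) (f : ℕ) (M N : GVec) :
    testSum rows f (M + N) = testSum rows f M + testSum rows f N := by
  rw [testSum, testSum, testSum, ← List.sum_map_add]
  congr 1
  refine List.map_congr_left fun r _ => ?_
  rw [ent_add, Zsqrtd.re_add, Zsqrtd.im_add]
  ring

lemma testSum_smul (rows : List Row) (f : ℕ) (c : GaussianInt) (M : GVec) :
    testSum rows f (c • M) = c.re * testSum rows f M + c.im * testSum rows f (i • M) := by
  rw [testSum, testSum, testSum, ← List.sum_map_mul_left, ← List.sum_map_mul_left,
    ← List.sum_map_add]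
  congr 1
  refine List.map_congr_left fun r _ => ?_
  simp only [ent_smul, Zsqrtd.re_mul, Zsqrtd.im_mul]
  ring

/-- The packed test sums of an array with a given code; `turn` multiplies it by `i`. -/
def packedSum (turn : Bool) (n : ℕ) (rows : List Row) : ℕ → ℕ :=
  List.rec (motive := fun _ => ℕ → ℕ) (fun acc => acc)
    (fun r _ ih acc => Prod.rec (fun s cc => Prod.rec (fun c c' =>
      force (Nat.land (Nat.shiftRight n s) 3) fun x =>
        force (Nat.land (Nat.shiftRight n (Nat.add s 2)) 3) fun y =>
          force (Bool.rec (Nat.add acc (Nat.add (Nat.mul x c) (Nat.mul y c')))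
            (Nat.add acc (Nat.add (Nat.mul (Nat.land (Nat.mul 3 y) 3) c) (Nat.mul x c'))) turn)
            ih) cc) r)
    rows

/-- All the test sums of an array with a given code are divisible by `4`. -/
def codeCheck (mask : ℕ) (rows : List Row) (n : ℕ) : Bool :=
  Nat.beq (Nat.land (Nat.shiftRight (packedSum false n rows 0) 32) mask) 0 &&
    Nat.beq (Nat.land (Nat.shiftRight (packedSum true n rows 0) 32) mask) 0

/-- Checks the digit bounds and vanishing digits of rows. -/
def rowsCheck (mask : ℕ) : List Row → Bool
  | [] => true
  | r :: rows => Nat.beq (Nat.land r.2.1 mask) r.2.1 && Nat.beq (Nat.land r.2.2 mask) r.2.2 &&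
      Nat.beq (Nat.shiftRight r.2.1 (16 * (2 * (rows.length + 1) + 2))) 0 &&
      Nat.beq (Nat.shiftRight r.2.2 (16 * (2 * (rows.length + 1) + 2))) 0 && rowsCheck mask rows

/-- Checks that `a + i b` and `i (a + i b)` contribute multiples of `4` to `k` digits. -/
def compatCheck (a b k : ℕ) : ℕ → ℕ → Bool :=
  Nat.rec (motive := fun _ => ℕ → ℕ → Bool) (fun _ _ => true)
    (fun _ ih n n' => Bool.rec false (Bool.rec false
        (force (Nat.shiftRight n 16) fun m => force (Nat.shiftRight n' 16) fun m' => ih m m')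
        (Nat.beq (Nat.land (Nat.add (Nat.mul (Nat.mul 3 b) n) (Nat.mul a n')) 3) 0))
      (Nat.beq (Nat.land (Nat.add (Nat.mul a n) (Nat.mul b n')) 3) 0)) k

/-- Checks a table of rows for values known modulo `a + i b`. -/
def tableCheck (a b : ℕ) (rows : List Row) : Bool :=
  decide (rows.length = 28) && (rows.map Prod.fst).isPerm ((List.range 28).map (4 * ·)) &&
    force (byteMask 58) (fun m => rowsCheck m rows) &&
    rows.all (fun r => compatCheck a b 56 (Nat.shiftRight r.2.1 32) (Nat.shiftRight r.2.2 32)) &&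
    force (testMask 56) (fun m => (List.finRange 28).all fun k =>
      force (genCode k) (codeCheck m rows))

lemma rowsOK_of_check {k : ℕ} {rows : List Row} (h : rowsCheck (byteMask k) rows = true) :
    RowsOK rows := by
  induction rows with
  | nil => trivial
  | cons r rows ih =>
    simp only [rowsCheck, Bool.and_eq_true, Nat.beq_eq] at h
    obtain ⟨⟨⟨⟨h1, h2⟩, h3⟩, h4⟩, h5⟩ := h
    exact ⟨fun f => ⟨dig_le_of_byteMask h1 f, dig_le_of_byteMask h2 f⟩,
      fun f hf => ⟨dig_eq_zero_of_shiftRight h3 hf, dig_eq_zero_of_shiftRight h4 hf⟩, ih h5⟩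

lemma and_three (n : ℕ) : n &&& 3 = n % 4 := Nat.and_two_pow_sub_one_eq_mod n 2

lemma compat_of_check {a b k n n' : ℕ} (h : compatCheck a b k n n' = true) {f : ℕ} (hf : f < k) :
    (a * dig f n + b * dig f n') % 4 = 0 ∧ (3 * b * dig f n + a * dig f n') % 4 = 0 := by
  induction k generalizing n n' f with
  | zero => omega
  | succ k ih =>
    have h1 : (Bool.rec false (Bool.rec false
        (force (Nat.shiftRight n 16) fun m => force (Nat.shiftRight n' 16) fun m' =>
          compatCheck a b k m m')
        (Nat.beq (Nat.land (Nat.add (Nat.mul (Nat.mul 3 b) n) (Nat.mul a n')) 3) 0))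
      (Nat.beq (Nat.land (Nat.add (Nat.mul a n) (Nat.mul b n')) 3) 0) : Bool) = true := h
    cases h2 : Nat.beq (Nat.land (Nat.add (Nat.mul a n) (Nat.mul b n')) 3) 0 with
    | false =>
      rw [h2] at h1
      exact absurd h1 Bool.false_ne_true
    | true =>
      cases h3 : Nat.beq (Nat.land (Nat.add (Nat.mul (Nat.mul 3 b) n) (Nat.mul a n')) 3) 0 with
      | false =>
        rw [h2, h3] at h1
        exact absurd h1 Bool.false_ne_true
      | true =>
        simp only [h2, h3, force_eq] at h1
        have h2' : (a * n + b * n') % 4 = 0 := by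
          rw [← and_three]; exact Nat.eq_of_beq_eq_true h2
        have h3' : (3 * b * n + a * n') % 4 = 0 := by
          rw [← and_three]; exact Nat.eq_of_beq_eq_true h3
        cases f with
        | zero =>
          have e : ∀ m, dig 0 m % 4 = m % 4 := fun m => by rw [dig_zero_left]; omega
          constructor
          · rw [Nat.add_mod, Nat.mul_mod, e, ← Nat.mul_mod, Nat.mul_mod b, e, ← Nat.mul_mod,
              ← Nat.add_mod, h2']
          · rw [Nat.add_mod, Nat.mul_mod, e, ← Nat.mul_mod, Nat.mul_mod a, e, ← Nat.mul_mod,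
              ← Nat.add_mod, h3']
        | succ f =>
          have e : ∀ m, Nat.shiftRight m 16 = m / 65536 := fun m =>
            Nat.shiftRight_eq_div_pow m 16
          rw [e, e] at h1
          rw [dig_succ, dig_succ]
          exact ih h1 (by omega)

lemma dig_shiftRight (f n : ℕ) : dig f (n >>> 32) = dig (f + 2) n := by
  rw [dig_succ, dig_succ, Nat.shiftRight_eq_div_pow, Nat.div_div_eq_div_mul]

/-- The digits of a sum of combinations of the rows. -/
lemma dig_sum {rows : List Row} (hrows : RowsOK rows) {acc B : ℕ} (hacc : ∀ f, dig f acc ≤ B)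
    (hB : B + 1530 * rows.length < 65536) (x y : ℕ → ℕ) (hx : ∀ s, x s ≤ 3) (hy : ∀ s, y s ≤ 3)
    (f : ℕ) : dig f (acc + (rows.map fun r => x r.1 * r.2.1 + y r.1 * r.2.2).sum) =
      dig f acc + (rows.map fun r => x r.1 * dig f r.2.1 + y r.1 * dig f r.2.2).sum := by
  induction rows generalizing acc B with
  | nil => simp
  | cons r rows ih =>
    simp only [List.map_cons, List.sum_cons, List.length_cons] at hB ⊢
    have hB1 : B + 1530 < 65536 := lt_of_le_of_lt
      (Nat.add_le_add_left (Nat.le_mul_of_pos_right _ (Nat.succ_pos _)) B) hB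
    have hd := dig_combination hacc hB1 (hx r.1) (hy r.1) hrows.1
    rw [← add_assoc, ih hrows.2.2 (B := B + 1530) (fun f => ?_) (by omega), hd, add_assoc]
    rw [hd]
    have h1 : x r.1 * dig f r.2.1 ≤ 3 * 255 := Nat.mul_le_mul (hx _) (hrows.1 f).1
    have h2 : y r.1 * dig f r.2.2 ≤ 3 * 255 := Nat.mul_le_mul (hy _) (hrows.1 f).2
    have := hacc f
    omega

lemma packedSum_eq (turn : Bool) (n : ℕ) (rows : List Row) (acc : ℕ) :
    packedSum turn n rows acc = acc + (rows.map fun r =>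
      (bif turn then (3 * (n >>> (r.1 + 2) &&& 3)) &&& 3 else n >>> r.1 &&& 3) * r.2.1 +
      (bif turn then n >>> r.1 &&& 3 else n >>> (r.1 + 2) &&& 3) * r.2.2).sum := by
  induction rows generalizing acc with
  | nil => rfl
  | cons r rows ih =>
    obtain ⟨s, c, c'⟩ := r
    have h : packedSum turn n ((s, c, c') :: rows) acc =
        force (Nat.land (Nat.shiftRight n s) 3) fun x =>
        force (Nat.land (Nat.shiftRight n (Nat.add s 2)) 3) fun y =>
          force (Bool.rec (Nat.add acc (Nat.add (Nat.mul x c) (Nat.mul y c')))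
            (Nat.add acc (Nat.add (Nat.mul (Nat.land (Nat.mul 3 y) 3) c) (Nat.mul x c'))) turn)
            (packedSum turn n rows) := rfl
    rw [h]
    simp only [force_eq, ih, List.map_cons, List.sum_cons]
    rw [← add_assoc]
    cases turn <;> rfl

lemma decNib_congr (n : ℕ) : (4 : ℤ) ∣ (decNib n).re - ((n &&& 3 : ℕ) : ℤ) ∧
    (4 : ℤ) ∣ (decNib n).im - ((n >>> 2 &&& 3 : ℕ) : ℤ) := by
  rw [and_three, and_three, Nat.shiftRight_eq_div_pow]
  have key : ∀ m : ℕ, (4 : ℤ) ∣ (if m % 4 = 3 then -1 else ((m % 4 : ℕ) : ℤ)) - ((m % 4 : ℕ) : ℤ) := by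
    intro m
    split <;> omega
  exact ⟨key n, key (n / 4)⟩

lemma list_dvd_sum_sub {rows : List Row} {g h : Row → ℤ} (H : ∀ r ∈ rows, (4 : ℤ) ∣ g r - h r) :
    (4 : ℤ) ∣ (rows.map g).sum - (rows.map h).sum := by
  induction rows with
  | nil => simp
  | cons r rows ih =>
    simp only [List.map_cons, List.sum_cons]
    have h1 := H r (List.mem_cons_self ..)
    have h2 := ih fun r hr => H r (List.mem_cons_of_mem _ hr)
    omega

lemma testSum_of_packed {rows : List Row} (hrows : RowsOK rows) (hl : rows.length = 28)
    {M : GVec} {x y : ℕ → ℕ} (hx : ∀ s, x s ≤ 3) (hy : ∀ s, y s ≤ 3)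
    (hM : ∀ r ∈ rows, 4 ∣ (ent M r.1).re - (x r.1 : ℤ) ∧ 4 ∣ (ent M r.1).im - (y r.1 : ℤ))
    {f : ℕ} (hf : 2 ≤ f)
    (h : ((rows.map fun r => x r.1 * r.2.1 + y r.1 * r.2.2).sum >>> 32) &&& testMask 56 = 0) :
    4 ∣ testSum rows f M := by
  have h1 := dig_sum hrows (acc := 0) (B := 0) (fun f => (dig_zero_right f).le)
    (by rw [hl]; norm_num) x y hx hy f
  rw [zero_add, dig_zero_right, zero_add] at h1
  have h2 : dig f (rows.map fun r => x r.1 * r.2.1 + y r.1 * r.2.2).sum % 4 = 0 := by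
    by_cases hf' : f < 58
    · have h3 := dig_mod_of_mask h (f := f - 2) (by omega)
      rw [dig_shiftRight, show f - 2 + 2 = f by omega] at h3
      exact h3
    · have h3 : (rows.map fun r => x r.1 * dig f r.2.1 + y r.1 * dig f r.2.2).sum = 0 := by
        refine List.sum_eq_zero fun t ht => ?_
        obtain ⟨r, hr, rfl⟩ := List.mem_map.1 ht
        obtain ⟨h4, h5⟩ := hrows.dig_eq_zero hr (f := f) (by omega)
        rw [h4, h5, mul_zero, mul_zero, add_zero]
      rw [h1, h3]
  rw [h1] at h2
  have h6 : 4 ∣ testSum rows f M - (rows.map fun r : Row =>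
      ((x r.1 * dig f r.2.1 + y r.1 * dig f r.2.2 : ℕ) : ℤ)).sum := by
    refine list_dvd_sum_sub fun r hr => ?_
    obtain ⟨⟨a, ha⟩, ⟨b, hb⟩⟩ := hM r hr
    refine ⟨a * dig f r.2.1 + b * dig f r.2.2, ?_⟩
    push_cast
    linear_combination (dig f r.2.1 : ℤ) * ha + (dig f r.2.2 : ℤ) * hb
  have h7 : (rows.map fun r : Row => ((x r.1 * dig f r.2.1 + y r.1 * dig f r.2.2 : ℕ) : ℤ)).sum =
      ((rows.map fun r : Row => x r.1 * dig f r.2.1 + y r.1 * dig f r.2.2).sum : ℕ) := by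
    rw [Nat.cast_list_sum, List.map_map]
    rfl
  rw [h7] at h6
  omega

lemma ent_dec (n s : ℕ) (hs : s / 4 < 28) : ent (dec n) s = decNib (n / 16 ^ (s / 4)) := by
  rw [ent, dif_pos hs]
  rfl

/-- The vectors with a code that passes the check have test sums divisible by `4`. -/
lemma testSum_dec {rows : List Row} (hrows : RowsOK rows) (hl : rows.length = 28)
    (hs : ∀ r ∈ rows, ∃ p : Fin 28, r.1 = 4 * (p : ℕ)) {n : ℕ}
    (h : codeCheck (testMask 56) rows n = true) {f : ℕ} (hf : 2 ≤ f) :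
    4 ∣ testSum rows f (dec n) ∧ 4 ∣ testSum rows f (i • dec n) := by
  simp only [codeCheck, Bool.and_eq_true, Nat.beq_eq, packedSum_eq, zero_add, cond_true,
    cond_false] at h
  have hle : ∀ m, m &&& 3 ≤ 3 := fun m => Nat.and_le_right
  have hd : ∀ r ∈ rows, 4 ∣ (ent (dec n) r.1).re - ((n >>> r.1 &&& 3 : ℕ) : ℤ) ∧
      4 ∣ (ent (dec n) r.1).im - ((n >>> (r.1 + 2) &&& 3 : ℕ) : ℤ) := by
    intro r hr
    obtain ⟨p, hp⟩ := hs r hr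
    have h1 := decNib_congr (n >>> r.1)
    rw [← Nat.shiftRight_add] at h1
    have h2 : n >>> r.1 = n / 16 ^ (r.1 / 4) := by
      rw [Nat.shiftRight_eq_div_pow, hp, show 4 * (p : ℕ) / 4 = p by omega, pow_mul]
      norm_num
    rw [ent_dec n r.1 (by omega), ← h2]
    exact h1
  refine ⟨testSum_of_packed hrows hl (x := fun s => n >>> s &&& 3)
    (y := fun s => n >>> (s + 2) &&& 3) (fun _ => hle _) (fun _ => hle _) hd hf h.1,
    testSum_of_packed hrows hl (x := fun s => 3 * (n >>> (s + 2) &&& 3) &&& 3)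
    (y := fun s => n >>> s &&& 3) (fun _ => hle _) (fun _ => hle _) (fun r hr => ?_) hf h.2⟩
  obtain ⟨⟨a, ha⟩, ⟨b, hb⟩⟩ := hd r hr
  rw [ent_smul, Zsqrtd.re_mul, Zsqrtd.im_mul]
  have h3 := and_three (3 * (n >>> (r.1 + 2) &&& 3))
  simp only at h3 ⊢
  constructor <;> omega

/-- A table of rows for values known modulo `a + i b`. -/
structure IsTable (a b : ℕ) (rows : List Row) : Prop where
  ok : RowsOK rows
  length : rows.length = 28
  perm : (rows.map Prod.fst).Perm ((List.range 28).map (4 * ·))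
  dvd : ∀ M ∈ D, ∀ f, 2 ≤ f → 4 ∣ testSum rows f M
  compat : ∀ r ∈ rows, ∀ f, 2 ≤ f → (a * dig f r.2.1 + b * dig f r.2.2) % 4 = 0 ∧
    (3 * b * dig f r.2.1 + a * dig f r.2.2) % 4 = 0

lemma exists_index {rows : List Row}
    (hp : (rows.map Prod.fst).Perm ((List.range 28).map (4 * ·))) {r : Row} (hr : r ∈ rows) :
    ∃ p : Fin 28, r.1 = 4 * (p : ℕ) := by
  have h1 := hp.mem_iff.1 (List.mem_map_of_mem (f := Prod.fst) hr)
  obtain ⟨k, hk, h⟩ := List.mem_map.1 h1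
  exact ⟨⟨k, List.mem_range.1 hk⟩, h.symm⟩

lemma IsTable.of_check {a b : ℕ} {rows : List Row} (h : tableCheck a b rows = true) :
    IsTable a b rows := by
  simp only [tableCheck, Bool.and_eq_true, decide_eq_true_eq, force_eq, List.all_eq_true,
    List.isPerm_iff] at h
  obtain ⟨⟨⟨⟨hl, hp⟩, hr⟩, hc⟩, hg⟩ := h
  have hok := rowsOK_of_check hr
  refine ⟨hok, hl, hp, ?_, ?_⟩
  · have key : ∀ M ∈ D, ∀ f, 2 ≤ f → 4 ∣ testSum rows f M ∧ 4 ∣ testSum rows f (i • M) := by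
      intro M hM f hf
      rw [D_eq_span] at hM
      induction hM using Submodule.span_induction with
      | mem M hM =>
        rcases hM with ⟨p, rfl⟩ | ⟨k, rfl⟩
        · have h4 : ∀ N : GVec, 4 ∣ testSum rows f ((4 : GaussianInt) • N) := fun N => by
            rw [testSum_smul]
            exact ⟨testSum rows f N, by simp⟩
          have h5 : frame p = (4 : GaussianInt) • Pi.single p 1 := by
            rw [← Pi.single_smul, frame, smul_eq_mul, mul_one]
          rw [h5, smul_comm]
          exact ⟨h4 _, h4 _⟩
        · exact testSum_dec hok hl (fun r hr => exists_index hp hr) (hg k (List.mem_finRange k)) hf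
      | zero =>
        have h0 : testSum rows f 0 = 0 := by
          have := testSum_add rows f 0 0
          rw [add_zero] at this
          omega
        rw [smul_zero, h0]
        exact ⟨dvd_zero _, dvd_zero _⟩
      | add M N _ _ h1 h2 =>
        rw [smul_add, testSum_add, testSum_add]
        exact ⟨dvd_add h1.1 h2.1, dvd_add h1.2 h2.2⟩
      | smul c M _ h1 =>
        rw [smul_comm, testSum_smul, testSum_smul rows f c (i • M), smul_smul,
          show i * i = -1 by decide]
        have h2 : testSum rows f ((-1 : GaussianInt) • M) = - testSum rows f M := by
          rw [testSum_smul]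
          simp
        rw [h2]
        refine ⟨dvd_add (h1.1.mul_left _) (h1.2.mul_left _),
          dvd_add (h1.2.mul_left _) (((dvd_neg).2 h1.1).mul_left _)⟩
    exact fun M hM f hf => (key M hM f hf).1
  · intro r hr f hf
    by_cases hf' : f < 58
    · have h1 := compat_of_check (hc r hr) (f := f - 2) (by omega)
      have e : ∀ n, Nat.shiftRight n 32 = n >>> 32 := fun _ => rfl
      rw [e, e, dig_shiftRight, dig_shiftRight, show f - 2 + 2 = f by omega] at h1
      exact h1
    · obtain ⟨h4, h5⟩ := hok.dig_eq_zero hr (f := f) (by omega)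
      simp [h4, h5]

lemma IsTable.sum_eq {a b : ℕ} {rows : List Row} (T : IsTable a b rows) {α : Type*}
    [AddCommMonoid α] (g : ℕ → α) : (rows.map fun r => g r.1).sum = ∑ p : Fin 28, g (4 * (p : ℕ)) := by
  have h1 : (rows.map fun r => g r.1) = (rows.map Prod.fst).map g := by
    rw [List.map_map]
    rfl
  rw [h1, (T.perm.map g).sum_eq, List.map_map, ← List.sum_toFinset _ List.nodup_range,
    List.toFinset_range, ← Fin.sum_univ_eq_sum_range]
  rfl

/-- The search visits the code of every lattice vector that is compatible with the value lists. -/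
theorem IsTable.search {a b : ℕ} {rows : List Row} (T : IsTable a b rows)
    {sel : ℕ → List Val} {R₀ : ℕ} {Q : ℕ → ℕ → Bool} {bud : ℕ} {M : GVec} (hM : M ∈ D)
    (v : Fin 28 → Val)
    (hv : ∀ p : Fin 28, v p ∈ sel (R₀ >>> (4 * (p : ℕ)) &&& 15) ∧ (v p).2.1 ≤ 3 ∧ (v p).2.2 ≤ 3)
    (hd : ∀ p, (⟨a, b⟩ : GaussianInt) ∣ M p - ⟨((v p).2.1 : ℕ), ((v p).2.2 : ℕ)⟩)
    (hb : ∑ p, (v p).1 ≤ bud)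
    (h : search sel R₀ Q rows 896 0 bud 0 = true) :
    Q (pack fun p => (v p).2.1 + 4 * (v p).2.2) (bud - ∑ p, (v p).1) = true := by
  let w : ℕ → Val := fun s => if h : s / 4 < 28 then v ⟨s / 4, h⟩ else (0, 0, 0)
  have hw : ∀ p : Fin 28, w (4 * (p : ℕ)) = v p := fun p => by
    have h1 : 4 * (p : ℕ) / 4 < 28 := by omega
    simp only [w, dif_pos h1]
    congr 1
    exact Fin.ext (by simp)
  have he : ∀ p : Fin 28, ent M (4 * (p : ℕ)) = M p := fun p => by
    have h1 : 4 * (p : ℕ) / 4 < 28 := by omega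
    rw [ent, dif_pos h1]
    congr 1
    exact Fin.ext (by simp)
  have hsum : (rows.map fun r => (w r.1).1).sum = ∑ p, (v p).1 := by
    rw [T.sum_eq fun s => (w s).1]
    simp only [hw]
  have h1 := search_sound_aux (acc := 0) (R := 0) (B := 0) (bud := bud) (sel := sel) (R₀ := R₀)
    (Q := Q) w T.ok (fun f => (dig_zero_right f).le) (by rw [T.length]; norm_num) (fun f hf => ?_)
    (fun r hr => ?_) (by rwa [hsum]) (by rwa [T.length])
  · rw [hsum, zero_add, T.sum_eq fun s => ((w s).2.1 + 4 * (w s).2.2) <<< s] at h1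
    simp only [hw] at h1
    exact h1
  · have h2 := T.dvd M hM f hf
    have h3 : (4 : ℤ) ∣ testSum rows f M - (rows.map fun r : Row =>
        (((w r.1).2.1 * dig f r.2.1 + (w r.1).2.2 * dig f r.2.2 : ℕ) : ℤ)).sum := by
      refine list_dvd_sum_sub fun r hr => ?_
      obtain ⟨p, hp⟩ := exists_index T.perm hr
      obtain ⟨c, hc⟩ := hd p
      obtain ⟨h4, h5⟩ := T.compat r hr f hf
      have h6 := congrArg Zsqrtd.re hc
      have h7 := congrArg Zsqrtd.im hc
      rw [Zsqrtd.re_sub, Zsqrtd.re_mul] at h6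
      rw [Zsqrtd.im_sub, Zsqrtd.im_mul] at h7
      simp only at h6 h7
      obtain ⟨e, h4⟩ := Nat.dvd_of_mod_eq_zero h4
      obtain ⟨e', h5⟩ := Nat.dvd_of_mod_eq_zero h5
      rw [hp, he, hw]
      have h4' : (a : ℤ) * dig f r.2.1 + b * dig f r.2.2 = 4 * e := by exact_mod_cast h4
      have h5' : (3 : ℤ) * b * dig f r.2.1 + a * dig f r.2.2 = 4 * e' := by exact_mod_cast h5
      refine ⟨c.re * e + c.im * e' - b * c.im * dig f r.2.1, ?_⟩
      push_cast
      linear_combination (dig f r.2.1 : ℤ) * h6 + (dig f r.2.2 : ℤ) * h7 + c.re * h4' + c.im * h5'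
    have h7 : (rows.map fun r : Row =>
        (((w r.1).2.1 * dig f r.2.1 + (w r.1).2.2 * dig f r.2.2 : ℕ) : ℤ)).sum =
        ((rows.map fun r : Row =>
          (w r.1).2.1 * dig f r.2.1 + (w r.1).2.2 * dig f r.2.2).sum : ℕ) := by
      rw [Nat.cast_list_sum, List.map_map]
      rfl
    rw [h7] at h3
    rw [dig_zero_right, zero_add]
    omega
  · obtain ⟨p, hp⟩ := exists_index T.perm hr
    rw [hp, hw]
    exact hv p

/-! ## Membership in the lattice -/

/-- The table of the products with the vectors `dualVec k`. -/
def dualRows : List Row :=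
  [(0, 0x2000200000000000200000000000000000002000000000002000000030001000200020000000200020000000100030002000000010001000100020001000200030003000300030001000300000003000000030003000000000002000000030000000000c200ce,
     0x20002000000000000000200000000000200000000000000000002000100010002000200020000000000020003000300000002000100030002000300020003000300010003000100030003000300000003000000000001000200000003000000000000005b0066),
   (4, 0x20002000000000000000200020002000000020000000000000002000300030002000200020002000000020001000300000002000300030003000200010002000000020003000100010003000300000003000000000000000100000003000000000000007f0075,
     0x20002000000000002000000020002000200000000000000020000000300010002000200020002000200000003000300020000000300010002000100020003000200000001000100030003000000010000000100000000000000030000000100000000002c0044),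
   (8, 0x2000200000000000200000000000000020000000000000002000000030001000200000002000000000000000300030000000000030003000100020003000200010003000200020000000200010000000300000000000000000000000000000000000000c40080,
     0x2000200000000000000020000000000000002000000000000000200010001000000020000000200000000000300010000000000030001000200030002000100030003000200020002000000000003000000010000000000000000000000000000000000fa002d),
   (12, 0x2000200000000000000020002000200020000000000000000000200030003000200000002000200000000000300030000000000010001000100000003000200000002000000020002000000000001000000010000000300000003000000000000000000d70066,
     0x2000200000000000200000002000200000002000000000002000000030001000000020002000200000000000300010000000000010003000000030002000100020000000200000000000200010000000100000003000000030000000000000000000000bf006e),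
   (16, 0x2000200000000000000020000000000020000000300030003000100000002000100030003000100010001000200020000000200010001000300010000000000030000000000000000000000000000000000000000000000000000006c00c6,
     0x200020000000000020000000000000000000200030001000100010002000000030003000100010001000300020002000200000001000300010001000000000000000100000000000000000000000000000000000000000000000000ec004d),
   (20, 0x200020002000200020000000000000000000200030003000100030002000200010001000100010003000100020002000200000001000300030001000000000001000000020002000100030003000100000001000000000000000000ad005b,
     0x2000200020002000000020000000000020000000300010003000300020002000100030001000300010001000200020000000200030003000100010000000000000003000200020003000300010001000100000000000000000000002c002a),
   (24, 0x2000200020000000000000000000200010003000100030002000200030003000100010001000100000000000000000003000300010001000200020001000200010003000200000000000100010000000300000000000000a100f0,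
     0x20002000000020000000000020000000300030003000300020002000300010001000300010003000000000000000000030001000100030002000200020003000300030000000200010000000000030000000100000000001500ce),
   (28, 0x2000000000002000000010003000100030000000200030001000300010003000100000000000200000003000300030001000000000003000200010001000100030000000100030001000100000000000000030089,
     0x200000000000000000002000300030003000300020000000100010001000100010001000000000000000200030001000100010000000000020001000100030003000300010000000100010000000300000000006800d9),
   (32, 0x20002000200000003000300000000000300010002000200000000000200020001000100010001000000030002000300030000000000000000000000020001000000010000000000010000002900b9,
     0x20002000000020003000100000000000100010002000200000000000200020001000300010003000300000003000200000001000000000000000000010002000100000000000000000003006500ec),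
   (36, 0x20002000000000003000300020002000100030000000200000000000200020000000000000000000100020003000000000003000300030003000100010000000100030003000000000003001a00ec,
     0x20002000000000003000100020002000300030002000000000000000200020000000000000000000200030000000100030000000300010001000100000003000300030000000100030000004200b7),
   (40, 0x2000000030001000200020003000300000000000000020002000200000002000200000000000100010002000000030000000000000000000000020000000100000000000300000052006e,
     0x20001000100020002000300010000000000020000000200020002000000000002000100000002000300030000000000000000000000020000000100000000000000000001005a00e2),
   (44, 0x30001000000000001000100020000000200000000000000030001000300010003000000000003000300000001000300030003000100010001000100000003000000030012005a,
     0x1000100000000000100030000000200000002000000000001000100010001000000010003000000000001000300030003000100010003000100030003000000030000000b0038),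
   (48, 0x2000200020000000000000003000300010003000200010001000200030001000300020000000100030002000000030000000000000000000000000000000000f20057,
     0x20002000000020000000000030001000300030001000200020003000100010002000100010000000200010003000000000000000000000000000000000000002900d6),
   (52, 0x200000000000200010001000300030003000200000001000300010003000000030000000100020002000300030000000100010003000000000000002c00d9,
     0x20002000000010003000300010002000100010000000100010000000100000001000200030003000200000001000100030000000100000000009e0049),
   (56, 0x200000003000300010003000000030003000200000000000300020003000000010000000300000003000300020000000100000000000000c30002,
     0x200030001000300030003000000020001000000000002000100000001000000030000000100030001000000020000000300000000004500a8),
   (60, 0x10001000100010001000200000001000000000001000200000001000100000001000000030000000000000000000000000000006600cf,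
     0x10003000100030002000300010000000000000002000300010000000000030000000300000001000000000000000000000000006c001c),
   (64, 0x200020001000300030001000300020001000100000003000000020000000300030000000000010000000000000001008300e2,
     0x200020003000300010001000200010001000300030000000200000003000000000001000100000000000000010000004000ce),
   (68, 0x100010001000300030002000000020000000300010001000100000002000200030001000000030000000100f300b5,
     0x10003000300030002000100020000000300000001000300000003000200020001000100030000000100000043001c),
   (72, 0x2000000020003000300030000000300020000000100000000000000000000000000000001000000d1004d,
     0x20003000200030001000300000000000200000003000000000000000000000000000000030031003f),
   (76, 0x300020002000000030001000100000001000100000000000300000001000300000049003c,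
     0x30000000200020003000000010003000100000000000300030000000100000000000100590097),
   (80, 0x20001000100030003000000030000000300000001000000030000000100d1005a,
     0x2000000010003000300010003000000030000000100000003000000010000006a004a),
   (84, 0x3000300000000000000010000000000000003000000010003000000ff00a3,
     0x3000100000000000100000000000000030000000100000000000100830077),
   (88, 0x10003000300000000000100000000000000010003000000b9003c,
     0x3000300000001000100000000000000010000000000010025005f),
   (92, 0x100000002000000030003000100000000000300050093,
     0x30000000200030001000000030003000000ac0018),
   (96, 0x3000100030000000000000000000300c1006e,
     0x1000100000001000000000003000000ac00cc),
   (100, 0x10000000300000000000300c500cc,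
     0x3000000010003000000bd00d4),
   (104, 0x300000003005c002f,
     0x300000003000000be0013),
   (108, 0x300e300cc,
     0x30000009f0075)]

lemma dualRows_ok : RowsOK dualRows := rowsOK_of_check (k := 58) (by decide +kernel)

lemma dualRows_length : dualRows.length = 28 := by decide +kernel

/-- The row of a given index. -/
def dualRow (p : Fin 28) : Row := dualRows[(p : ℕ)]'(by rw [dualRows_length]; exact p.2)

lemma dualRow_fst (p : Fin 28) : (dualRow p).1 = 4 * (p : ℕ) := by
  revert p
  decide +kernel

lemma dualRow_dig (k p : Fin 28) :
    (((dig (56 - 2 * k) (dualRow p).2.1 : ℕ) : ℤ) - (dualVec k p).re) % 4 = 0 ∧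
    (((dig (56 - 2 * k) (dualRow p).2.2 : ℕ) : ℤ) - (dualVec k p).im) % 4 = 0 ∧
    (((dig (57 - 2 * k) (dualRow p).2.1 : ℕ) : ℤ) + (dualVec k p).im) % 4 = 0 ∧
    (((dig (57 - 2 * k) (dualRow p).2.2 : ℕ) : ℤ) - (dualVec k p).re) % 4 = 0 := by
  revert k p
  decide +kernel

lemma dualRows_eq : dualRows = List.ofFn dualRow := by
  refine List.ext_getElem (by rw [dualRows_length, List.length_ofFn]) fun n h1 h2 => ?_
  rw [List.getElem_ofFn]
  rfl

lemma testSum_dualRows (f : ℕ) (M : GVec) : testSum dualRows f M =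
    ∑ p, ((M p).re * (dig f (dualRow p).2.1 : ℤ) + (M p).im * (dig f (dualRow p).2.2 : ℤ)) := by
  rw [testSum, dualRows_eq, List.map_ofFn, List.sum_ofFn]
  refine Finset.sum_congr rfl fun p _ => ?_
  simp only [Function.comp, dualRow_fst, ent_mul]

lemma sum_re (f : Fin 28 → GaussianInt) : (∑ p, f p).re = ∑ p, (f p).re :=
  map_sum (AddMonoidHom.mk ⟨Zsqrtd.re, rfl⟩ fun _ _ => rfl : GaussianInt →+ ℤ) f Finset.univ

lemma sum_im (f : Fin 28 → GaussianInt) : (∑ p, f p).im = ∑ p, (f p).im :=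
  map_sum (AddMonoidHom.mk ⟨Zsqrtd.im, rfl⟩ fun _ _ => rfl : GaussianInt →+ ℤ) f Finset.univ

lemma dvd_sum_sub {f g : Fin 28 → ℤ} {n : ℤ} (h : ∀ p, n ∣ f p - g p) :
    n ∣ ∑ p, f p - ∑ p, g p := by
  rw [← Finset.sum_sub_distrib]
  exact Finset.dvd_sum fun p _ => h p

lemma mem_D_of_testSum {M : GVec} (h : ∀ f, 2 ≤ f → 4 ∣ testSum dualRows f M) : M ∈ D := by
  refine mem_D_of_dual fun k => four_dvd ?_
  have h1 : (4 : ℤ) ∣ testSum dualRows (56 - 2 * k) M - (ipv M (dualVec k)).re := by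
    rw [testSum_dualRows, ipv, sum_re]
    refine dvd_sum_sub fun p => ?_
    obtain ⟨e1, e2, -, -⟩ := dualRow_dig k p
    obtain ⟨a, ha⟩ := Int.dvd_of_emod_eq_zero e1
    obtain ⟨b, hb⟩ := Int.dvd_of_emod_eq_zero e2
    refine ⟨(M p).re * a + (M p).im * b, ?_⟩
    rw [Zsqrtd.re_mul, Zsqrtd.re_star, Zsqrtd.im_star]
    linear_combination (M p).re * ha + (M p).im * hb
  have h2 : (4 : ℤ) ∣ testSum dualRows (57 - 2 * k) M - (ipv M (dualVec k)).im := by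
    rw [testSum_dualRows, ipv, sum_im]
    refine dvd_sum_sub fun p => ?_
    obtain ⟨-, -, e1, e2⟩ := dualRow_dig k p
    obtain ⟨a, ha⟩ := Int.dvd_of_emod_eq_zero e1
    obtain ⟨b, hb⟩ := Int.dvd_of_emod_eq_zero e2
    refine ⟨(M p).re * a + (M p).im * b, ?_⟩
    rw [Zsqrtd.im_mul, Zsqrtd.re_star, Zsqrtd.im_star]
    linear_combination (M p).re * ha + (M p).im * hb
  have h3 := h (56 - 2 * k) (by omega)
  have h4 := h (57 - 2 * k) (by omega)
  constructor <;> omega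

/-- A code of a member of the lattice. -/
def codeMem (n : ℕ) : Bool := force (testMask 56) fun m => codeCheck m dualRows n

lemma dec_mem_D {n : ℕ} (h : codeMem n = true) : dec n ∈ D := by
  rw [codeMem, force_eq] at h
  exact mem_D_of_testSum fun f hf => (testSum_dec dualRows_ok dualRows_length
    (fun r hr => by
      rw [dualRows_eq, List.mem_ofFn] at hr
      obtain ⟨p, rfl⟩ := hr
      exact ⟨p, dualRow_fst p⟩) h hf).1

lemma mem_D_congr {v w : GVec} (h : ∀ p, 4 ∣ v p - w p) (hw : w ∈ D) : v ∈ D := by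
  have h1 : v = (v - w) + w := by abel
  rw [h1]
  exact D.add_mem (mem_D_of_four_dvd h) hw

/-! ## Integrality -/

lemma gen_integral (j k : Fin 28) :
    (ipv (dec (genCode j)) (dec (genCode k))).re % 4 = 0 ∧
    (ipv (dec (genCode j)) (dec (genCode k))).im % 4 = 0 := by
  have h : ∀ j k : Fin 28, j ≤ k → (ipv (dec (genCode j)) (dec (genCode k))).re % 4 = 0 ∧
      (ipv (dec (genCode j)) (dec (genCode k))).im % 4 = 0 := by
    decide +kernel
  rcases le_total j k with hjk | hjk
  · exact h j k hjk
  · rw [← star_ipv, Zsqrtd.re_star, Zsqrtd.im_star]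
    have := h k j hjk
    omega

lemma ipv_frame (v : GVec) (p : Fin 28) : ipv v (frame p) = 4 * v p := by
  rw [ipv, Finset.sum_eq_single p]
  · rw [frame, Pi.single_eq_same, mul_comm]
    rfl
  · intro q _ hq
    rw [frame, Pi.single_eq_of_ne hq, star_zero, mul_zero]
  · simp

lemma ipv_add_right (u v w : GVec) : ipv u (v + w) = ipv u v + ipv u w := by
  rw [← star_ipv, ipv_add_left, star_add, star_ipv, star_ipv]

lemma D_integral {v w : GVec} (hv : v ∈ D) (hw : w ∈ D) : 4 ∣ ipv v w := by
  rw [D_eq_span] at hv hw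
  induction hw using Submodule.span_induction with
  | mem w hw =>
    rcases hw with ⟨p, rfl⟩ | ⟨k, rfl⟩
    · exact ⟨v p, ipv_frame v p⟩
    · induction hv using Submodule.span_induction with
      | mem v hv =>
        rcases hv with ⟨p, rfl⟩ | ⟨j, rfl⟩
        · rw [← star_ipv, ipv_frame, star_mul, mul_comm]
          exact ⟨_, rfl⟩
        · exact four_dvd (gen_integral j k)
      | zero => simp [ipv]
      | add v v' _ _ h h' => rw [ipv_add_left]; exact dvd_add h h'
      | smul c v _ h => rw [ipv_smul_left]; exact h.mul_left c
  | zero => simp [ipv]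
  | add w w' _ _ h h' => rw [ipv_add_right]; exact dvd_add h h'
  | smul c w _ h => rw [ipv_smul_right]; exact h.mul_left _

/-- The inner products of lattice vectors are Gaussian integers. -/
lemma lattice_integral {x y : V} (hx : x ∈ lattice) (hy : y ∈ lattice) :
    ∃ z, herm x y = GaussianInt.toComplex z := by
  obtain ⟨v, hv, rfl⟩ := exists_vec hx
  obtain ⟨w, hw, rfl⟩ := exists_vec hy
  obtain ⟨z, hz⟩ := D_integral hv hw
  exact ⟨z, herm_vec v w z hz⟩

lemma frame_apply_self (p : Fin 28) : frame p p = 4 := Pi.single_eq_same ..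

lemma herm_frame (x : V) (p : Fin 28) : herm x (vec (frame p)) = 2 * x (ix.symm p) := by
  rw [herm, PiLp.inner_apply, Finset.sum_eq_single (ix.symm p)]
  · rw [vec_apply, Equiv.apply_symm_apply, frame_apply_self, RCLike.inner_apply, toComplex_four,
      map_div₀, Complex.conj_ofNat, Complex.conj_ofNat]
    ring
  · intro q _ hq
    have h : ix q ≠ p := fun h => hq (by rw [← h, Equiv.symm_apply_apply])
    rw [vec_apply, frame, Pi.single_eq_of_ne h, map_zero, zero_div, inner_zero_left]
  · simp

lemma latBasis_dual_mem (k : Fin 28) : dualVec k ∈ D := by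
  rw [dualVec]
  split
  · exact frame_mem k
  · have h : ∀ k, codeMem (dualCode k) = true := by decide +kernel
    exact dec_mem_D (h k)

/-- A vector whose products with the lattice are Gaussian integers belongs to the lattice. -/
lemma mem_lattice_of_dual {x : V}
    (h : ∀ y ∈ lattice, ∃ z, herm x y = GaussianInt.toComplex z) : x ∈ lattice := by
  choose z hz using fun p => h _ (frame_mem p)
  have hx : x = vec z := by
    ext q
    have h1 := hz (ix q)
    rw [vecL_apply, herm_frame, Equiv.symm_apply_apply] at h1
    rw [vec_apply, ← h1]
    ring
  subst hx
  refine mem_D.1 (mem_D_of_dual fun k => ?_)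
  obtain ⟨c, hc⟩ := h _ (latBasis_dual_mem k)
  exact ⟨c, ipv_of_herm _ _ c hc⟩

lemma herm_map (g : V ≃ₗᵢ[ℂ] V) (x y : V) : herm (g x) (g y) = herm x y := g.inner_map_map y x

/-- An isometry that maps the generators of the lattice into the lattice preserves it. -/
lemma mem_autLattice {g : V ≃ₗᵢ[ℂ] V} (hf : ∀ p, g (vec (frame p)) ∈ lattice)
    (hg : ∀ k, g (vec (dec (genCode k))) ∈ lattice) : g ∈ autLattice := by
  have h1 : ∀ x ∈ lattice, g x ∈ lattice := by
    intro x hx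
    obtain ⟨v, hv, rfl⟩ := exists_vec hx
    rw [D_eq_span] at hv
    induction hv using Submodule.span_induction with
    | mem v hv =>
      rcases hv with ⟨p, rfl⟩ | ⟨k, rfl⟩
      · exact hf p
      · exact hg k
    | zero =>
      rw [show vec 0 = 0 from map_zero vecL, map_zero]
      exact lattice.zero_mem
    | add v w hv hw h h' =>
      rw [vec_add, map_add]
      exact lattice.add_mem (h (by rw [← D_eq_span] at hv; exact hv))
        (h' (by rw [← D_eq_span] at hw; exact hw))
    | smul c v hv h =>
      rw [vec_smul, map_smul]
      exact lattice.smul_mem c (h (by rw [← D_eq_span] at hv; exact hv))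
  refine fun x => ⟨fun hx => mem_lattice_of_dual fun y hy => ?_, h1 x⟩
  rw [← herm_map g]
  exact lattice_integral hx (h1 y hy)

/-! ## Isometries with given columns -/

/-- The isometry of `𝔯` with given orthogonal columns. -/
lemma exists_isometry (Y : Fin 28 → GVec)
    (hY : ∀ p q, ipv (Y p) (Y q) = if p = q then 16 else 0) :
    ∃ g : V ≃ₗᵢ[ℂ] V, ∀ M N : GVec, (∀ r, 4 * N r = ∑ p, M p * Y p r) → g (vec M) = vec N := by
  have h16 : GaussianInt.toComplex 16 = 16 := map_ofNat _ 16
  let b : Fin 7 × Fin 4 → V := fun q => (2⁻¹ : ℂ) • vec (Y (ix q))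
  have hb : Orthonormal ℂ b := by
    rw [orthonormal_iff_ite]
    intro q r
    have h1 := herm_vec_mul (Y (ix r)) (Y (ix q))
    rw [hY, herm] at h1
    rw [inner_smul_left, inner_smul_right]
    by_cases hqr : q = r
    · subst hqr
      rw [if_pos rfl, h16] at h1
      rw [if_pos rfl]
      simp only [map_inv₀, Complex.conj_ofNat]
      linear_combination h1 / 16
    · have h2 : ¬ ix r = ix q := fun h => hqr (ix.injective h).symm
      rw [if_neg h2, map_zero] at h1
      rw [if_neg hqr]
      have h3 : inner ℂ (vec (Y (ix q))) (vec (Y (ix r))) = (0 : ℂ) := by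
        linear_combination h1 / 4
      rw [h3, mul_zero, mul_zero]
  have hc : Fintype.card (Fin 7 × Fin 4) = Module.finrank ℂ V := by simp
  let B : OrthonormalBasis (Fin 7 × Fin 4) ℂ V :=
    OrthonormalBasis.mk hb (by
      rw [hb.linearIndependent.span_eq_top_of_card_eq_finrank' hc])
  have hB : ∀ q, B q = b q := fun q => by simp [B]
  refine ⟨B.repr.symm, fun M N hN => ?_⟩
  rw [← B.sum_repr_symm]
  ext q
  have h1 := congrArg GaussianInt.toComplex (hN (ix q))
  rw [map_mul, map_sum, toComplex_four, ← ix.sum_comp] at h1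
  simp only [map_mul] at h1
  rw [WithLp.ofLp_sum, Finset.sum_apply]
  simp only [hB, b, PiLp.smul_apply, smul_eq_mul, vec_apply]
  rw [show GaussianInt.toComplex (N (ix q)) / 2 = 4 * GaussianInt.toComplex (N (ix q)) / 8 by ring,
    h1, Finset.sum_div]
  exact Finset.sum_congr rfl fun r _ => by ring

/-! ## Monomial transformations -/

/-- A monomial transformation of the 28 coordinates. If the entry with index `p` is `(q, u)`, then
the coordinate `p` of the image is `i ^ u` times the coordinate `q`. -/
abbrev Mono : Type := List (ℕ × ℕ)

/-- The coordinate which is moved to `p`. -/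
def Mono.src (m : Mono) (p : Fin 28) : Fin 28 := Fin.ofNat 28 (m.getD p (0, 0)).1

/-- The exponent of the power of `i` at the coordinate `p`. -/
def Mono.pow (m : Mono) (p : Fin 28) : ℕ := (m.getD p (0, 0)).2

/-- The action of a monomial transformation. -/
def act (m : Mono) (M : GVec) : GVec := fun p => i ^ m.pow p * M (m.src p)

lemma act_add (m : Mono) (M N : GVec) : act m (M + N) = act m M + act m N := by
  funext p
  simp [act, mul_add]

lemma act_smul (m : Mono) (c : GaussianInt) (M : GVec) : act m (c • M) = c • act m M := by
  funext p
  simp only [act, Pi.smul_apply, smul_eq_mul]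
  ring

lemma star_i_mul_i : star i * i = 1 := by decide

lemma i_pow_mul_star (n : ℕ) : i ^ n * star (i ^ n) = 1 := by
  rw [star_pow, ← mul_pow, mul_comm i, star_i_mul_i, one_pow]

lemma ipv_act {m : Mono} (hm : Function.Injective m.src) (M N : GVec) :
    ipv (act m M) (act m N) = ipv M N := by
  have h := (Function.Bijective.sum_comp (Finite.injective_iff_bijective.1 hm)
    fun p => M p * star (N p))
  rw [ipv, ipv, ← h]
  refine Finset.sum_congr rfl fun p _ => ?_
  rw [act, act, star_mul']
  linear_combination M (m.src p) * star (N (m.src p)) * i_pow_mul_star (m.pow p)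

/-- The composition of monomial transformations. -/
def Mono.comp (m n : Mono) : Mono :=
  m.map fun x => ((n.getD x.1 (0, 0)).1, (x.2 + (n.getD x.1 (0, 0)).2) % 4)

lemma i_pow_mod (n : ℕ) : i ^ (n % 4) = i ^ n := by
  conv_rhs => rw [← Nat.mod_add_div n 4, pow_add, pow_mul, show i ^ 4 = 1 by decide, one_pow,
    mul_one]

/-- The entries are indices of coordinates. -/
def Mono.IsIndex (m : Mono) : Prop := m.length = 28 ∧ ∀ x ∈ m, x.1 < 28

lemma getD_eq {m : Mono} (h : m.IsIndex) (p : Fin 28) :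
    m.getD p (0, 0) = m[(p : ℕ)]'(by rw [h.1]; exact p.2) :=
  (List.getElem_eq_getD (0, 0)).symm

lemma src_val {m : Mono} (h : m.IsIndex) (p : Fin 28) :
    ((m.src p : Fin 28) : ℕ) = (m.getD p (0, 0)).1 := by
  have h1 : (m.getD p (0, 0)).1 < 28 := by
    rw [getD_eq h]
    exact h.2 _ (List.getElem_mem _)
  exact Nat.mod_eq_of_lt h1

lemma act_comp {m n : Mono} (hm : m.IsIndex) (M : GVec) :
    act (m.comp n) M = act m (act n M) := by
  funext p
  have h1 : (m.comp n).getD p (0, 0) =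
      ((n.getD (m.src p) (0, 0)).1, (m.pow p + (n.getD (m.src p) (0, 0)).2) % 4) := by
    have hl : (p : ℕ) < (m.comp n).length := by
      rw [Mono.comp, List.length_map, hm.1]
      exact p.2
    rw [← List.getElem_eq_getD (h := hl), Mono.pow, src_val hm, getD_eq hm]
    simp only [Mono.comp, List.getElem_map]
  rw [act, act, act, Mono.pow, Mono.src, h1]
  simp only
  rw [i_pow_mod, pow_add, mul_assoc]
  rfl

/-! ## Monomial transformations of codes -/

/-- The code of `i z` for a digit that is the code of `z`. -/
def rot (n : ℕ) : ℕ :=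
  Nat.add (Nat.land (Nat.mul 3 (Nat.shiftRight n 2)) 3) (Nat.mul 4 (Nat.land n 3))

/-- The code of `i ^ u * z` for a digit that is the code of `z`. -/
def rotN (u n : ℕ) : ℕ := Nat.rec (motive := fun _ => ℕ → ℕ) (fun n => n)
  (fun _ ih n => force (rot n) ih) u n

lemma rotN_zero (n : ℕ) : rotN 0 n = n := rfl

lemma rotN_succ (u n : ℕ) : rotN (u + 1) n = rotN u (rot n) := force_eq (rot n) (rotN u)

lemma rot_lt (n : ℕ) : rot n < 16 := by
  have h1 : (3 * (n >>> 2)) &&& 3 = (3 * (n >>> 2)) % 4 := and_three _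
  have h2 : n &&& 3 = n % 4 := and_three _
  have h3 : rot n = ((3 * (n >>> 2)) &&& 3) + 4 * (n &&& 3) := rfl
  omega

lemma rotN_lt {u n : ℕ} (hn : n < 16) : rotN u n < 16 := by
  induction u generalizing n with
  | zero => exact hn
  | succ u ih => rw [rotN_succ]; exact ih (rot_lt n)

lemma four_dvd_iff {z : GaussianInt} : 4 ∣ z ↔ (4 : ℤ) ∣ z.re ∧ (4 : ℤ) ∣ z.im := by
  constructor
  · rintro ⟨w, rfl⟩
    simp [Zsqrtd.re_mul, Zsqrtd.im_mul]
  · rintro ⟨h1, h2⟩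
    exact four_dvd ⟨by omega, by omega⟩

lemma decNib_rot (n : ℕ) : 4 ∣ decNib (rot n) - i * decNib n := by
  have h1 : (3 * (n >>> 2)) &&& 3 = (3 * (n >>> 2)) % 4 := and_three _
  have h2 : n &&& 3 = n % 4 := and_three _
  have h3 : rot n = ((3 * (n >>> 2)) &&& 3) + 4 * (n &&& 3) := rfl
  obtain ⟨⟨a, ha⟩, ⟨b, hb⟩⟩ := decNib_congr n
  obtain ⟨⟨c, hc⟩, ⟨d, hd⟩⟩ := decNib_congr (rot n)
  have h4 : rot n &&& 3 = rot n % 4 := and_three _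
  have h5 : rot n >>> 2 &&& 3 = rot n / 4 % 4 := by
    rw [and_three, Nat.shiftRight_eq_div_pow]
  have h6 : n >>> 2 &&& 3 = n >>> 2 % 4 := and_three _
  rw [four_dvd_iff]
  simp only [Zsqrtd.re_sub, Zsqrtd.im_sub, Zsqrtd.re_mul, Zsqrtd.im_mul]
  generalize n >>> 2 &&& 3 = r' at *
  generalize n >>> 2 = t at *
  generalize n &&& 3 = s at *
  generalize rot n &&& 3 = s' at *
  generalize 3 * t &&& 3 = t' at *
  have h7 : rot n / 4 = s := by omega
  have h8 : rot n % 4 = t' := by omega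
  generalize rot n >>> 2 &&& 3 = r at *
  generalize (decNib (rot n)).re = x at *
  generalize (decNib (rot n)).im = y at *
  generalize (decNib n).re = z at *
  generalize (decNib n).im = w at *
  constructor <;> omega

lemma decNib_rotN (u n : ℕ) : 4 ∣ decNib (rotN u n) - i ^ u * decNib n := by
  induction u generalizing n with
  | zero => simp [rotN_zero]
  | succ u ih =>
    rw [rotN_succ, pow_succ]
    have h := dvd_add (ih (rot n)) ((decNib_rot n).mul_left (i ^ u))
    convert h using 1
    ring

lemma decNib_mod (n : ℕ) : decNib (n % 16) = decNib n := by
  have h1 : n % 16 % 4 = n % 4 := by omega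
  have h2 : n % 16 / 4 % 4 = n / 4 % 4 := by omega
  rw [decNib, decNib, h1, h2]

/-- The code of the image under a monomial transformation. -/
def actCode (m : Mono) (n : ℕ) : ℕ :=
  List.rec 0 (fun x _ ih => Nat.add (rotN x.2 (Nat.land (Nat.shiftRight n (Nat.mul 4 x.1)) 15))
    (Nat.mul 16 ih)) m

lemma actCode_cons (x : ℕ × ℕ) (m : Mono) (n : ℕ) :
    actCode (x :: m) n = rotN x.2 (n >>> (4 * x.1) &&& 15) + 16 * actCode m n := rfl

lemma and_fifteen (n : ℕ) : n &&& 15 = n % 16 := Nat.and_two_pow_sub_one_eq_mod n 4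

lemma actCode_digit (m : Mono) (n : ℕ) {p : ℕ} (hp : p < m.length) :
    actCode m n / 16 ^ p % 16 = rotN (m[p]).2 (n >>> (4 * (m[p]).1) &&& 15) := by
  induction m generalizing p with
  | nil => simp at hp
  | cons x m ih =>
    have h := rotN_lt (u := x.2) (n := n >>> (4 * x.1) &&& 15) (by rw [and_fifteen]; omega)
    rw [actCode_cons]
    cases p with
    | zero =>
      simp only [pow_zero, Nat.div_one, List.getElem_cons_zero]
      omega
    | succ p =>
      rw [pow_succ', ← Nat.div_div_eq_div_mul]
      rw [show (rotN x.2 (n >>> (4 * x.1) &&& 15) + 16 * actCode m n) / 16 = actCode m n by omega]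
      rw [List.getElem_cons_succ]
      exact ih _

lemma dec_actCode {m : Mono} (hm : m.IsIndex) (n : ℕ) (p : Fin 28) :
    4 ∣ dec (actCode m n) p - act m (dec n) p := by
  have h1 : dec (actCode m n) p = decNib (actCode m n / 16 ^ (p : ℕ) % 16) := (decNib_mod _).symm
  rw [h1, actCode_digit m n (by rw [hm.1]; exact p.2), and_fifteen]
  have h2 : act m (dec n) p =
      i ^ (m.getD p (0, 0)).2 * decNib (n >>> (4 * (m.getD p (0, 0)).1) % 16) := by
    rw [act, Mono.pow, decNib_mod, dec, src_val hm, Nat.shiftRight_eq_div_pow, pow_mul]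
    norm_num
  rw [h2, getD_eq hm]
  exact decNib_rotN _ _

/-- Checks that a monomial transformation preserves the lattice. -/
def Mono.check (m : Mono) : Bool :=
  (decide (m.length = 28) && m.all fun x => Nat.blt x.1 28) &&
    decide (Function.Injective m.src) &&
    (List.finRange 28).all fun k => force (actCode m (genCode k)) codeMem

/-- A monomial transformation that preserves the lattice. -/
structure Mono.IsSym (m : Mono) : Prop where
  index : m.IsIndex
  inj : Function.Injective m.src
  mem : ∀ M ∈ D, act m M ∈ D

lemma act_frame {m : Mono} (hm : Function.Injective m.src) (p : Fin 28) :
    act m (frame (m.src p)) = i ^ m.pow p • frame p := by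
  funext q
  rw [act, Pi.smul_apply, smul_eq_mul]
  by_cases h : q = p
  · rw [h, frame_apply_self, frame_apply_self]
  · rw [frame, Pi.single_eq_of_ne fun h' => h (hm h'), mul_zero, frame, Pi.single_eq_of_ne h,
      mul_zero]

lemma Mono.IsSym.of_check {m : Mono} (h : m.check = true) : m.IsSym := by
  simp only [Mono.check, Bool.and_eq_true, decide_eq_true_eq, List.all_eq_true, force_eq] at h
  obtain ⟨⟨⟨h1, h2⟩, h3⟩, h4⟩ := h
  have hi : m.IsIndex := ⟨h1, fun x hx => Nat.blt_eq.mp (h2 x hx)⟩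
  refine ⟨hi, h3, fun M hM => ?_⟩
  rw [D_eq_span] at hM
  induction hM using Submodule.span_induction with
  | mem M hM =>
    rcases hM with ⟨p, rfl⟩ | ⟨k, rfl⟩
    · obtain ⟨q, rfl⟩ := (Finite.injective_iff_bijective.1 h3).2 p
      rw [act_frame h3]
      exact D.smul_mem _ (frame_mem q)
    · refine mem_D_congr (fun p => ?_) (dec_mem_D (h4 k (List.mem_finRange k)))
      rw [dvd_sub_comm]
      exact dec_actCode hi (genCode k) p
  | zero =>
    have h0 : act m 0 = 0 := by
      funext p
      simp [act]
    rw [h0]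
    exact D.zero_mem
  | add M N _ _ h h' => rw [act_add]; exact D.add_mem h h'
  | smul c M _ h => rw [act_smul]; exact D.smul_mem c h

lemma Mono.IsSym.isSacred {m : Mono} (hm : m.IsSym) {M : GVec} (h : IsSacred M) :
    IsSacred (act m M) := ⟨hm.mem M h.1, by rw [ipv_act hm.inj]; exact h.2⟩

/-- Monomial transformations that preserve `D` come from automorphisms of the lattice. -/
lemma Mono.IsSym.exists_aut {m : Mono} (hm : m.IsSym) :
    ∃ g ∈ autLattice, ∀ M, g (vec M) = vec (act m M) := by
  have h1 : ∀ p q, ipv (frame p) (frame q) = if p = q then 16 else 0 := by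
    intro p q
    rw [ipv_frame]
    split
    · next h => rw [h, frame_apply_self]; rfl
    · next h => rw [frame, Pi.single_eq_of_ne (Ne.symm h), mul_zero]
  obtain ⟨g, hg⟩ := exists_isometry (fun p => act m (frame p)) fun p q => by
    rw [ipv_act hm.inj, h1]
  have h2 : ∀ M, g (vec M) = vec (act m M) := fun M => hg M _ fun r => by
    rw [Finset.sum_eq_single (m.src r)]
    · rw [act, act, frame_apply_self]
      ring
    · intro p _ hp
      rw [act, frame, Pi.single_eq_of_ne hp.symm, mul_zero, mul_zero]
    · simp
  refine ⟨g, mem_autLattice (fun p => ?_) (fun k => ?_), h2⟩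
  · rw [h2]; exact hm.mem _ (frame_mem p)
  · rw [h2]; exact hm.mem _ (gen_mem k)

/-- The cyclic permutation of the rows. -/
def rowShift : Mono :=
  [(24, 0), (25, 0), (26, 0), (27, 0), (0, 0), (1, 0), (2, 0), (3, 0), (4, 0), (5, 0), (6, 0),
   (7, 0), (8, 0), (9, 0), (10, 0), (11, 0), (12, 0), (13, 0), (14, 0), (15, 0), (16, 0), (17,
   0), (18, 0), (19, 0), (20, 0), (21, 0), (22, 0), (23, 0)]
/-- The square of the cyclic permutation of the rows. -/
def rowShift2 : Mono :=
  [(20, 0), (21, 0), (22, 0), (23, 0), (24, 0), (25, 0), (26, 0), (27, 0), (0, 0), (1, 0), (2,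
   0), (3, 0), (4, 0), (5, 0), (6, 0), (7, 0), (8, 0), (9, 0), (10, 0), (11, 0), (12, 0), (13,
   0), (14, 0), (15, 0), (16, 0), (17, 0), (18, 0), (19, 0)]
/-- The fourth power of the cyclic permutation of the rows. -/
def rowShift4 : Mono :=
  [(12, 0), (13, 0), (14, 0), (15, 0), (16, 0), (17, 0), (18, 0), (19, 0), (20, 0), (21, 0),
   (22, 0), (23, 0), (24, 0), (25, 0), (26, 0), (27, 0), (0, 0), (1, 0), (2, 0), (3, 0), (4, 0),
   (5, 0), (6, 0), (7, 0), (8, 0), (9, 0), (10, 0), (11, 0)]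
/-- The multiplication of the indices of the rows by `2`, with a cyclic permutation of the columns
`1`, `2`, `3`. -/
def rowDouble : Mono :=
  [(0, 0), (3, 0), (1, 0), (2, 0), (16, 0), (19, 0), (17, 0), (18, 0), (4, 0), (7, 0), (5, 0),
   (6, 0), (20, 0), (23, 0), (21, 0), (22, 0), (8, 0), (11, 0), (9, 0), (10, 0), (24, 0), (27,
   0), (25, 0), (26, 0), (12, 0), (15, 0), (13, 0), (14, 0)]
/-- A transformation that preserves each row. -/
def rowTwist0 : Mono :=
  [(0, 0), (1, 0), (2, 2), (3, 2), (4, 2), (5, 2), (6, 0), (7, 0), (8, 3), (9, 3), (10, 3), (11,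
   3), (12, 2), (13, 0), (14, 2), (15, 0), (17, 1), (16, 1), (19, 3), (18, 3), (21, 2), (20, 0),
   (23, 2), (22, 0), (26, 1), (27, 1), (24, 1), (25, 1)]
/-- The conjugate of `rowTwist0` by a power of the cyclic permutation of the rows. -/
def rowTwist1 : Mono :=
  [(2, 1), (3, 1), (0, 1), (1, 1), (4, 0), (5, 0), (6, 2), (7, 2), (8, 2), (9, 2), (10, 0), (11,
   0), (12, 3), (13, 3), (14, 3), (15, 3), (16, 2), (17, 0), (18, 2), (19, 0), (21, 1), (20, 1),
   (23, 3), (22, 3), (25, 2), (24, 0), (27, 2), (26, 0)]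
/-- The conjugate of `rowTwist0` by a power of the cyclic permutation of the rows. -/
def rowTwist2 : Mono :=
  [(1, 2), (0, 0), (3, 2), (2, 0), (6, 1), (7, 1), (4, 1), (5, 1), (8, 0), (9, 0), (10, 2), (11,
   2), (12, 2), (13, 2), (14, 0), (15, 0), (16, 3), (17, 3), (18, 3), (19, 3), (20, 2), (21, 0),
   (22, 2), (23, 0), (25, 1), (24, 1), (27, 3), (26, 3)]
/-- The conjugate of `rowTwist0` by a power of the cyclic permutation of the rows. -/
def rowTwist3 : Mono :=
  [(1, 1), (0, 1), (3, 3), (2, 3), (5, 2), (4, 0), (7, 2), (6, 0), (10, 1), (11, 1), (8, 1), (9,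
   1), (12, 0), (13, 0), (14, 2), (15, 2), (16, 2), (17, 2), (18, 0), (19, 0), (20, 3), (21, 3),
   (22, 3), (23, 3), (24, 2), (25, 0), (26, 2), (27, 0)]
/-- The conjugate of `rowTwist0` by a power of the cyclic permutation of the rows. -/
def rowTwist4 : Mono :=
  [(0, 2), (1, 0), (2, 2), (3, 0), (5, 1), (4, 1), (7, 3), (6, 3), (9, 2), (8, 0), (11, 2), (10,
   0), (14, 1), (15, 1), (12, 1), (13, 1), (16, 0), (17, 0), (18, 2), (19, 2), (20, 2), (21, 2),
   (22, 0), (23, 0), (24, 3), (25, 3), (26, 3), (27, 3)]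
/-- The conjugate of `rowTwist0` by a power of the cyclic permutation of the rows. -/
def rowTwist5 : Mono :=
  [(0, 3), (1, 3), (2, 3), (3, 3), (4, 2), (5, 0), (6, 2), (7, 0), (9, 1), (8, 1), (11, 3), (10,
   3), (13, 2), (12, 0), (15, 2), (14, 0), (18, 1), (19, 1), (16, 1), (17, 1), (20, 0), (21, 0),
   (22, 2), (23, 2), (24, 2), (25, 2), (26, 0), (27, 0)]
/-- The conjugate of `rowTwist0` by a power of the cyclic permutation of the rows. -/
def rowTwist6 : Mono :=
  [(0, 2), (1, 2), (2, 0), (3, 0), (4, 3), (5, 3), (6, 3), (7, 3), (8, 2), (9, 0), (10, 2), (11,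
   0), (13, 1), (12, 1), (15, 3), (14, 3), (17, 2), (16, 0), (19, 2), (18, 0), (22, 1), (23, 1),
   (20, 1), (21, 1), (24, 0), (25, 0), (26, 2), (27, 2)]
/-- A change of signs of some rows. -/
def rowSign0 : Mono :=
  [(0, 2), (1, 2), (2, 2), (3, 2), (4, 0), (5, 0), (6, 0), (7, 0), (8, 0), (9, 0), (10, 0), (11,
   0), (12, 0), (13, 0), (14, 0), (15, 0), (16, 2), (17, 2), (18, 2), (19, 2), (20, 2), (21, 2),
   (22, 2), (23, 2), (24, 0), (25, 0), (26, 0), (27, 0)]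
/-- A change of signs of some rows. -/
def rowSign1 : Mono :=
  [(0, 0), (1, 0), (2, 0), (3, 0), (4, 2), (5, 2), (6, 2), (7, 2), (8, 0), (9, 0), (10, 0), (11,
   0), (12, 0), (13, 0), (14, 0), (15, 0), (16, 0), (17, 0), (18, 0), (19, 0), (20, 2), (21, 2),
   (22, 2), (23, 2), (24, 2), (25, 2), (26, 2), (27, 2)]
/-- A change of signs of some rows. -/
def rowSign2 : Mono :=
  [(0, 0), (1, 0), (2, 0), (3, 0), (4, 0), (5, 0), (6, 0), (7, 0), (8, 2), (9, 2), (10, 2), (11,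
   2), (12, 0), (13, 0), (14, 0), (15, 0), (16, 2), (17, 2), (18, 2), (19, 2), (20, 2), (21, 2),
   (22, 2), (23, 2), (24, 2), (25, 2), (26, 2), (27, 2)]
/-- A change of signs of some rows. -/
def rowSign3 : Mono :=
  [(0, 0), (1, 0), (2, 0), (3, 0), (4, 0), (5, 0), (6, 0), (7, 0), (8, 0), (9, 0), (10, 0), (11,
   0), (12, 2), (13, 2), (14, 2), (15, 2), (16, 2), (17, 2), (18, 2), (19, 2), (20, 0), (21, 0),
   (22, 0), (23, 0), (24, 2), (25, 2), (26, 2), (27, 2)]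

lemma rowShift_isSym : rowShift.IsSym := .of_check (by decide +kernel)

lemma rowDouble_isSym : rowDouble.IsSym := .of_check (by decide +kernel)

lemma rowTwist0_isSym : rowTwist0.IsSym := .of_check (by decide +kernel)

lemma rowSign0_isSym : rowSign0.IsSym := .of_check (by decide +kernel)

lemma rowSign1_isSym : rowSign1.IsSym := .of_check (by decide +kernel)

lemma rowSign2_isSym : rowSign2.IsSym := .of_check (by decide +kernel)

lemma rowSign3_isSym : rowSign3.IsSym := .of_check (by decide +kernel)

lemma Mono.IsSym.comp {m n : Mono} (hm : m.IsSym) (hn : n.IsSym) : (m.comp n).IsSym := by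
  have hl : (m.comp n).length = 28 := by rw [Mono.comp, List.length_map, hm.index.1]
  have hx : ∀ p : Fin 28, (m.comp n).getD p (0, 0) =
      ((n.getD (m.src p) (0, 0)).1, (m.pow p + (n.getD (m.src p) (0, 0)).2) % 4) := by
    intro p
    rw [← List.getElem_eq_getD (h := by rw [hl]; exact p.2), Mono.pow, src_val hm.index,
      getD_eq hm.index]
    simp only [Mono.comp, List.getElem_map]
  have hs : (m.comp n).src = n.src ∘ m.src := by
    funext p
    rw [Mono.src, hx]
    rfl
  refine ⟨⟨hl, fun x hx' => ?_⟩, ?_, fun M hM => ?_⟩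
  · obtain ⟨k, hk, rfl⟩ := List.getElem_of_mem hx'
    have h1 := hx ⟨k, by rwa [← hl]⟩
    rw [← List.getElem_eq_getD (h := hk)] at h1
    rw [h1, ← src_val hn.index]
    exact Fin.is_lt _
  · rw [hs]
    exact hn.inj.comp hm.inj
  · rw [act_comp hm.index]
    exact hm.mem _ (hn.mem _ hM)

lemma rowShift2_isSym : rowShift2.IsSym := by
  have h : rowShift2 = rowShift.comp rowShift := by decide +kernel
  exact h ▸ rowShift_isSym.comp rowShift_isSym

lemma rowShift4_isSym : rowShift4.IsSym := by
  have h : rowShift4 = rowShift2.comp rowShift2 := by decide +kernel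
  exact h ▸ rowShift2_isSym.comp rowShift2_isSym

lemma rowTwist1_eq :
    rowTwist1 = (rowShift.comp rowTwist0).comp (rowShift4.comp rowShift2) := by
  decide +kernel

lemma rowTwist1_isSym : rowTwist1.IsSym :=
  rowTwist1_eq ▸ (rowShift_isSym.comp rowTwist0_isSym).comp (rowShift4_isSym.comp rowShift2_isSym)

lemma rowTwist2_eq :
    rowTwist2 = (rowShift.comp rowTwist1).comp (rowShift4.comp rowShift2) := by
  decide +kernel

lemma rowTwist2_isSym : rowTwist2.IsSym :=
  rowTwist2_eq ▸ (rowShift_isSym.comp rowTwist1_isSym).comp (rowShift4_isSym.comp rowShift2_isSym)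

lemma rowTwist3_eq :
    rowTwist3 = (rowShift.comp rowTwist2).comp (rowShift4.comp rowShift2) := by
  decide +kernel

lemma rowTwist3_isSym : rowTwist3.IsSym :=
  rowTwist3_eq ▸ (rowShift_isSym.comp rowTwist2_isSym).comp (rowShift4_isSym.comp rowShift2_isSym)

lemma rowTwist4_eq :
    rowTwist4 = (rowShift.comp rowTwist3).comp (rowShift4.comp rowShift2) := by
  decide +kernel

lemma rowTwist4_isSym : rowTwist4.IsSym :=
  rowTwist4_eq ▸ (rowShift_isSym.comp rowTwist3_isSym).comp (rowShift4_isSym.comp rowShift2_isSym)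

lemma rowTwist5_eq :
    rowTwist5 = (rowShift.comp rowTwist4).comp (rowShift4.comp rowShift2) := by
  decide +kernel

lemma rowTwist5_isSym : rowTwist5.IsSym :=
  rowTwist5_eq ▸ (rowShift_isSym.comp rowTwist4_isSym).comp (rowShift4_isSym.comp rowShift2_isSym)

lemma rowTwist6_eq :
    rowTwist6 = (rowShift.comp rowTwist5).comp (rowShift4.comp rowShift2) := by
  decide +kernel

lemma rowTwist6_isSym : rowTwist6.IsSym :=
  rowTwist6_eq ▸ (rowShift_isSym.comp rowTwist5_isSym).comp (rowShift4_isSym.comp rowShift2_isSym)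

section
/-! ## Normalisation by monomial transformations -/

/-- `N` is obtained from `M` by some of the given transformations, applied one after the other. -/
def Moves : List Mono → GVec → GVec → Prop
  | [], M, N => M = N
  | g :: gs, M, N => Moves gs M N ∨ Moves gs (act g M) N

/-- A property that is inherited by images under the given transformations. -/
lemma Moves.preserves {P : GVec → Prop} {gs : List Mono} (hP : ∀ g ∈ gs, ∀ M, P M → P (act g M))
    {M N : GVec} (h : Moves gs M N) (hM : P M) : P N := by
  induction gs generalizing M with
  | nil => exact h ▸ hM
  | cons g gs ih =>
    have hP' : ∀ g ∈ gs, ∀ M, P M → P (act g M) := fun g hg => hP g (List.mem_cons_of_mem _ hg)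
    rcases h with h | h
    · exact ih hP' h hM
    · exact ih hP' h (hP g (List.mem_cons_self ..) M hM)

lemma Moves.smul {gs : List Mono} {M N : GVec} (c : GaussianInt) (h : Moves gs M N) :
    Moves gs (c • M) (c • N) := by
  induction gs generalizing M with
  | nil => exact congrArg (c • ·) h
  | cons g gs ih =>
    rcases h with h | h
    · exact Or.inl (ih h)
    · exact Or.inr (act_smul g c M ▸ ih h)

/-- Evaluates the members of a list before it is substituted into `k`. -/
def forceL {α : Type} (l : List ℕ) (k : List ℕ → α) : α :=
  List.rec (motive := fun _ => (List ℕ → α) → α) (fun k => k [])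
    (fun a _ ih k => force a fun a' => ih fun l' => k (a' :: l')) l k

lemma forceL_eq {α : Type} (l : List ℕ) (k : List ℕ → α) : forceL l k = k l := by
  induction l generalizing k with
  | nil => rfl
  | cons a l ih =>
    have h : forceL (a :: l) k = force a fun a' => forceL l fun l' => k (a' :: l') := rfl
    rw [h, force_eq, ih]

/-- Moves the hexadecimal digits of a number back along a monomial transformation. -/
def pushCode (m : Mono) (n : ℕ) : ℕ :=
  List.rec (motive := fun _ => ℕ → ℕ) (fun _ => 0)
    (fun x _ ih n => Nat.add (Nat.shiftLeft (Nat.land n 15) (Nat.mul 4 x.1))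
      (force (Nat.shiftRight n 4) ih)) m n

/-- The codes that can be normalised to `rep` by some of the given transformations. -/
def words (gs : List Mono) (rep : ℕ) : List ℕ :=
  List.rec [rep] (fun g _ ih => forceL ih fun ws => ws ++ ws.map (pushCode g)) gs

lemma words_cons (g : Mono) (gs : List Mono) (rep : ℕ) :
    words (g :: gs) rep = words gs rep ++ (words gs rep).map (pushCode g) :=
  forceL_eq _ _

lemma pushCode_cons (x : ℕ × ℕ) (m : Mono) (n : ℕ) :
    pushCode (x :: m) n = (n &&& 15) <<< (4 * x.1) + pushCode m (n >>> 4) := by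
  have h : pushCode (x :: m) n =
    Nat.add (Nat.shiftLeft (Nat.land n 15) (Nat.mul 4 x.1)) (force (Nat.shiftRight n 4) (pushCode m)) := rfl
  rw [h, force_eq]
  rfl

lemma pushCode_eq_sum (m : Mono) (n : ℕ) : pushCode m n =
    ∑ j : Fin m.length, (n >>> (4 * (j : ℕ)) &&& 15) <<< (4 * (m[(j : ℕ)]).1) := by
  induction m generalizing n with
  | nil => rfl
  | cons x m ih =>
    rw [pushCode_cons, ih]
    refine Eq.trans ?_ (Fin.sum_univ_succ (n := m.length) _).symm
    congr 1
    refine Finset.sum_congr rfl fun j _ => ?_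
    simp only [Fin.val_succ, List.getElem_cons_succ]
    rw [← Nat.shiftRight_add, show 4 + 4 * (j : ℕ) = 4 * (j + 1) by ring]

lemma pack_lt {n : ℕ} {w : Fin n → ℕ} (hw : ∀ p, w p < 16) : pack w < 16 ^ n := by
  induction n with
  | zero => simp [pack]
  | succ n ih =>
    rw [pack_succ, pow_succ]
    have h0 := hw 0
    have h1 := ih (w := fun p => w p.succ) fun p => hw _
    omega

lemma pack_digits {n m : ℕ} (hm : m < 16 ^ n) :
    pack (fun p : Fin n => m >>> (4 * (p : ℕ)) &&& 15) = m := by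
  induction n generalizing m with
  | zero =>
    rw [pow_zero] at hm
    simp only [pack, Finset.univ_eq_empty, Finset.sum_empty]
    omega
  | succ n ih =>
    rw [pack_succ]
    have h1 : (fun p : Fin n => m >>> (4 * (p.succ : ℕ)) &&& 15) =
        fun p : Fin n => (m >>> 4) >>> (4 * (p : ℕ)) &&& 15 := by
      funext p
      rw [← Nat.shiftRight_add, Fin.val_succ, show 4 + 4 * (p : ℕ) = 4 * (p + 1) by ring]
    have h2 : m >>> 4 = m / 16 := Nat.shiftRight_eq_div_pow m 4
    rw [h1, ih (by rw [pow_succ] at hm; omega), and_fifteen, h2]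
    simp only [Fin.val_zero, mul_zero, Nat.shiftRight_zero]
    omega

lemma pushCode_eq_pack {m : Mono} (hi : m.IsIndex) (hm : Function.Injective m.src) (n : ℕ) :
    ∃ w : Fin 28 → ℕ, (∀ p, w p < 16) ∧ (∀ p, w (m.src p) = n >>> (4 * (p : ℕ)) &&& 15) ∧
      pushCode m n = pack w := by
  let e := Equiv.ofBijective m.src (Finite.injective_iff_bijective.1 hm)
  have he : ∀ p, e p = m.src p := fun _ => rfl
  refine ⟨fun q => n >>> (4 * (e.symm q : ℕ)) &&& 15, fun p => ?_, fun p => ?_, ?_⟩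
  · show n >>> (4 * (e.symm p : ℕ)) &&& 15 < 16
    rw [and_fifteen]
    omega
  · show n >>> (4 * (e.symm (m.src p) : ℕ)) &&& 15 = _
    rw [← he, Equiv.symm_apply_apply]
  · rw [pushCode_eq_sum, pack, ← e.sum_comp]
    refine Fintype.sum_equiv (finCongr hi.1) _ _ fun j => ?_
    rw [Equiv.symm_apply_apply, he, src_val hi, getD_eq hi]
    rfl

/-! ## Kinds of entries -/

/-- A rule that assigns a cost and a pair of digits to the residues modulo `4` of an entry. -/
abbrev Kind : Type := ℕ → ℕ → Val

/-- The value assigned to a Gaussian integer. -/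
def Kind.val (k : Kind) (z : GaussianInt) : Val := k (z.re % 4).toNat (z.im % 4).toNat

/-- The hexadecimal digit assigned to a Gaussian integer. -/
def Kind.digit (k : Kind) (z : GaussianInt) : ℕ := (k.val z).2.1 + 4 * (k.val z).2.2

/-- The code assigned to a vector. -/
def Kind.code (k : Kind) (M : GVec) : ℕ := pack fun p => k.digit (M p)

/-- The total cost of the entries of a vector. -/
def Kind.cost (k : Kind) (M : GVec) : ℕ := ∑ p, (k.val (M p)).1

/-- The digits are at most `3`. -/
def Kind.Bounded (k : Kind) : Prop := ∀ x < 4, ∀ y < 4, (k x y).2.1 ≤ 3 ∧ (k x y).2.2 ≤ 3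

instance (k : Kind) : Decidable k.Bounded := by unfold Kind.Bounded; infer_instance

lemma toNat_emod_lt (a : ℤ) : (a % 4).toNat < 4 := by omega

lemma Kind.Bounded.val {k : Kind} (h : k.Bounded) (z : GaussianInt) :
    (k.val z).2.1 ≤ 3 ∧ (k.val z).2.2 ≤ 3 :=
  h _ (toNat_emod_lt _) _ (toNat_emod_lt _)

lemma Kind.Bounded.digit_lt {k : Kind} (h : k.Bounded) (z : GaussianInt) : k.digit z < 16 := by
  have := h.val z
  rw [Kind.digit]
  omega

lemma Kind.Bounded.digit_code {k : Kind} (h : k.Bounded) (M : GVec) (p : Fin 28) :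
    k.code M >>> (4 * (p : ℕ)) &&& 15 = k.digit (M p) :=
  nib_pack (fun p => h.digit_lt (M p)) p

/-- Entries of `M` and their associates have the same digits. -/
def Kind.Inv (k : Kind) (M : GVec) : Prop := ∀ p u, k.digit (i ^ u * M p) = k.digit (M p)

lemma Kind.Inv.act {k : Kind} {M : GVec} (h : k.Inv M) (m : Mono) : k.Inv (act m M) := by
  intro p u
  rw [ConwayWales.act, ← mul_assoc, ← pow_add, h, h]

lemma exists_moves {k : Kind} (hk : k.Bounded) {gs : List Mono} (hgs : ∀ g ∈ gs, Mono.IsSym g)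
    {rep : ℕ} (hrep : rep < 16 ^ 28) {M : GVec} (hM : k.Inv M) (h : k.code M ∈ words gs rep) :
    ∃ N, Moves gs M N ∧ k.code N = rep := by
  have hlt : ∀ (gs : List Mono), (∀ g ∈ gs, Mono.IsSym g) → ∀ w ∈ words gs rep, w < 16 ^ 28 := by
    intro gs
    induction gs with
    | nil =>
      intro _ w hw
      rw [List.mem_singleton.1 hw]
      exact hrep
    | cons g gs ih =>
      intro hgs w hw
      have ih' := ih fun g hg => hgs g (List.mem_cons_of_mem _ hg)
      have hg := hgs g (List.mem_cons_self ..)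
      rw [words_cons, List.mem_append, List.mem_map] at hw
      rcases hw with hw | ⟨w', hw', rfl⟩
      · exact ih' w hw
      · obtain ⟨v, hv, -, hv'⟩ := pushCode_eq_pack hg.index hg.inj w'
        rw [hv']
        exact pack_lt hv
  induction gs generalizing M with
  | nil => exact ⟨M, rfl, List.mem_singleton.1 h⟩
  | cons g gs ih =>
    have hgs' : ∀ g ∈ gs, Mono.IsSym g := fun g hg => hgs g (List.mem_cons_of_mem _ hg)
    have hg := hgs g (List.mem_cons_self ..)
    rw [words_cons, List.mem_append, List.mem_map] at h
    rcases h with h | ⟨w, hw, hw'⟩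
    · obtain ⟨N, h1, h2⟩ := ih hgs' hM h
      exact ⟨N, Or.inl h1, h2⟩
    · have h1 : k.code (act g M) = w := by
        rw [← pack_digits (hlt gs hgs' w hw), Kind.code]
        congr 1
        funext p
        obtain ⟨v, hv1, hv2, hv3⟩ := pushCode_eq_pack hg.index hg.inj w
        rw [act, hM, ← hk.digit_code, ← hw', hv3, nib_pack hv1, hv2]
      obtain ⟨N, h1, h2⟩ := ih hgs' (hM.act g) (h1 ▸ hw)
      exact ⟨N, Or.inr h1, h2⟩

/-! ## Phases of the search -/

/-- The least square of an integer with a given residue modulo `4`. -/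
def minSq (x : ℕ) : ℕ := if x = 3 then 1 else x ^ 2

/-- The residues themselves, with the least norm as cost. -/
def fullKind : Kind := fun x y => (minSq x + minSq y, x, y)

lemma minSq_le (a : ℤ) : (minSq (a % 4).toNat : ℤ) ≤ a * a := by
  have h : a % 4 = 0 ∨ a % 4 = 1 ∨ a % 4 = 2 ∨ a % 4 = 3 := by omega
  rcases h with h | h | h | h <;> rw [h]
  · exact mul_self_nonneg a
  · have : a ≤ -1 ∨ 1 ≤ a := by omega
    rw [show minSq (1 : ℤ).toNat = 1 from rfl]
    rcases this with h | h <;> push_cast <;> nlinarith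
  · have : a ≤ -2 ∨ 2 ≤ a := by omega
    rw [show minSq (2 : ℤ).toNat = 4 from rfl]
    rcases this with h | h <;> push_cast <;> nlinarith
  · have : a ≤ -1 ∨ 1 ≤ a := by omega
    rw [show minSq (3 : ℤ).toNat = 1 from rfl]
    rcases this with h | h <;> push_cast <;> nlinarith

lemma fullKind_le (z : GaussianInt) : ((fullKind.val z).1 : ℤ) ≤ z.norm := by
  have h1 := minSq_le z.re
  have h2 := minSq_le z.im
  rw [Zsqrtd.norm_def, Kind.val, fullKind]
  push_cast
  linarith

lemma dvd_of_norm_dvd {a b : ℕ} (hab : 0 < a * a + b * b) {u v : ℤ}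
    (h1 : ((a * a + b * b : ℕ) : ℤ) ∣ a * u + b * v)
    (h2 : ((a * a + b * b : ℕ) : ℤ) ∣ a * v - b * u) : (⟨a, b⟩ : GaussianInt) ∣ ⟨u, v⟩ := by
  obtain ⟨e, he⟩ := h1
  obtain ⟨f, hf⟩ := h2
  have hn : ((a * a + b * b : ℕ) : ℤ) ≠ 0 := by exact_mod_cast hab.ne'
  refine ⟨⟨e, f⟩, ?_⟩
  apply Zsqrtd.ext
  · rw [Zsqrtd.re_mul]
    apply mul_left_cancel₀ hn
    push_cast at *
    linear_combination (a : ℤ) * he - b * hf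
  · rw [Zsqrtd.im_mul]
    apply mul_left_cancel₀ hn
    push_cast at *
    linear_combination (a : ℤ) * hf + b * he

/-- The entries of kind `k` are refined to the kind `k'`, known modulo `a + i b`. -/
def Refines (a b : ℕ) (k k' : Kind) (sel : ℕ → List Val) : Prop :=
  (0 < a * a + b * b ∧ a * a + b * b ∣ 4 * a ∧ a * a + b * b ∣ 4 * b) ∧
  ∀ x < 4, ∀ y < 4, (k x y).1 ≤ (k' x y).1 ∧ (k' x y).1 ≤ (fullKind x y).1 ∧
    ((k' x y).1 - (k x y).1, (k' x y).2) ∈ sel ((k x y).2.1 + 4 * (k x y).2.2) ∧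
    ((a * a + b * b : ℕ) : ℤ) ∣ a * (x - (k' x y).2.1) + b * (y - (k' x y).2.2) ∧
    ((a * a + b * b : ℕ) : ℤ) ∣ a * (y - (k' x y).2.2) - b * (x - (k' x y).2.1)

instance (a b : ℕ) (k k' : Kind) (sel : ℕ → List Val) : Decidable (Refines a b k k' sel) := by
  unfold Refines
  refine @instDecidableAnd _ _ ?_ ?_
  · infer_instance
  · refine @Nat.decidableBallLT _ _ fun x _ => @Nat.decidableBallLT _ _ fun y _ => ?_
    infer_instance

variable {a b : ℕ} {k k' : Kind} {sel : ℕ → List Val}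

lemma Refines.le (h : Refines a b k k' sel) (z : GaussianInt) : (k.val z).1 ≤ (k'.val z).1 :=
  (h.2 _ (toNat_emod_lt _) _ (toNat_emod_lt _)).1

lemma Refines.le_norm (h : Refines a b k k' sel) (z : GaussianInt) :
    ((k'.val z).1 : ℤ) ≤ z.norm := by
  have h1 : (k'.val z).1 ≤ (fullKind.val z).1 :=
    (h.2 _ (toNat_emod_lt _) _ (toNat_emod_lt _)).2.1
  have h2 := fullKind_le z
  omega

lemma Refines.mem (h : Refines a b k k' sel) (z : GaussianInt) :
    ((k'.val z).1 - (k.val z).1, (k'.val z).2) ∈ sel (k.digit z) :=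
  (h.2 _ (toNat_emod_lt _) _ (toNat_emod_lt _)).2.2.1

lemma Refines.dvd (h : Refines a b k k' sel) (z : GaussianInt) :
    (⟨a, b⟩ : GaussianInt) ∣ z - ⟨((k'.val z).2.1 : ℕ), ((k'.val z).2.2 : ℕ)⟩ := by
  obtain ⟨⟨h0, h4, h5⟩, h⟩ := h
  have h1 := (h _ (toNat_emod_lt z.re) _ (toNat_emod_lt z.im)).2.2.2
  have h2 : (⟨a, b⟩ : GaussianInt) ∣ 4 := by
    have : (4 : GaussianInt) = ⟨4, 0⟩ := rfl
    rw [this]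
    refine dvd_of_norm_dvd h0 ?_ ?_
    · rw [mul_zero, add_zero, mul_comm (a : ℤ)]
      exact_mod_cast h4
    · rw [mul_zero, zero_sub, mul_comm (b : ℤ), dvd_neg]
      exact_mod_cast h5
  have h3 : z - ⟨((k'.val z).2.1 : ℕ), ((k'.val z).2.2 : ℕ)⟩ = 4 * ⟨z.re / 4, z.im / 4⟩ +
      ⟨(z.re % 4).toNat - ((k'.val z).2.1 : ℕ), (z.im % 4).toNat - ((k'.val z).2.2 : ℕ)⟩ := by
    apply Zsqrtd.ext
    · simp only [Zsqrtd.re_sub, Zsqrtd.re_add, Zsqrtd.re_mul, Zsqrtd.re_ofNat, Zsqrtd.im_ofNat]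
      omega
    · simp only [Zsqrtd.im_sub, Zsqrtd.im_add, Zsqrtd.im_mul, Zsqrtd.re_ofNat, Zsqrtd.im_ofNat]
      omega
  rw [h3]
  exact dvd_add (h2.mul_right _) (dvd_of_norm_dvd h0 h1.1 h1.2)

lemma Refines.cost_le (h : Refines a b k k' sel) {M : GVec} (hM : IsSacred M) :
    k'.cost M ≤ 16 := by
  have h1 : ((k'.cost M : ℕ) : ℤ) ≤ 16 := by
    rw [Kind.cost, Nat.cast_sum, ← hM.norm_sum]
    exact Finset.sum_le_sum fun p _ => h.le_norm _
  exact_mod_cast h1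

lemma Refines.sum_sub (h : Refines a b k k' sel) (M : GVec) :
    ∑ p, ((k'.val (M p)).1 - (k.val (M p)).1) + k.cost M = k'.cost M := by
  rw [Kind.cost, Kind.cost, ← Finset.sum_add_distrib]
  exact Finset.sum_congr rfl fun p _ => Nat.sub_add_cancel (h.le _)

/-- One phase of the search for sacred vectors, with a code `R₀` that restricts the values. -/
lemma phase_of_mem {rows : List Row} (T : IsTable a b rows) (h : Refines a b k k' sel)
    (hk' : k'.Bounded) {M : GVec} (hM : IsSacred M) {R₀ bud : ℕ}
    (hR : ∀ p : Fin 28, ((k'.val (M p)).1 - (k.val (M p)).1, (k'.val (M p)).2) ∈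
      sel (R₀ >>> (4 * (p : ℕ)) &&& 15)) (hb : bud + k.cost M = 16) {Q : ℕ → ℕ → Bool}
    (hs : search sel R₀ Q rows 896 0 bud 0 = true) :
    ∃ bud', bud' + k'.cost M = 16 ∧ Q (k'.code M) bud' = true := by
  have h1 := h.sum_sub M
  have h2 := h.cost_le hM
  refine ⟨bud - ∑ p, ((k'.val (M p)).1 - (k.val (M p)).1), by omega, T.search hM.1 (fun p => ((k'.val (M p)).1 - (k.val (M p)).1, (k'.val (M p)).2))
    (fun p => ⟨hR p, hk'.val _⟩) (fun p => h.dvd _) ?_ hs⟩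
  show ∑ p, ((k'.val (M p)).1 - (k.val (M p)).1) ≤ bud
  omega

lemma phase {rows : List Row} (T : IsTable a b rows) (h : Refines a b k k' sel)
    (hk : k.Bounded) (hk' : k'.Bounded) {M : GVec} (hM : IsSacred M) {bud : ℕ}
    (hb : bud + k.cost M = 16) {Q : ℕ → ℕ → Bool}
    (hs : search sel (k.code M) Q rows 896 0 bud 0 = true) :
    ∃ bud', bud' + k'.cost M = 16 ∧ Q (k'.code M) bud' = true :=
  phase_of_mem T h hk' hM (fun p => by rw [hk.digit_code]; exact h.mem _) hb hs

end

/-! ## Tables for the search -/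

/-- The table of the search for the parities. -/
def parityRows : List Row :=
  [(8, 0x2000200000000000000000000000000020002000000000002000200000000000200020002000200020002000200020000000000020002000200020002000200000000000200020002000200020002000000000002000200020002000000000000000000d700c5,
     0x2000200000000000000000000000000020002000000000002000200000000000200020002000200020002000200020000000000020002000200020002000200000000000200020002000200020002000000000002000200020002000000000000000000840014),
   (24, 0x2000200000000000200020002000200020002000000000000000000000000000200020000000000020002000200020002000200020002000200020002000200020002000200020000000000020002000200020000000000020002000200020000000000cf00f8,
     0x2000200000000000200020002000200020002000000000000000000000000000200020000000000020002000200020002000200020002000200020002000200020002000200020000000000020002000200020000000000020002000200020000000000f4009b),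
   (0, 0x20002000000000000000000000000000200020000000000000000000000000002000200020002000200020000000000000000000200020002000200020002000000000000000000020002000200020000000000000000000000000002000200000000006f00b7,
     0x2000200000000000000000000000000020002000000000000000000000000000200020002000200020002000000000000000000020002000200020002000200000000000000000002000200020002000000000000000000000000000200020000000000900047),
   (20, 0x2000200000000000200020002000200020002000000000000000000020002000200020000000000020002000000000002000200000000000200020002000200020002000200020002000200020002000200020002000200000000000000000000000000300047,
     0x20002000000000002000200020002000200020000000000000000000200020002000200000000000200020000000000020002000000000002000200020002000200020002000200020002000200020002000200020002000000000000000000000000004b0080),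
   (16, 0x20002000200020002000200000000000000000000000000020002000200020000000000020002000200020000000000020002000200020002000200020002000000000000000000000000000000000000000000000000000000000032009e,
     0x200020002000200020002000000000000000000000000000200020002000200000000000200020002000200000000000200020002000200020002000200020000000000000000000000000000000000000000000000000000000000a90025),
   (28, 0x2000200020002000200020000000000000000000200020002000200020002000000000000000000020002000200020002000200020002000200020002000200000000000000000000000000020002000200020002000200000000003300f1,
     0x200020002000200020002000000000000000000020002000200020002000200000000000000000002000200020002000200020002000200020002000200020000000000000000000000000002000200020002000200020000000000de00b5),
   (12, 0x200020000000000000000000000000002000200000000000200020000000000000000000200020000000000020002000000000002000200000000000000000002000200000000000200020002000200000000006800a1,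
     0x20002000000000000000000000000000200020000000000020002000000000000000000020002000000000002000200000000000200020000000000000000000200020000000000020002000200020000000000e200f4),
   (4, 0x200020000000000020002000000000002000200000000000200020002000200000000000200020000000000020002000000000000000000020002000000000002000200020002000000000000000000000000001f0085,
     0x200020000000000020002000000000002000200000000000200020002000200000000000200020000000000020002000000000000000000020002000000000002000200020002000000000000000000000000002f0007),
   (40, 0x20002000000000002000200000000000200020000000000020002000200020002000200020002000000000000000000020002000000000002000200000000000200020000000000020002000000cc,
     0x2000200000000000200020000000000020002000000000002000200020002000200020002000200000000000000000002000200000000000200020000000000020002000000000002000200aa00fc),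
   (44, 0x2000200020002000200020000000000020002000000000002000200000000000200020000000000000000000000000002000200020002000000000000000000000000000000000002000200a6007c,
     0x2000200020002000200020000000000020002000000000002000200000000000200020000000000000000000000000002000200020002000000000000000000000000000000000002000200610020),
   (32, 0x200020002000200000000000200020000000000020002000000000000000000000000000000000000000000020002000200020002000200000000000200020002000200020002007a0071,
     0x20002000200020000000000020002000000000002000200000000000000000000000000000000000000000002000200020002000200020000000000020002000200020002000200e50048),
   (36, 0x20002000000000002000200000000000200020002000200000000000200020000000000000000000000000000000000000000000000000000000000020002000200020029002e,
     0x200020000000000020002000000000002000200020002000000000002000200000000000000000000000000000000000000000000000000000000000200020002000200fa00a3),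
   (52, 0x200020000000000020002000200020002000200000000000000000000000000020002000200020002000200020002000000000002000200000000009a0037,
     0x200020000000000020002000200020002000200000000000000000000000000020002000200020002000200020002000000000002000200000000003f0095),
   (48, 0x200020002000200020002000200020002000200000000000000000000000000000000000000000002000200000000000200020000000000000000006800aa,
     0x20002000200020002000200020002000200020000000000000000000000000000000000000000000200020000000000020002000000000000000000e30093),
   (60, 0x200020002000200000000000200020000000000000000000000000002000200000000000200020000000000020002000200020000000000c5002e,
     0x2000200020002000000000002000200000000000000000000000000020002000000000002000200000000000200020002000200000000007b00a2),
   (56, 0x20002000000000002000200000000000000000000000000020002000200020002000200020002000000000000000000000000005e0094,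
     0x20002000000000002000200000000000000000000000000020002000200020002000200020002000000000000000000000000005f0060),
   (76, 0x200020002000200020002000200020002000200020002000000000002000200000000000200020002000200850010,
     0x2000200020002000200020002000200020002000200020000000000020002000000000002000200020002002300f3),
   (68, 0x20002000000000002000200020002000200020000000000020002000000000000000000000000000200020042002d,
     0x20002000000000002000200020002000200020000000000020002000000000000000000000000000200020013004c),
   (72, 0x2000200020002000000000000000000020002000200020002000200020002000000000002000200c80029,
     0x200020002000200000000000000000002000200020002000200020002000200000000000200020078008d),
   (64, 0x20002000000000002000200000000000000000000000000020002000200020002000200d6006e,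
     0x20002000000000002000200000000000000000000000000020002000200020002000200e6008c),
   (108, 0x2000200000000000200020002000200020002000000000002000200b600fc,
     0x2000200000000000200020002000200020002000000000002000200a6002a),
   (92, 0x2000200020002000200020002000200000000000000000002000200f9003b,
     0x20002000200020002000200020002000000000000000000020002006100ab),
   (88, 0x2000200020002000200020000000000020002000200020008007c,
     0x200020002000200020002000000000002000200020002003b008a),
   (104, 0x200020000000000000000000000000002000200be0070,
     0x200020000000000000000000000000002000200aa0057),
   (100, 0x20002000000000000000000020002001f00da,
     0x20002000000000000000000020002004a0033),
   (96, 0x20002000000000002000200170070,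
     0x200020000000000020002000d0025),
   (80, 0x20002000200020060003f,
     0x200020002000200c8003d),
   (84, 0x2000200bd002e,
     0x200020012003b)]

/-- The table of the search for the residues modulo `2`. -/
def halfRows : List Row :=
  [(4, 0x200000000000000020002000200020002000000000000000000020000000000000002000200000002000200020000000000020002000000020000000000020000000200020000000000020000000000000002000000020000000000200044,
     0x200000000000200020002000200000002000000000002000000000000000200000000000200020002000000020002000000000002000000020002000000020000000000020002000000000000000200000002000000000000003c0082),
   (28, 0x20000000000000002000200000002000000000000000200020000000000000002000200020000000000020002000200020002000000000000000000020000000000000002000200020002000000020002000000020000000000e600fd,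
     0x200000000000000020000000000020000000200000000000200020000000000020000000200020000000000020002000200020000000200000000000200000000000000020000000200020000000200020002000200000000000000c200f1),
   (56, 0x20002000000000000000200000000000000000002000000020000000000000002000200020000000000020002000000020002000200020002000200000002000000000002000200000002000200020000000000000002000000000030006b,
     0x2000200000000000200000000000000000000000000020000000200000000000200020000000200020000000000020002000200020002000200020002000000000000000200020002000000020002000000000002000000000000000e00f9),
   (20, 0x200020000000000020002000000000000000200000000000200020000000000020000000200020000000200020002000200020002000200020000000200020002000200020000000200020002000200020000000000000000000000dd00c7,
     0x200020000000000020002000000000002000000000000000200020000000000000002000200020002000000020002000200020002000200000002000200020002000200000002000200020002000200000002000000000000000000e40001),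
   (12, 0x20000000000020002000000000000000200000002000200000000000000000002000000020000000200020000000200000000000200020000000200020002000000000000000200000002000000020000000000000000000000750088,
     0x200000000000000020002000000000002000000020000000000020000000000020000000200000002000000000002000000020002000000000002000200020000000200000000000000020000000200000002000000000000000000a20034),
   (16, 0x2000000000000000000020002000000020000000000020000000000000000000200000000000000020000000000000000000000000000000000000000000000000000000000000000000000000000000000000000000000000000000b000f,
     0x2000000000002000000000002000000020002000000000000000000000000000200000000000000020000000000000000000000000000000000000000000000000000000000000000000000000000000000000000000000000004000d),
   (0, 0x200020002000000020000000200000002000000000000000200000000000200000000000000020000000200020000000200000002000200020000000200000002000000000002000000000002000000000000006e00c3,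
     0x200020000000200000002000000020000000200000000000000020002000000000000000200000002000000000002000000020002000200000002000000020000000200020000000000000000000200000000000e00d8),
   (60, 0x2000200020000000000020002000200000000000000000000000200020002000000020000000200020000000000000002000000000002000200020002000000020000000200000000000000000000000000e00071,
     0x200000002000200000000000200020000000200000000000000000002000200000002000000020002000200000000000200000000000000020002000200020002000000020000000000000000000000000000007700fd),
   (8, 0x2000000000002000200020000000200000000000200000002000000000002000000020002000000020000000200000000000200000002000200020000000200000000000000000000000000000000007600b0,
     0x20002000000020002000200000000000000000002000000020002000000020000000000020000000200000002000200000002000000020002000200000000000000000000000000000000000000eb0070),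
   (24, 0x2000000020000000000000000000000020000000000020002000000000000000000000002000200000002000000020002000000000000000000020000000000020000000200000000000b0094,
     0x20000000200000000000000000000000200000000000000020002000000000000000000020000000000020000000200020002000000000000000000000002000200000002000000000000003300d5),
   (52, 0x2000000000002000000000002000200020000000000020002000000020002000200000002000200020002000200020002000000020000000000020002000200000002000000000097005f,
     0x2000200000000000000020002000000020002000000000002000200020000000200020002000200020002000200000002000000020002000000020002000200000000000000aa003d),
   (48, 0x200000000000000000002000200000002000200000002000200000002000200000002000000000000000200000002000000000000000000000000000000000000006100d8,
     0x20000000000000000000000020002000200000000000200020002000200000000000200000002000000000000000200000002000000000000000000000000000000000091009b),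
   (40, 0x200000000000000020002000200000000000200000002000200000000000000020002000000000000000000020000000000020000000200c900ff,
     0x20000000000020002000000020002000000020000000000020000000000020002000000000000000000000002000200000002000000f50011),
   (84, 0x200020002000000020002000200020000000000020000000200000000000200000000000200000000000000020000000200020000000200ce007c,
     0x2000200000002000200020002000200000000000000020000000200020000000000000000000200000000000000020002000200020000005800d4),
   (32, 0x20002000200000000000000020002000200020000000200020000000000000000000000000002000000020000000000020000000200bf00bb,
     0x200000002000200000000000200000002000200000002000200020000000000000000000000000000000200000002000200000002000000e0002c),
   (80, 0x2000000020002000200020000000000020000000000000002000000000002000200000002000000020000000000000002000000530037,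
     0x200020002000200020000000000000002000000000000000200020000000000020000000200000002000000000000000200bd00c9),
   (36, 0x200020000000200020000000200020002000200020002000000020002000200000002000200020002000200020000000f00fa,
     0x200020002000000000002000200020002000200020002000200000002000200020000000200020002000200000002001600f0),
   (44, 0x200000000000000020002000000020002000200000002000200020002000200020002000000000002000000c9009d,
     0x20000000000020002000200000002000200020000000200020002000200020002000000000000000200560057),
   (68, 0x2000200020000000000020002000200000000000000020000000000020002000000000002000000060074,
     0x2000200000002000200000002000200000000000200000000000000020002000000000000000200760066),
   (72, 0x2000200000002000200000002000000020000000000000000000000020000000200b000cf,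
     0x20000000000020002000200020000000200000000000000000000000200000002000000eb00b4),
   (92, 0x20002000000020000000000020000000000020002000200020002000000020089,
     0x2000000000002000000020002000000000000000200020002000200000002004200c4),
   (88, 0x200000000000000020002000000000000000200020000000200da0069,
     0x2000000000000000200000000000200000000000200020002000000f6001c),
   (64, 0x200000002000000000002000200000002000000020000006600ba,
     0x2000000020002000000000002000000020000000200f800d3),
   (76, 0x200000000000200020000000200020000000200d400b6,
     0x200020000000000020002000200020000000000b1),
   (96, 0x2000200000002000200000002000000ea00a9,
     0x200020002000000000002000000020075000e),
   (100, 0x20002000200020000005c005a,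
     0x2000000020002000000020082002e),
   (108, 0x200000002000000240010,
     0x2000000020008002a),
   (104, 0x20000000700e7,
     0x2007f008f)]

/-- The table of the search for the residues modulo `2 + 2i`. -/
def evenRows : List Row :=
  [(32, 0x2000200020000000200000000000000030001000000020002000000020000000100030001000100010001000300030001000300030001000100030003000300030003000200020001000300010003000000020000000000010001002e001c,
     0x200020000000200000002000000000001000100020000000000020000000200030003000100030001000300030001000300030001000100030003000300010003000100020002000300030003000300020000000000000001000300b8002b),
   (40, 0x2000200020000000000020000000000030001000200000000000000020000000100010003000300010003000100010003000100020002000000000000000200030001000000000001000100010003000000000001000100030003009d0056,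
     0x2000200000002000200000000000000010001000000020000000000000002000100030003000100030003000100030001000100020002000000000002000000010001000000000001000300030003000000000001000300030001006c0080),
   (60, 0x2000200020000000000000003000100020000000100030000000200010001000100030000000000020000000000000002000200000000000300010003000300000000000200020000000000020002000300030000000000510012,
     0x2000200000002000000000001000100000002000300030002000000010003000300030000000000000002000000000002000200000000000100010003000100000000000200020000000000020002000300010000000000c900dc),
   (52, 0x200020002000200020000000000000001000100020000000300030002000200030003000100010000000000000000000200000000000200000002000300010003000100030001000000000003000100030003000000000000000000e300be,
     0x200020002000200000002000000000001000300000002000300010002000200030001000100030000000000000000000000020002000000020000000100010001000100010001000000000001000100030001000000000000000000120089),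
   (44, 0x2000000020000000000000001000300020000000200020002000200030003000100030003000100010003000300010000000200000002000200020001000300010003000100010002000000020002000100030001000300ba000e,
     0x200000002000000000003000300000002000200020002000200030001000300030001000100030003000100010002000000020000000200020003000300030003000100030000000200020002000300030003000300a300ee),
   (56, 0x200020000000000020000000000000003000100000002000300030002000200010003000300030000000200020000000000020003000300030003000200020001000300010001000000000003000100030001000100010000000000d800c2,
     0x2000200000000000000020000000000010001000200000003000100020002000300030003000100020000000000020002000000030001000300010002000200030003000100030000000000010001000100010001000300000000005a0054),
   (36, 0x2000000000002000000000003000100000002000200000000000000030001000100030003000100030001000100010001000100010003000300010001000100010001000100030000000000000000000000000001000300760078,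
     0x2000200000000000000010001000200000000000200000000000100010003000300010001000100010001000300010003000300030001000100010003000100030003000300000000000000000000000000030003005a000c),
   (48, 0x200000000000000010001000000020001000300000002000300010001000300020002000200020000000200010001000300010002000000010001000200000000000000000000000000000000000000000000005800a6,
     0x2000000000001000300020000000300030002000000010001000300030002000200020002000200000001000300010001000000020001000300000002000000000000000000000000000000000000000000b80045),
   (28, 0x2000000000000000300010000000000020002000000020002000200030003000000000003000300020000000100030000000000000000000000020003000100030001000000000000000000e4005d,
     0x200000000000100010000000000020002000200000002000200030001000000000003000100000002000300030000000000000000000200000001000100010001000000000000000000ba00d4),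
   (24, 0x2000000020002000300030000000000020000000000000000000200010003000000000001000100000000000300010002000200000002000200000003000300020002000100030000000000b900b5,
     0x2000200020003000100000000000000020000000000020000000300030000000000010003000000000001000100020002000200000000000200030001000200020003000300000000005200e4),
   (20, 0x20002000100010000000000020000000000020002000200030001000200000002000200010001000200020000000200010003000000000002000000030001000300030000000000ec00cc,
     0x20002000100030000000000000002000200000002000200010001000000020002000200010003000200020002000000030003000000000000000200010001000300010000000000fa007f),
   (16, 0x100030000000000000000000000000002000200010001000200020002000000030001000000020002000000030003000000000000000000000000000000000000000000ff008e,
     0x300030000000000000000000000000002000200010003000200020000000200010001000200000000000200030001000000000000000000000000000000000000000000e800b5),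
   (88, 0x2000200020002000000000000000200000000000200020003000300030001000100030000000000000000000200000000000200010001000300010003000300b300ec,
     0x2000200020002000000000002000000000000000200020003000100010001000300030000000000000000000000020002000000010003000100010003000100f900e9),
   (76, 0x20002000200020000000200020000000200020003000300010003000000020002000000010001000200000002000200020000000100010003000300a60071,
     0x20002000200020002000000000002000200020003000100030003000200000000000200010003000000020002000200000002000100030003000100890055),
   (108, 0x2000200000002000200020002000000020000000200020002000000000002000100030000000000030003000000020000000000010003009e00f5,
     0x200020002000000020002000000020000000200020002000000020002000000030003000000000003000100020000000000000003000300d0009b),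
   (4, 0x20000000200020000000200030001000300010003000100020002000200020003000100030001000100010003000300000000006a009f,
     0x200020002000200000001000100010001000100010002000200020002000100010001000100010003000300010000000000bb00fa),
   (64, 0x2000200000003000300010003000000020002000000000002000000020001000300030001000000000003000100ae0026,
     0x20000000000020003000100030003000200000000000200020000000200000003000300010001000000000001000100610004),
   (80, 0x2000000010001000300030003000100000000000200000002000000020000000000020000000000030001001e0036,
     0x200010003000300010001000100000000000000020000000200000002000200000000000000010001008b0019),
   (8, 0x1000100030001000300030000000000010001000300030000000200010001000300030000000000360074,
     0x1000300010001000300010000000000010003000300010002000000010003000300010000000000880045),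
   (72, 0x20001000300020000000000000000000200030001000200020000000000010001006b007d,
     0x20000000300030000000200000000000200000001000100020002000000000001000300d8001e),
   (68, 0x3000100000002000300010000000200020002000100030003000100030001001d0010,
     0x100010002000000010001000200000002000200030003000100010001000100b800b9),
   (96, 0x20000000100010000000000030001000300010001000100010003007f0058,
     0x2000100030000000000010001000100010001000300030003002a000c),
   (12, 0x1000300030001000000000002000200010003000000000022003a,
     0x3000300010001000000000002000200030003000000000014000c),
   (0, 0x300030001000300020002000300030000000000bf000a,
     0x300010003000300020002000300010000000000410082),
   (92, 0x2000100030000000000010003005e0050,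
     0x2000000030003000000000003000300c50000),
   (104, 0x300010001000100010003007e0016,
     0x1000100010003000300030012004d),
   (84, 0x300010003000300b00002,
     0x100010003000100920039),
   (100, 0x1000300fa00ac,
     0x30003009d000f)]

/-- The table of the search for the even vectors. -/
def evenFullRows : List Row :=
  [(36, 0x20002000000000002000000020000000000020002000000010001000000020003000100010002000300010002000000030000000100020001000000020002000000010001000100000001000300000000000300420079,
     0x20002000000000000000200000002000200000000000200010003000200000001000100020003000100010000000200000001000200030000000300020002000100000001000300010000000000010003000000f200bd),
   (72, 0x20002000000000002000000020000000200000002000200000001000100030001000100000002000100030002000100010002000300030000000100020000000200010001000100000000000000000001000000060021,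
     0x200020000000000000002000000020000000200020002000100000003000300010003000200000003000300010002000200030003000100010000000000020001000200010003000000000000000000000003008400f0),
   (60, 0x20002000000000002000000000000000200000000000000030002000300010002000000000003000200030000000000030002000000010001000000000001000200010001000100030000000000000000000000620077,
     0x20002000000000000000200000000000000020000000000020001000100010000000200030000000300020000000000020001000100000000000300010000000100020001000300000001000000000000000000f300f0),
   (96, 0x200020002000200000000000200000000000000000000000000000002000000000000000200000002000200030003000000000000000200030002000000020000000000000003004d00cb,
     0x200020002000200000000000000020000000000000000000000000000000200000000000000020002000200030001000000000002000000020001000200000000000000030000004d0076),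
   (92, 0x200020002000200000000000000020000000200000000000000000000000000010001000200000001000100020001000100010001000000000003000700c7,
     0x20002000200020000000000020000000200000000000000000000000000000001000300000002000100030001000200010003000000030003000000510020),
   (56, 0x200020000000000020000000000020002000200000002000300000003000100000002000200010003000200010001000000030002000300010001000300000001000200010002000000000001000000000000009a0015,
     0x2000200000000000000020002000000020002000200000000000100010001000200000001000200020001000100030003000000030002000100030000000100020003000200030000000000000003000000000089000f),
   (64, 0x20002000000000002000000000000000000000000000200010000000300010001000300000002000000000002000100030000000300010000000200030003000100010002000100000003000000000000000100c600f2,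
     0x20002000000000000000200000000000000000002000000000003000100010003000300020000000000000001000200000001000100010002000000030001000100030001000200030000000000000001000000ca00da),
   (32, 0x200020000000000000002000000020002000000020000000300010002000200030003000000010002000200010003000300000000000300020001000100030001000300010003000300000000000000010000004400e3,
     0x200020000000000020000000200000000000200000002000100010002000200030001000100000002000200030003000000010003000000010002000300030003000300030003000000010000000000000003003100bb),
   (4, 0x2000200020002000200020000000200030003000200000002000200030001000300020002000300020001000000000002000200010002000200000002000100000000000300000000000000450012,
     0x20002000200020002000200020000000300010000000200020002000100010002000100030002000100020000000000020002000200030000000200010002000000000000000100000000006f00fd),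
   (76, 0x2000200000002000000020002000000030002000100010003000100030001000300010001000000030000000000000001000300000000000000030000000200010000000000010003000000df0084,
     0x2000200020000000200000000000200020001000100030001000100010001000100010000000300000001000000000003000300000000000300000002000000000003000100000000000100d7009a),
   (52, 0x20000000200020002000200000003000300030002000200000001000200010001000300020003000000010000000100000001000200020001000200000003000300000000000000b300c5,
     0x20002000200020002000300000003000100020002000100000001000200030003000300020001000000010000000100000002000200020003000300000000000100000000007600d0),
   (48, 0x200000002000200010003000300020002000200030001000200000000000100020000000100010001000300000000000000000000000000000000000000000000000e00ac,
     0x20000000200000001000200030001000200020003000200020003000000000002000300010000000100030000000100000000000000000000000000000000000000000053008f),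
   (8, 0x20000000100010000000200020002000000020003000000000001000300020001000300000002000100000003000000030000000000000000000000000000003500a7,
     0x20001000300020000000200020002000000000001000100000002000100030003000200000000000300000001000000010000000000000000000000000088006c),
   (68, 0x30003000300030003000100010000000000010002000300020000000000010002000100030001000100020001000300030000000300000001003f0091,
     0x30000000300010003000100010003000000000002000300020001000000000002000300030003000100030001000200030001000300000001000000f60020),
   (44, 0x200030003000200010002000000000000000000030000000100020002000300030000000000000000000000000000000300000003002d00f7,
     0x2000000030001000100020000000200000000000300000001000000020002000300010000000000000000000000000003000000030000002200b0),
   (40, 0x30001000300000001000300010001000200010003000000030003000000000000000100030001000100010000000000030000004d00d2,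
     0x100010000000100030003000100030001000200000001000300010000000000010000000100010001000300000000000000010096000a),
   (0, 0x10001000100000001000000030000000200000002000300010002000200030002000000000003000000030000000000d400da,
     0x1000300000003000000030000000100000002000300020002000300030002000000020003000000030000000000000016003c),
   (12, 0x100000003000000020003000300030003000200010002000100010001000100030000000000000000000000c10017,
     0x300000001000300020003000100020001000200030001000300010003000000010000000000000000008e00a9),
   (88, 0x200020000000000000002000300000002000000030000000300010000000000010003000000120078,
     0x200000000000200000000000300020002000000030000000300000000000300010000000000010003009e),
   (16, 0x20000000200020003000000000000000000000000000000000000000000000000000000370027,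
     0x2000200020000000100000000000000000000000000000000000000000000000000650010),
   (80, 0x2000000030002000000020002000100020000000000030000000300000001009500d0,
     0x200020001000200000001000200000002000300000003000000010000004f0086),
   (20, 0x100000000000100030000000300000000000000000000000000ad0015,
     0x1000000000000000300030003000000000000000000000000000000b800a0),
   (104, 0x2000200030002000300030001000000030000000300c10046,
     0x20000000300020003000200010001000300000003000000eb00c0),
   (100, 0x300000002000000000003000000000003003400c5,
     0x300000002000000000000000000010003000000dc008a),
   (28, 0x3000100000001000000000000009a0079,
     0x30000000000030000000300000000008400df),
   (24, 0x1000300000000000000ad009b,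
     0x10000000000010000000000d40005),
   (84, 0x100030000000a00a1,
     0x1000000000001004400c0),
   (108, 0x300aa001e,
     0x3000000b400ee)]

/-- The table of the search for the vectors with eight odd entries. -/
def eightRows : List Row :=
  [(52, 0x20002000000000000000000000002000000000000000000030001000200020000000200030003000000020002000200000002000000010001000000000001000100000001000000000003000300010001000100010000000300000003000000000000009b0078,
     0x2000200000000000000000002000000000000000000000001000100020002000200000003000100020000000200020002000000010000000000030001000000000003000000030003000000010001000100030000000300000001000000010000000000ca0034),
   (48, 0x20002000000000000000000000002000000000002000200030001000200020000000200030003000000020000000200020002000200010001000000000001000200030002000100000003000000000000000000000000000000010000000000000000004f00f5,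
     0x200020000000000000000000200000000000000020002000100010002000200020000000300010002000000020000000200020001000200000003000100000003000200010002000300000000000000000000000000000001000000000000000000000022002e),
   (60, 0x2000200000000000000000000000200020002000200020001000100020002000200020003000100020002000200000001000100000003000000030000000300010002000100020003000000000003000300030003000000030000000000000000000000cd000a,
     0x20002000000000000000000020000000200020002000200010003000200020002000200010001000200020000000200010003000300000003000000030000000200030002000300000001000300000003000100000001000000010000000000000000001e0094),
   (56, 0x2000200000000000000000000000200020002000000000001000100020002000000000001000300020002000200020001000100000001000200010002000300020003000000010001000000000003000300010003000300010000000100000000000000b80071,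
     0x200020000000000000000000200000002000200000000000100030002000200000000000300030002000200020002000100030001000000010002000300020003000200010000000000030003000000010001000300010000000300000003000000000058008d),
   (68, 0x2000200020002000000000000000200020002000100030003000300030001000200020002000300030003000300020003000100010003000000000003000200010002000100030002000000000003000100030000000100860036,
     0x20002000200020000000000020000000200020003000300030001000100010002000200030002000300010002000100010001000300030000000000020001000200030003000300000002000300000003000300010000000d006d),
   (40, 0x200020000000000030003000200020003000100020000000100010002000000000003000300020003000300000001000300010000000200020002000000030003000100010001000100010000000100030000008b0085,
     0x20002000000000003000100020002000100010000000200010003000000020003000000020001000300010001000000010001000200000002000200030000000100010001000300010003000100000000000100540063),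
   (76, 0x200020002000200000000000000020000000000010001000100030001000300020000000100000003000300020003000300030000000000030003000200030003000300030002000200030001000300000002000300000094009e,
     0x20002000200020000000000020000000000000001000300030003000300030000000200000003000300010003000200030001000000000003000100030002000300010002000100030002000300030002000000000001002c00be),
   (44, 0x20002000200020003000100000000000100010000000200010001000000020001000000020003000100030001000000020000000100030000000000020002000300020003000100000001000300030000000300c600ac,
     0x200020002000200010001000000000001000300020000000100030002000000000003000300020003000300000003000000020003000300000000000200020002000100010001000100000003000100030000005b007f),
   (36, 0x200020001000300020002000100030000000200030001000000000001000000010002000200000002000300030001000000000001000100000001000100000001000200000001000200000000000300f2007e,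
     0x2000200030003000200020003000300020000000100010000000000000003000200030000000200030002000100010000000000010003000100000000000300020003000100000000000200030000002d008f),
   (32, 0x1000100000000000300030000000200030001000000000000000300000001000000000001000000000002000300010003000100030003000300010003000000030001000000030001000000030099,
     0x10003000000000003000100020000000100010000000000030000000100000000000000000003000200000001000100010001000300010001000100000001000100010003000000000003009f0095),
   (64, 0x20002000100010003000100030001000200020002000300000000000200030000000000010001000200020000000300010000000000030000000300010003000100000000000100d30063,
     0x200020001000300010001000100010002000200030002000000000003000200000000000100030002000200030000000000030003000000030000000300030000000300010000009300d8),
   (72, 0x100030003000300030001000000020003000200000002000100000000000200020002000300030001000000030001000100010000000000030000000000030001000000e700dc,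
     0x300030003000100010001000200000002000100020000000000030002000000020002000300010000000300010001000100030000000000000001000300000000000300770052),
   (8, 0x200020000000200000000000100030000000000010001000000020002000300010002000200000003000300030000000000000000000000000000000000000084009c,
     0x2000200020000000000000003000300000000000100030002000000030002000200030000000200030001000000010000000000000000000000000000000000290016),
   (0, 0x20000000200020003000100010003000200000001000100000003000300000003000100030003000300000003000000000000000000030000000000ec0017,
     0x2000200020001000100030003000000020001000300030000000000010001000100030001000000010000000100000000000300000000000000f1008f),
   (104, 0x2000200000002000000000002000200000000000000000002000000000002000000010001000100020002000000000003000300000003004a00af,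
     0x200020002000000000000000200020000000000000000000000020002000000010000000100030002000200000000000300010003000000220064),
   (80, 0x2000200000002000000000000000200020000000000000000000000030003000000030000000000030001000300000001006700d3,
     0x20000000000020000000200000000000200020000000000000000000300000000000100000001000300000003000300010000008d00e1),
   (4, 0x10003000100010001000100020001000300020000000000010000000000020001000100030000000300000000000000b6005e,
     0x30003000100030001000300010002000200010000000000000003000200000001000300000001000000010000000000a400df),
   (24, 0x200000002000000000002000000000000000000010003000000030001000200000000000300000000000000a50065,
     0x200000002000200000000000000000000000300030003000000020003000000000000000100000000001f0033),
   (100, 0x20000000000000000000000020000000100020002000300010001000000010002000000000003008e0075,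
     0x2000000000000000000000002000200030003000200010003000100000000000200030000003e0079),
   (12, 0x10001000200030003000100020003000300030000000000030000000000000000005a00a9,
     0x10000000200030003000100020003000300010000000100030000000000000000000000eb0094),
   (84, 0x20000000000000002000200010002000100030001000000000002000300000015000d,
     0x200000000000200020002000300030003000000030002000000000001002a00b6),
   (96, 0x200030003000300020000000200000001000300000000000300a70092,
     0x2000000030001000200010002000000010000000000010003000000a50009),
   (88, 0x10000000300030002000300000000000000020003000000a40093,
     0x3000300010003000200000000000200000000000100d2004e),
   (20, 0x30000000000000000000000000000000000960027,
     0x300000000000000000000000000000000000000e30062),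
   (28, 0x300010000000100000000000000450095,
     0x3000000000003000000030000000000c30080),
   (16, 0x30000000000000000000000a90051,
     0x1000000000000000000ba0004),
   (108, 0x300000000000300e80016,
     0x10003000000ba0056),
   (92, 0x3009400b9,
     0x3000000e00031)]

/-- The table of the search for the vectors with at least twelve odd entries. -/
def oddRows : List Row :=
  [(108, 0x200000000000000000000000000020002000200020002000200000000000200020000000200000001000300030001000000000001000100000000000100030003000300000001000000000000000300000000000000030000000000b70082,
     0x20000000000000000000200000002000200020002000000020002000000000002000000020003000300010001000000000001000300000000000300030003000100010000000000000003000000000000000300000000000000ee000e),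
   (92, 0x2000000000000000000000002000000000000000000000000000000020002000200000000000200010001000200010001000100020000000200020000000100030003000300030001000100000003000100000002000000030000001a007f,
     0x20000000000000000000000020000000000000000000000000002000200000002000200000001000300010002000100030000000200020002000100000003000100030001000100030003000000000003000000020000000100390050),
   (104, 0x200020000000000000000000000020002000200020002000000020000000000020000000000020001000300010001000000000001000300000000000300010003000300010002000200000000000300000003000300010000000300f000be,
     0x200020000000000000000000200000002000200020002000200000000000000000002000200000003000300010003000000000003000300000000000100010003000100020003000000020003000000030000000100010003000000c2007e),
   (28, 0x2000200000000000000000002000200020002000000020000000200020000000000020002000200000000000000030002000000020002000300030002000000030001000300010000000200000000000100000001000100000003007f0034,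
     0x2000200000000000000000002000200020002000200000002000000000002000200000002000200000000000300000000000200020002000300010000000200010001000100010002000000000000000000030001000300030000006e0006),
   (96, 0x200000000000000000002000200000000000200000002000200020000000000000000000200030003000100010002000200010003000200020001000100020000000100030001000000000003000000000000000100000000008f00d0,
     0x200000000000000000000000200020000000000000002000200020000000200000000000200000003000100010003000200020003000300020002000100030000000200030003000000030003000000000000000100000000000000c7005d),
   (84, 0x20000000000000000000000020000000000020002000200020000000000000000000000020001000100020003000100010002000200020000000100020000000000000003000200030003000000000001000300010000000300240051,
     0x200000000000000000000000200000000000000020002000200020000000000000000000200000001000300030002000100030002000200000002000200030000000000030000000300020000000100010000000100010003000000e30047),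
   (0, 0x20002000200020000000200000002000000020002000000000002000200030001000000020000000200030002000300010000000100010001000100000000000000000003000000030000000000430040,
     0x200000002000200000002000000020000000200020002000000000002000200010001000200000002000000020001000100010001000000010003000000030000000000030000000300000000000000020000),
   (44, 0x2000200000000000200020002000200020000000200020000000000000000000100010001000100010001000100020002000300030000000000030002000100000003000000030001000300030000006e006b,
     0x200020000000000020002000200020000000200020002000000000000000000010003000100030001000300020003000300020000000100030000000100020003000000030000000300030000000100550054),
   (12, 0x20002000200020000000200000000000200020002000000000002000200010003000200000002000200000001000200000000000300020003000000000000000000000000000300010000000300a00094,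
     0x200000002000200000002000000020002000000020002000000000002000200030003000000020002000200010000000000020003000000030002000000000000000000000000000100010003000000680065),
   (24, 0x200020000000200020000000200000000000000000000000000000001000000000000000000000003000300010001000000000002000100000003000000000003000000000002000000030064005d,
     0x20002000200000000000200000002000000000000000000000000000000030000000000000000000300010001000300000000000100020003000000000000000000010002000000030000009800c4),
   (100, 0x20000000000000002000200000000000200000003000300010001000200020001000100020000000300010002000000020002000100000000000300030000000100030003000000b8000b,
     0x20000000000020002000000000000000200030001000100030002000200010003000000020001000100000002000200020000000300030000000000010003000300000001005400d4),
   (16, 0x20002000000000000000200020002000200020003000000000000000000000000000000000000000000000000000000000000000000000000000000000000000000000087004a,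
     0x200020000000000020000000200020002000200000001000000000000000000000000000000000000000000000000000000000000000000000000000000000000000000a90021),
   (40, 0x200000002000200000000000200000003000100010003000100030001000000010002000000010001000300030003000300000000000000000001000000000001009a,
     0x2000200020000000000000002000100010003000300030003000000030002000300010000000300030003000100000001000000000001000000000000002100ad),
   (88, 0x2000000020001000100000003000300010000000000030003000300000000000200010001000300030003000000000001000100000003000000b5009e,
     0x20000000200000001000300030000000100010000000000030001000000010002000000010003000300010000000100010000000000030000000100f6009c),
   (80, 0x200030003000000010001000300000002000300030000000100010001000100000001000000000001000000030001000000030000005e00a1,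
     0x200000003000100010000000300030002000000030001000100000001000300000003000000030001000000030000000000030000000100f100f6),
   (36, 0x2000200020001000100010001000000010002000300020003000100020001000000000003000300000000000300000001001d005a,
     0x20000000200020001000300010003000100000003000200030002000200030000000300030000000000010003000000010000000b0083),
   (20, 0x3000000020002000200020002000100030001000100010000000000030000000000000000000000000000000000ce00b7,
     0x30000000200000002000200020002000300030001000300000003000300000000000000000000000000000000000000d60009),
   (32, 0x100030003000100020003000100020003000000020000000000020001000000000000000000000000000000c000bb,
     0x300030001000100030002000200030000000100000002000200000000000300000000000000000000000000e70004),
   (8, 0x2000300020003000100000003000300010003000000000000000000000001000000030000005c0017,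
     0x20000000200010001000100030000000100010000000100000000000000000000000300000001003c0064),
   (4, 0x3000000000000000300010000000300030000000000030000000000000000000000ec007d,
     0x30000000000000003000000000003000300010000000000000001000000000000000000b500b0),
   (64, 0x200000001000100010002000300000000000100000000000000000000000000ec0080,
     0x20001000300020003000000010001000000000000000000000000000000bc0037),
   (76, 0x1000100020003000300020003000000000001000300000001000000120097,
     0x10003000300020002000100000001000100000000000100000003002e00dd),
   (52, 0x10003000300030000000000030000000000030000000000ae006a,
     0x300030003000100000000000000010003000000000000004b00b9),
   (72, 0x1000100010000000000000001000000000000008d00ae,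
     0x1000300000003000000000000000300000000009f002f),
   (68, 0x1000000030000000000030000009c00a2,
     0x100000003000000000000000000010028005a),
   (56, 0x100000000000000000000009e004c,
     0x30000000000000000005200f7),
   (48, 0x100000003000000290018,
     0x300000001001000cf),
   (60, 0x3000000b00079,
     0x100e90080)]

lemma parityRows_isTable : IsTable 1 1 parityRows := .of_check (by decide +kernel)

lemma halfRows_isTable : IsTable 2 0 halfRows := .of_check (by decide +kernel)

lemma evenRows_isTable : IsTable 2 2 evenRows := .of_check (by decide +kernel)

lemma evenFullRows_isTable : IsTable 4 0 evenFullRows := .of_check (by decide +kernel)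

lemma eightRows_isTable : IsTable 4 0 eightRows := .of_check (by decide +kernel)

lemma oddRows_isTable : IsTable 4 0 oddRows := .of_check (by decide +kernel)

/-- The parities. -/
def paritySel : ℕ → List Val := fun _ => [(0, 0, 0), (1, 1, 0)]

/-- The residues modulo `2` with a given parity. -/
def halfSel : ℕ → List Val := pick
  [[(0, 0, 0), (2, 1, 1)],
   [(0, 1, 0), (0, 0, 1)]]

/-- The residues modulo `2 + 2i` with a given residue modulo `2`. -/
def evenSel : ℕ → List Val := pick
  [[(0, 0, 0), (4, 2, 0)],
   [(0, 1, 0), (0, 3, 0)],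
   [],
   [],
   [(0, 0, 1), (0, 0, 3)],
   [(0, 1, 1), (0, 1, 3)]]

/-- The residues modulo `4` with a given residue modulo `2 + 2i`. -/
def evenFullSel : ℕ → List Val := pick
  [[(0, 0, 0), (8, 2, 2)],
   [(0, 1, 0), (4, 3, 2)],
   [(0, 2, 0), (0, 0, 2)],
   [(0, 3, 0), (4, 1, 2)],
   [(0, 0, 1), (4, 2, 3)],
   [(0, 1, 1), (0, 3, 3)],
   [],
   [],
   [],
   [],
   [],
   [],
   [(0, 0, 3), (4, 2, 1)],
   [(0, 1, 3), (0, 3, 1)]]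

/-- The residues modulo `4` with a given residue modulo `2`. -/
def eightSel : ℕ → List Val := pick
  [[(0, 0, 0), (4, 2, 0), (4, 0, 2), (8, 2, 2)],
   [(0, 1, 0), (0, 3, 0), (4, 1, 2), (4, 3, 2)],
   [],
   [],
   [(0, 0, 1), (0, 0, 3), (4, 2, 1), (4, 2, 3)],
   [(0, 1, 1), (0, 1, 3), (0, 3, 1), (0, 3, 3)]]

/-- The residues modulo `4` with a given parity; odd residues with index `2` are normalised by a power of `i`. -/
def oddSel : ℕ → List Val := pick
  [[(0, 0, 0), (2, 1, 1), (2, 1, 3), (2, 3, 1), (2, 3, 3), (4, 2, 0), (4, 0, 2), (8, 2, 2)],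
   [(0, 1, 0), (0, 0, 1), (0, 3, 0), (0, 0, 3), (4, 1, 2), (4, 3, 2), (4, 2, 1), (4, 2, 3)],
   [(0, 1, 0), (4, 1, 2)]]

/-- Nothing is known. -/
def trivialKind : Kind := fun _ _ => (0, 0, 0)

/-- The parity. -/
def parityKind : Kind := fun x y => ((x + y) % 2, (x + y) % 2, 0)

/-- The residue modulo `2`. -/
def halfKind : Kind := fun x y => (x % 2 + y % 2, x % 2, y % 2)

/-- The residue modulo `2 + 2i`. -/
def evenKind : Kind := fun x y =>
  if x % 2 = 0 ∧ y % 2 = 0 then (if x = y then (0, 0, 0) else (4, 2, 0))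
  else if x % 2 = 0 then (1, 0, if x = 0 then y else 4 - y)
  else if y % 2 = 0 then (1, (if y = 0 then x else 4 - x), 0)
  else (2, 1, if x = y then 1 else 3)

lemma trivialKind_bounded : trivialKind.Bounded := by decide +kernel
lemma parityKind_bounded : parityKind.Bounded := by decide +kernel
lemma halfKind_bounded : halfKind.Bounded := by decide +kernel
lemma evenKind_bounded : evenKind.Bounded := by decide +kernel
lemma fullKind_bounded : fullKind.Bounded := by decide +kernel

lemma parity_refines : Refines 1 1 trivialKind parityKind paritySel := by decide +kernel
lemma half_refines : Refines 2 0 parityKind halfKind halfSel := by decide +kernel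
lemma even_refines : Refines 2 2 halfKind evenKind evenSel := by decide +kernel
lemma evenFull_refines : Refines 4 0 evenKind fullKind evenFullSel := by decide +kernel
lemma eight_refines : Refines 4 0 halfKind fullKind eightSel := by decide +kernel
lemma odd_refines : Refines 4 0 parityKind fullKind oddSel := by decide +kernel

/-! ## The searches -/

/-- Membership in a list of numbers. -/
def memL (n : ℕ) (l : List ℕ) : Bool :=
  List.rec false (fun a _ ih => Bool.rec ih true (Nat.beq a n)) l

lemma mem_of_memL {n : ℕ} {l : List ℕ} (h : memL n l = true) : n ∈ l := by
  induction l with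
  | nil => exact absurd h Bool.false_ne_true
  | cons a l ih =>
    have h1 : memL n (a :: l) = Bool.rec (memL n l) true (Nat.beq a n) := rfl
    rw [h1] at h
    cases ha : Nat.beq a n with
    | true => exact List.mem_cons.2 (Or.inl (Nat.eq_of_beq_eq_true ha).symm)
    | false =>
      rw [ha] at h
      exact List.mem_cons_of_mem _ (ih h)

/-- Cyclic permutations of the rows. -/
def shiftMoves : List Mono := [rowShift, rowShift2, rowShift4]

/-- Affine permutations of the rows. -/
def affineMoves : List Mono := [rowDouble, rowDouble, rowShift, rowShift2, rowShift4]

/-- Transformations that normalise vectors with twelve odd entries. -/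
def twelveMoves : List Mono := [rowShift, rowShift2, rowShift4, rowTwist0, rowTwist1, rowTwist2,
  rowTwist3, rowTwist5]

/-- Transformations that normalise vectors with odd entries in all rows. -/
def mixedMoves : List Mono := [rowShift, rowShift2, rowShift4, rowTwist0, rowTwist2, rowTwist4,
  rowTwist5, rowTwist6]

/-- The parities of two rows. -/
def eightWord : ℕ := 0x11111111

/-- The parities of four rows. -/
def fourRowsWord : ℕ := 0x1111111111111111

/-- The parities of four rows. -/
def fourRowsWord' : ℕ := 0x11110000111111111111

/-- The parities of twelve entries. -/
def twelveWord : ℕ := 0x10101100101001100110110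

/-- The parities of vectors with all entries in four rows. -/
def blockWord : ℕ := 0x11111111111100001111

/-- The parities of vectors with entries in all rows. -/
def mixedWord : ℕ := 0x11001101101111010101101010

/-- All parities. -/
def parityWords : List ℕ := words mixedMoves mixedWord ++ (words twelveMoves twelveWord ++
  (words affineMoves eightWord ++ (words affineMoves fourRowsWord ++
    (words shiftMoves fourRowsWord' ++ (words shiftMoves blockWord ++ [0])))))

/-- The residues modulo `2` of the even vectors. -/
def halfWords : List ℕ := words shiftMoves 0x5555 ++
  (words affineMoves 0x55555555 ++ [0])

/-- Codes of vectors with all entries in four rows. -/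
def blockCodes : List ℕ :=
  [0x111114c111c400004341,
   0x1111433ccc130000c141,
   0x1133144313440000c3c1,
   0x113343144c11000041c1,
   0x13131c4131440000c141,
   0x1313411c4c3300004341,
   0x13311cc333c4000041c1,
   0x13314134cc310000c3c1,
   0x44441c414c33000041c1,
   0x4444411c31440000c3c1,
   0x44cc1cc344130000c141,
   0x44cc4134114c00004341,
   0x4c4c14c144310000c3c1,
   0x4c4c433c334c000041c1,
   0x4cc414434c1100004341,
   0x4cc4431413440000c141]

/-- Codes of vectors with entries in all rows. -/
def mixedCodes : List ℕ :=
  [0x11001c043041c403010cc04010,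
   0x13001404103413010104c0c010]

/-- The images of codes under products of monomial transformations. -/
def images (gs : List Mono) (l : List ℕ) : List ℕ :=
  List.rec l (fun g _ ih => forceL ih fun ws => ws ++ ws.map (actCode g)) gs

lemma search_parity : (forceL parityWords fun l =>
    search paritySel 0 (fun R _ => memL R l) parityRows 896 0 16 0) = true := by
  decide +kernel

lemma search_half : (forceL halfWords fun l =>
    search halfSel 0 (fun R _ => memL R l) halfRows 896 0 16 0) = true := by
  decide +kernel

/-- The search for even vectors with given residues modulo `2`. -/
def evenSearch (R₀ bud : ℕ) : Bool :=
  search evenSel R₀ (fun R bud => search evenFullSel R (fun R _ => Nat.beq R 0) evenFullRows 896 0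
    bud 0) evenRows 896 0 bud 0

lemma search_even : evenSearch 0 16 = true := by
  decide +kernel

lemma search_even_row : evenSearch 0x5555 8 = true := by
  decide +kernel

lemma search_even_rows : evenSearch 0x55555555 0 = true := by
  decide +kernel

lemma search_eight : search halfSel eightWord (fun R bud => search eightSel R (fun _ _ => false)
    eightRows 896 0 bud 0) halfRows 896 0 8 0 = true := by
  decide +kernel

lemma search_fourRows :
    search oddSel fourRowsWord (fun _ _ => false) oddRows 896 0 0 0 = true := by
  decide +kernel

lemma search_fourRows' :
    search oddSel fourRowsWord' (fun _ _ => false) oddRows 896 0 0 0 = true := by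
  decide +kernel

lemma search_twelve :
    search oddSel twelveWord (fun _ _ => false) oddRows 896 0 4 0 = true := by
  decide +kernel

lemma search_block : (forceL (images [rowSign2, rowSign3] blockCodes) fun l =>
    search oddSel (blockWord + 1) (fun R _ => memL R l) oddRows 896 0 0 0) = true := by
  decide +kernel

lemma search_mixed : (forceL (images [rowSign1, rowSign2, rowSign3] mixedCodes) fun l =>
    search oddSel (mixedWord + 16) (fun R _ => memL R l) oddRows 896 0 0 0) = true := by
  decide +kernel

/-! ## The classification of the sacred vectors -/

lemma parityKind_digit (z : GaussianInt) : parityKind.digit z = ((z.re + z.im) % 2).toNat := by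
  simp only [Kind.digit, Kind.val, parityKind]
  omega

lemma parityKind_inv (M : GVec) : parityKind.Inv M := by
  have h : ∀ z, parityKind.digit (i * z) = parityKind.digit z := fun z => by
    rw [parityKind_digit, parityKind_digit, Zsqrtd.re_mul, Zsqrtd.im_mul]
    simp only
    omega
  intro p u
  induction u with
  | zero => rw [pow_zero, one_mul]
  | succ u ih => rw [pow_succ', mul_assoc, h, ih]

lemma halfKind_digit (z : GaussianInt) :
    halfKind.digit z = (z.re % 2).toNat + 4 * (z.im % 2).toNat := by
  simp only [Kind.digit, Kind.val, halfKind]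
  omega

lemma halfKind_inv {M : GVec} (hM : ∀ p, (M p).re % 2 = (M p).im % 2) : halfKind.Inv M := by
  intro p u
  have h : halfKind.digit (i ^ u * M p) = halfKind.digit (M p) ∧
      (i ^ u * M p).re % 2 = (i ^ u * M p).im % 2 := by
    induction u with
    | zero =>
      rw [pow_zero, one_mul]
      exact ⟨rfl, hM p⟩
    | succ u ih =>
      obtain ⟨h1, h2⟩ := ih
      rw [pow_succ', mul_assoc]
      generalize i ^ u * M p = z at *
      rw [← h1, halfKind_digit, halfKind_digit, Zsqrtd.re_mul, Zsqrtd.im_mul]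
      simp only
      constructor <;> omega
  exact h.1

lemma cost_of_code {k : Kind} (hk : k.Bounded)
    (hc : ∀ x < 4, ∀ y < 4, (k x y).1 = (k x y).2.1 + (k x y).2.2) (M : GVec) :
    k.cost M = ∑ p : Fin 28, ((k.code M >>> (4 * (p : ℕ)) &&& 15) % 4 +
      (k.code M >>> (4 * (p : ℕ)) &&& 15) / 4) := by
  refine Finset.sum_congr rfl fun p _ => ?_
  rw [hk.digit_code]
  have h1 := hc _ (toNat_emod_lt (M p).re) _ (toNat_emod_lt (M p).im)
  have h2 := hk.val (M p)
  simp only [Kind.digit]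
  simp only [Kind.val] at *
  omega

lemma parity_cost {M : GVec} {w c : ℕ} (hw : parityKind.code M = w)
    (h : ∑ p : Fin 28, ((w >>> (4 * (p : ℕ)) &&& 15) % 4 + (w >>> (4 * (p : ℕ)) &&& 15) / 4) = c) :
    parityKind.cost M = c := by
  rw [cost_of_code parityKind_bounded (by decide +kernel), hw, h]

lemma half_cost {M : GVec} {w c : ℕ} (hw : halfKind.code M = w)
    (h : ∑ p : Fin 28, ((w >>> (4 * (p : ℕ)) &&& 15) % 4 + (w >>> (4 * (p : ℕ)) &&& 15) / 4) = c) :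
    halfKind.cost M = c := by
  rw [cost_of_code halfKind_bounded (by decide +kernel), hw, h]

lemma parityCode_mem {M : GVec} (hM : IsSacred M) : parityKind.code M ∈ parityWords := by
  have h := search_parity
  rw [forceL_eq] at h
  have h0 : trivialKind.code M = 0 := by
    rw [Kind.code, pack]
    exact Finset.sum_eq_zero fun p _ => Nat.zero_shiftLeft _
  have hc : trivialKind.cost M = 0 := Finset.sum_eq_zero fun p _ => rfl
  obtain ⟨b, -, hb⟩ := phase parityRows_isTable parity_refines trivialKind_bounded
    parityKind_bounded hM (bud := 16) (by rw [hc]) (by rw [h0]; exact h)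
  exact mem_of_memL hb

lemma Moves.isSacred {gs : List Mono} (hgs : ∀ g ∈ gs, Mono.IsSym g) {M N : GVec}
    (h : Moves gs M N) (hM : IsSacred M) : IsSacred N :=
  h.preserves (fun g hg _ hM => (hgs g hg).isSacred hM) hM

lemma isUnit_i_pow (u : ℕ) : IsUnit (i ^ u) := IsUnit.of_mul_eq_one _ (i_pow_mul_star u)

lemma Moves.dvd {gs : List Mono} (hgs : ∀ g ∈ gs, Mono.IsSym g) {M N : GVec}
    (h : Moves gs M N) (hN : ∀ p, 4 ∣ N p) : ∀ p, 4 ∣ M p := by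
  induction gs generalizing M with
  | nil => exact h ▸ hN
  | cons g gs ih =>
    have hgs' : ∀ g ∈ gs, Mono.IsSym g := fun g hg => hgs g (List.mem_cons_of_mem _ hg)
    rcases h with h | h
    · exact ih hgs' h
    · intro p
      obtain ⟨q, rfl⟩ := (Finite.injective_iff_bijective.1 (hgs g (List.mem_cons_self ..)).inj).2 p
      exact (IsUnit.dvd_mul_left (isUnit_i_pow _)).1 (ih hgs' h q)

lemma shiftMoves_isSym : ∀ g ∈ shiftMoves, Mono.IsSym g := by
  simp only [shiftMoves, List.forall_mem_cons]
  exact ⟨rowShift_isSym, rowShift2_isSym, rowShift4_isSym, by simp⟩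

lemma affineMoves_isSym : ∀ g ∈ affineMoves, Mono.IsSym g := by
  simp only [affineMoves, List.forall_mem_cons]
  exact ⟨rowDouble_isSym, rowDouble_isSym, rowShift_isSym, rowShift2_isSym, rowShift4_isSym, by simp⟩

lemma twelveMoves_isSym : ∀ g ∈ twelveMoves, Mono.IsSym g := by
  simp only [twelveMoves, List.forall_mem_cons]
  exact ⟨rowShift_isSym, rowShift2_isSym, rowShift4_isSym, rowTwist0_isSym, rowTwist1_isSym,
    rowTwist2_isSym, rowTwist3_isSym, rowTwist5_isSym, by simp⟩

lemma mixedMoves_isSym : ∀ g ∈ mixedMoves, Mono.IsSym g := by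
  simp only [mixedMoves, List.forall_mem_cons]
  exact ⟨rowShift_isSym, rowShift2_isSym, rowShift4_isSym, rowTwist0_isSym, rowTwist2_isSym,
    rowTwist4_isSym, rowTwist5_isSym, rowTwist6_isSym, by simp⟩

/-! ### Even vectors -/

lemma dvd_of_fullCode {N : GVec} (h : fullKind.code N = 0) (p : Fin 28) : 4 ∣ N p := by
  have h1 := fullKind_bounded.digit_code N p
  rw [h, Nat.zero_shiftRight, Nat.zero_and] at h1
  simp only [Kind.digit, Kind.val, fullKind] at h1
  exact four_dvd ⟨by omega, by omega⟩

lemma dvd_of_evenSearch {N : GVec} (hN : IsSacred N) {w b c : ℕ} (hw : halfKind.code N = w)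
    (hc : ∑ p : Fin 28, ((w >>> (4 * (p : ℕ)) &&& 15) % 4 + (w >>> (4 * (p : ℕ)) &&& 15) / 4) = c)
    (hb : b + c = 16) (h : evenSearch w b = true) (p : Fin 28) : 4 ∣ N p := by
  obtain ⟨b', hb', h'⟩ := phase evenRows_isTable even_refines halfKind_bounded evenKind_bounded hN
    (bud := b) (by rw [half_cost hw hc]; exact hb) (by rw [hw]; exact h)
  obtain ⟨b'', -, h''⟩ := phase evenFullRows_isTable evenFull_refines evenKind_bounded
    fullKind_bounded hN hb' h'
  exact dvd_of_fullCode (Nat.eq_of_beq_eq_true h'') p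

lemma dvd_of_even {M : GVec} (hM : IsSacred M) (hp : parityKind.code M = 0) (p : Fin 28) :
    4 ∣ M p := by
  have h := search_half
  rw [forceL_eq] at h
  obtain ⟨b, -, hb⟩ := phase halfRows_isTable half_refines parityKind_bounded
    halfKind_bounded hM (bud := 16) (by rw [parity_cost hp (c := 0) (by decide +kernel)])
    (by rw [hp]; exact h)
  have hi : halfKind.Inv M := halfKind_inv fun q => by
    have h1 := parityKind_bounded.digit_code M q
    rw [hp, Nat.zero_shiftRight, Nat.zero_and, parityKind_digit] at h1
    omega
  have h1 := mem_of_memL hb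
  rw [halfWords, List.mem_append, List.mem_append, List.mem_singleton] at h1
  rcases h1 with h1 | h1 | h1
  · obtain ⟨N, h2, h3⟩ := exists_moves halfKind_bounded shiftMoves_isSym (by norm_num) hi h1
    exact h2.dvd shiftMoves_isSym (fun q => dvd_of_evenSearch (h2.isSacred shiftMoves_isSym hM) h3
      (c := 8) (by decide +kernel) (by norm_num) search_even_row q) p
  · obtain ⟨N, h2, h3⟩ := exists_moves halfKind_bounded affineMoves_isSym (by norm_num) hi h1
    exact h2.dvd affineMoves_isSym (fun q => dvd_of_evenSearch
      (h2.isSacred affineMoves_isSym hM) h3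
      (c := 16) (by decide +kernel) (by norm_num) search_even_rows q) p
  · exact dvd_of_evenSearch hM h1 (c := 0) (by decide +kernel) (by norm_num) search_even p

lemma eq_i_pow_of_norm {z : GaussianInt} (h : z.norm = 1) : ∃ u, z = i ^ u := by
  obtain ⟨x, y⟩ := z
  rw [Zsqrtd.norm_def] at h
  simp only at h
  have hx : x * x ≤ 1 := by nlinarith [mul_self_nonneg y]
  have hy : y * y ≤ 1 := by nlinarith [mul_self_nonneg x]
  have hx1 : -1 ≤ x := by nlinarith
  have hx2 : x ≤ 1 := by nlinarith
  have hy1 : -1 ≤ y := by nlinarith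
  have hy2 : y ≤ 1 := by nlinarith
  interval_cases x <;> interval_cases y <;> simp at h
  · exact ⟨2, by decide⟩
  · exact ⟨3, by decide⟩
  · exact ⟨1, by decide⟩
  · exact ⟨0, by decide⟩

lemma norm_nonneg' (z : GaussianInt) : 0 ≤ z.norm := by
  rw [Zsqrtd.norm_def]
  nlinarith [mul_self_nonneg z.re, mul_self_nonneg z.im]

lemma eq_zero_of_norm {z : GaussianInt} (h : z.norm = 0) : z = 0 := by
  rw [Zsqrtd.norm_def] at h
  apply Zsqrtd.ext
  · exact mul_self_eq_zero.1 (by nlinarith [mul_self_nonneg z.re, mul_self_nonneg z.im])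
  · exact mul_self_eq_zero.1 (by nlinarith [mul_self_nonneg z.re, mul_self_nonneg z.im])

lemma exists_frame {M : GVec} (hM : IsSacred M) (h : ∀ p, 4 ∣ M p) :
    ∃ u p, M = i ^ u • frame p := by
  choose z hz using h
  have h1 : ∑ p, (z p).norm = 1 := by
    have h2 := hM.norm_sum
    have h3 : ∀ p, (M p).norm = 16 * (z p).norm := fun p => by
      rw [hz, Zsqrtd.norm_mul]
      rfl
    simp only [h3, ← Finset.mul_sum] at h2
    omega
  have h4 : ∃ p, (z p).norm ≠ 0 := by
    by_contra h5
    push Not at h5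
    simp [h5] at h1
  obtain ⟨p, hp⟩ := h4
  have hp' := norm_nonneg' (z p)
  have h5 : ∑ q ∈ Finset.univ.erase p, (z q).norm = 1 - (z p).norm := by
    have h8 := Finset.add_sum_erase Finset.univ (fun q => (z q).norm) (Finset.mem_univ p)
    have h9 : (z p).norm + ∑ q ∈ Finset.univ.erase p, (z q).norm = ∑ q, (z q).norm := h8
    omega
  have h6 : 0 ≤ ∑ q ∈ Finset.univ.erase p, (z q).norm :=
    Finset.sum_nonneg fun q _ => norm_nonneg' _
  have h7 : (z p).norm = 1 := by omega
  rw [h7, sub_self, Finset.sum_eq_zero_iff_of_nonneg fun q _ => norm_nonneg' _] at h5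
  obtain ⟨u, hu⟩ := eq_i_pow_of_norm h7
  refine ⟨u, p, funext fun q => ?_⟩
  rw [hz q, Pi.smul_apply, smul_eq_mul]
  by_cases hq : q = p
  · rw [hq, hu, frame_apply_self, mul_comm]
  · rw [eq_zero_of_norm (h5 q (Finset.mem_erase.2 ⟨hq, Finset.mem_univ q⟩)), frame,
      Pi.single_eq_of_ne hq, mul_zero, mul_zero]

/-! ### Vectors with odd entries -/

lemma false_of_eight {N : GVec} (hN : IsSacred N) (hw : parityKind.code N = eightWord) : False := by
  obtain ⟨b, hb, h⟩ := phase halfRows_isTable half_refines parityKind_bounded halfKind_bounded hN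
    (bud := 8) (by rw [parity_cost hw (c := 8) (by decide +kernel)]) (by rw [hw]; exact search_eight)
  obtain ⟨-, -, h'⟩ := phase eightRows_isTable eight_refines halfKind_bounded fullKind_bounded hN hb h
  exact Bool.false_ne_true h'

lemma false_of_odd {N : GVec} (hN : IsSacred N) {w b c : ℕ} (hw : parityKind.code N = w)
    (hc : ∑ p : Fin 28, ((w >>> (4 * (p : ℕ)) &&& 15) % 4 + (w >>> (4 * (p : ℕ)) &&& 15) / 4) = c)
    (hb : b + c = 16) (h : search oddSel w (fun _ _ => false) oddRows 896 0 b 0 = true) : False := by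
  obtain ⟨-, -, h'⟩ := phase oddRows_isTable odd_refines parityKind_bounded fullKind_bounded hN
    (bud := b) (by rw [parity_cost hw hc]; exact hb) (by rw [hw]; exact h)
  exact Bool.false_ne_true h'

/-- All entries have norm at most `1`. -/
def Small (M : GVec) : Prop := ∀ p, (M p).norm ≤ 1

lemma norm_i_pow (u : ℕ) : (i ^ u).norm = 1 := by
  induction u with
  | zero => rfl
  | succ u ih => rw [pow_succ, Zsqrtd.norm_mul, ih]; rfl

lemma norm_eq_of_odd {N : GVec} (hN : IsSacred N) (hc : parityKind.cost N = 16) (p : Fin 28) :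
    (N p).norm = parityKind.digit (N p) := by
  have h1 : ∀ q, ((parityKind.val (N q)).1 : ℤ) ≤ (N q).norm := fun q => parity_refines.le_norm _
  have h2 : ∑ q, ((parityKind.val (N q)).1 : ℤ) = ∑ q, (N q).norm := by
    rw [hN.norm_sum, ← Nat.cast_sum]
    exact_mod_cast hc
  rw [← (Finset.sum_eq_sum_iff_of_le fun q _ => h1 q).1 h2 p (Finset.mem_univ p)]
  rfl

lemma Small.dec_code {N : GVec} (hN : Small N) : dec (fullKind.code N) = N := by
  funext p
  have h1 : dec (fullKind.code N) p = decNib (fullKind.digit (N p)) := by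
    rw [← fullKind_bounded.digit_code, and_fifteen, decNib_mod, Nat.shiftRight_eq_div_pow, pow_mul]
    rfl
  have h2 : (N p).norm = 0 ∨ (N p).norm = 1 := by
    have := norm_nonneg' (N p)
    have := hN p
    omega
  rw [h1]
  rcases h2 with h2 | h2
  · rw [eq_zero_of_norm h2]
    decide
  · obtain ⟨u, hu⟩ := eq_i_pow_of_norm h2
    rw [hu, ← i_pow_mod]
    have h3 : u % 4 < 4 := Nat.mod_lt _ (by norm_num)
    interval_cases u % 4 <;> decide

/-- Normalised vectors with sixteen odd entries. -/
lemma exists_normalised {N : GVec} (hN : IsSacred N) {w : ℕ} {p₀ : Fin 28}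
    (hw : parityKind.code N = w) {l : List ℕ}
    (hc : ∑ p : Fin 28, ((w >>> (4 * (p : ℕ)) &&& 15) % 4 + (w >>> (4 * (p : ℕ)) &&& 15) / 4) = 16)
    (hp₀ : w >>> (4 * (p₀ : ℕ)) &&& 15 = 1)
    {w' : ℕ} (hw' : ∀ p : Fin 28, w' >>> (4 * (p : ℕ)) &&& 15 =
      if p = p₀ then 2 else w >>> (4 * (p : ℕ)) &&& 15)
    (h : search oddSel w' (fun R _ => memL R l) oddRows 896 0 0 0 = true) :
    ∃ u, Small (i ^ u • N) ∧ ∃ n ∈ l, i ^ u • N = dec n := by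
  have h1 := norm_eq_of_odd hN (parity_cost hw hc)
  have h2 : (N p₀).norm = 1 := by
    rw [h1, ← parityKind_bounded.digit_code, hw, hp₀]
    rfl
  obtain ⟨v, hv⟩ := eq_i_pow_of_norm h2
  have h3 : i ^ (3 * v) * N p₀ = 1 := by
    rw [hv, ← pow_add, show 3 * v + v = 4 * v by ring, pow_mul, show i ^ 4 = 1 by decide, one_pow]
  obtain ⟨N', hN'⟩ : ∃ N', N' = i ^ (3 * v) • N := ⟨_, rfl⟩
  have hs : IsSacred N' := by
    rw [hN']
    exact ⟨D.smul_mem _ hN.1, by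
      rw [ipv_smul_left, ipv_smul_right, ← mul_assoc, i_pow_mul_star, one_mul, hN.2]⟩
  have hw2 : parityKind.code N' = w := by
    have h4 : (fun p => parityKind.digit (N' p)) = fun p => parityKind.digit (N p) := by
      funext p
      rw [hN']
      exact parityKind_inv N p _
    exact (congrArg pack h4).trans hw
  have hc2 := parity_cost hw2 hc
  have hsm : Small N' := fun p => by
    rw [norm_eq_of_odd hs hc2, parityKind_digit]
    omega
  have hN'p : N' p₀ = 1 := by rw [hN', ← h3]; rfl
  have hsel : ∀ p : Fin 28, ((fullKind.val (N' p)).1 - (parityKind.val (N' p)).1,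
      (fullKind.val (N' p)).2) ∈ oddSel (w' >>> (4 * (p : ℕ)) &&& 15) := by
    intro p
    rw [hw']
    by_cases hp : p = p₀
    · rw [if_pos hp, hp, hN'p]
      decide +kernel
    · rw [if_neg hp, ← hw2, parityKind_bounded.digit_code]
      exact odd_refines.mem _
  have hb : 0 + parityKind.cost N' = 16 := by omega
  have hph := phase_of_mem (R₀ := w') (bud := 0) (Q := fun R _ => memL R l) oddRows_isTable
    odd_refines fullKind_bounded hs hsel hb
  obtain ⟨b, -, hb⟩ := hph h
  refine ⟨3 * v, ?_⟩
  rw [← hN']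
  exact ⟨hsm, _, mem_of_memL hb, hsm.dec_code.symm⟩

/-- The sacred vectors. -/
theorem sacred_cases {M : GVec} (hM : IsSacred M) : (∃ u p, M = i ^ u • frame p) ∨
    (∃ u N, Moves mixedMoves (i ^ u • M) N ∧ Small N ∧
      ∃ n ∈ images [rowSign1, rowSign2, rowSign3] mixedCodes, N = dec n) ∨
    ∃ u N, Moves shiftMoves (i ^ u • M) N ∧ Small N ∧
      ∃ n ∈ images [rowSign2, rowSign3] blockCodes, N = dec n := by
  have h := parityCode_mem hM
  have hi := parityKind_inv M
  simp only [parityWords, List.mem_append, List.mem_singleton] at h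
  rcases h with h | h | h | h | h | h | h
  · obtain ⟨N, h2, h3⟩ := exists_moves parityKind_bounded mixedMoves_isSym
      (by rw [mixedWord]; norm_num) hi h
    have hs := search_mixed
    rw [forceL_eq] at hs
    obtain ⟨u, hu, n, hn, hn'⟩ := exists_normalised (h2.isSacred mixedMoves_isSym hM) h3 (p₀ := 1)
      (by decide +kernel) (by decide +kernel) (by decide +kernel) hs
    exact Or.inr (Or.inl ⟨u, _, h2.smul _, hu, n, hn, hn'⟩)
  · obtain ⟨N, h2, h3⟩ := exists_moves parityKind_bounded twelveMoves_isSym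
      (by rw [twelveWord]; norm_num) hi h
    exact (false_of_odd (h2.isSacred twelveMoves_isSym hM) h3 (c := 12) (by decide +kernel)
      (by norm_num) search_twelve).elim
  · obtain ⟨N, h2, h3⟩ := exists_moves parityKind_bounded affineMoves_isSym
      (by rw [eightWord]; norm_num) hi h
    exact (false_of_eight (h2.isSacred affineMoves_isSym hM) h3).elim
  · obtain ⟨N, h2, h3⟩ := exists_moves parityKind_bounded affineMoves_isSym
      (by rw [fourRowsWord]; norm_num) hi h
    exact (false_of_odd (h2.isSacred affineMoves_isSym hM) h3 (c := 16) (by decide +kernel)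
      (by norm_num) search_fourRows).elim
  · obtain ⟨N, h2, h3⟩ := exists_moves parityKind_bounded shiftMoves_isSym
      (by rw [fourRowsWord']; norm_num) hi h
    exact (false_of_odd (h2.isSacred shiftMoves_isSym hM) h3 (c := 16) (by decide +kernel)
      (by norm_num) search_fourRows').elim
  · obtain ⟨N, h2, h3⟩ := exists_moves parityKind_bounded shiftMoves_isSym
      (by rw [blockWord]; norm_num) hi h
    have hs := search_block
    rw [forceL_eq] at hs
    obtain ⟨u, hu, n, hn, hn'⟩ := exists_normalised (h2.isSacred shiftMoves_isSym hM) h3 (p₀ := 0)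
      (by decide +kernel) (by decide +kernel) (by decide +kernel) hs
    exact Or.inr (Or.inr ⟨u, _, h2.smul _, hu, n, hn, hn'⟩)
  · exact Or.inl (exists_frame hM (dvd_of_even hM h))

section
/-! ## An isometry that fixes the complement `λ_*` -/

/-- The multiple of an encoded vector given by a pair of numbers. -/
def scaled (c : ℕ × ℕ) : GVec := fun p => (c.1 : GaussianInt) * dec c.2 p

/-- The columns of an automorphism of the lattice that fixes `λ_*`. -/
def stabCols : List (ℕ × ℕ) :=
  [(1, 0x4c4c433c11c40000c343), (1, 0x13131443441300001c3c), (1, 0xc4c4433c11c4000041c1), (1,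
   0x13133cc1cc3100001c3c), (4, 0x10000), (4, 0xc00000), (4, 0x100000000000000000000000000), (4,
   0xc0000000000000000000000000), (1, 0x4cc4431413440000c141), (1, 0x4cc4c13c1344000043c3), (1,
   0x31133c43c41100003c1c), (1, 0x13313c434c3300003c1c), (1, 0x4444411c13cc00004143), (1,
   0x33331cc3c4330000343c), (1, 0x33331cc34c1100001c14), (1, 0xccccc33413cc00004143), (1,
   0x331134c3443100003c34), (1, 0x113334c344310000141c), (1, 0x11331c41443100003c34), (1,
   0x33111c4144310000141c), (4, 0xc000000000000000000000), (4, 0x30000000), (4,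
   0x300000000000000000000000), (4, 0xc000000), (4, 0x1000000000000000000000000), (4,
   0x300000000000000000000), (4, 0x40000000000000000000000), (4, 0x4000000000000000000000000000)]

/-- The images of the tabulated generators of the lattice under this automorphism. -/
def stabImages : List (ℕ × ℕ) :=
  [(1, 0xc003ccc1c04004c00401c4000041), (1, 0x4303c4c30101001030c330000c1), (1,
   0x340cc1c40c0c00c401011003400), (1, 0x30c000331c00300c1343c0403001), (1,
   0xc43c00300c4313040404c03040), (1, 0xc13103010110c0100011c3004001), (1,
   0x30c3100410003c0441c301004c0), (1, 0x33331cc34c1100001c1400000000), (1,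
   0x404c0040c03330014000430c311), (1, 0xcc003c000410441cc0c003300401), (1,
   0x3010c400104cc0000c1041031c1), (1, 0x333c0c04400c3040004cc1000430), (1,
   0x40400110c010330000340c104331), (1, 0x3c033c3c0c0c004403013001400), (1,
   0x310041003004c441040404400403), (1, 0x4c14303003100c010011c1001004), (1,
   0x13004100100cc44104040cc00c01), (1, 0x3300001cc0033c11010303101040), (1,
   0xcc00c33004c311303001304010), (1, 0x30400440014100c3444c0401003), (1,
   0x41031c103010c400104cc0000c1), (1, 0x4400c3100cc31130300310c030), (1,
   0x30c000310014c001413340c00440), (1, 0x3c000140ccc103013001c0300013), (1,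
   0x43004001134310104004c03000c4), (1, 0xc030cc0041004003131c04043001), (1,
   0x33003c000c10c3110404c0040401), (1, 0x3401c014c44040400c04014c00)]

/-- A column of the automorphism. -/
def stabCol (p : Fin 28) : GVec := scaled (stabCols.getD p (0, 0))

/-- `N` is the image of `M` under the linear map with the given columns. -/
def IsImage (M N : GVec) : Prop := ∀ r, 4 * N r = ∑ p, M p * stabCol p r

instance (M N : GVec) : Decidable (IsImage M N) := by unfold IsImage; infer_instance

lemma stabCol_orthogonal : ∀ p q, ipv (stabCol p) (stabCol q) = if p = q then 16 else 0 := by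
  decide +kernel

lemma isImage_gen :
    ∀ k : Fin 28, IsImage (dec (genCode k)) (scaled (stabImages.getD k (0, 0))) := by
  decide +kernel

lemma scaled_mem {c : ℕ × ℕ} (h : (Nat.beq c.1 4 || (Nat.beq c.1 1 && codeMem c.2)) = true) :
    vec (scaled c) ∈ lattice := by
  refine mem_D.1 ?_
  rw [Bool.or_eq_true, Bool.and_eq_true] at h
  rcases h with h | ⟨h, h'⟩
  · refine mem_D_of_four_dvd fun p => ?_
    rw [scaled, Nat.eq_of_beq_eq_true h]
    exact Dvd.intro _ rfl
  · have : scaled c = dec c.2 := by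
      funext p
      rw [scaled, Nat.eq_of_beq_eq_true h, Nat.cast_one, one_mul]
    rw [this]
    exact dec_mem_D h'

lemma exists_stabilizer :
    ∃ t ∈ autLattice, ∀ M N, IsImage M N → t (vec M) = vec N := by
  obtain ⟨t, ht⟩ := exists_isometry stabCol stabCol_orthogonal
  have h1 : ∀ M N, IsImage M N → t (vec M) = vec N := ht
  refine ⟨t, mem_autLattice (fun p => ?_) (fun k => ?_), h1⟩
  · have h2 : IsImage (frame p) (stabCol p) := by
      intro r
      rw [Finset.sum_eq_single p, frame_apply_self]
      · intro q _ hq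
        rw [frame, Pi.single_eq_of_ne hq, zero_mul]
      · simp
    rw [h1 _ _ h2]
    refine scaled_mem ?_
    revert p
    decide +kernel
  · rw [h1 _ _ (isImage_gen k)]
    refine scaled_mem ?_
    revert k
    decide +kernel

/-! ## The orbit of `λ_*` -/

/-- The multiplication with the scalar `i`. -/
def scalarI : Mono :=
  [(0, 1), (1, 1), (2, 1), (3, 1), (4, 1), (5, 1), (6, 1), (7, 1), (8, 1), (9, 1), (10, 1), (11,
   1), (12, 1), (13, 1), (14, 1), (15, 1), (16, 1), (17, 1), (18, 1), (19, 1), (20, 1), (21, 1),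
   (22, 1), (23, 1), (24, 1), (25, 1), (26, 1), (27, 1)]

lemma scalarI_isSym : scalarI.IsSym := Mono.IsSym.of_check (by decide +kernel)

lemma act_scalarI (M : GVec) : act scalarI M = i • M := by
  have h : ∀ p, scalarI.pow p = 1 ∧ scalarI.src p = p := by decide +kernel
  funext p
  rw [act, (h p).1, (h p).2, pow_one]
  rfl

/-- The monomial transformation is induced by an element of `H`. -/
def Mono.InGroup (m : Mono) (H : Subgroup (V ≃ₗᵢ[ℂ] V)) : Prop :=
  ∃ g ∈ H, ∀ M, g (vec M) = vec (act m M)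

/-- The vector is the image of `λ_*` under an element of `H`. -/
def InOrbit (H : Subgroup (V ≃ₗᵢ[ℂ] V)) (M : GVec) : Prop := ∃ g ∈ H, g (vec (frame 4)) = vec M

variable {H : Subgroup (V ≃ₗᵢ[ℂ] V)}

lemma Mono.InGroup.comp {m n : Mono} (hi : m.IsIndex) (hm : m.InGroup H) (hn : n.InGroup H) :
    (m.comp n).InGroup H := by
  obtain ⟨g, hg, hg'⟩ := hm
  obtain ⟨k, hk, hk'⟩ := hn
  exact ⟨g * k, H.mul_mem hg hk, fun M => by
    rw [act_comp hi, ← hg', ← hk']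
    rfl⟩

lemma InOrbit.act {m : Mono} (hm : m.InGroup H) {M : GVec} (hM : InOrbit H M) :
    InOrbit H (act m M) := by
  obtain ⟨g, hg, hg'⟩ := hm
  obtain ⟨k, hk, hk'⟩ := hM
  exact ⟨g * k, H.mul_mem hg hk, by rw [← hg', ← hk']; rfl⟩

lemma InOrbit.of_act {m : Mono} (hm : m.InGroup H) {M : GVec} (hM : InOrbit H (ConwayWales.act m M)) :
    InOrbit H M := by
  obtain ⟨g, hg, hg'⟩ := hm
  obtain ⟨k, hk, hk'⟩ := hM
  refine ⟨g⁻¹ * k, H.mul_mem (H.inv_mem hg) hk, ?_⟩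
  have h : (g⁻¹ * k) (vec (frame 4)) = g⁻¹ (k (vec (frame 4))) := rfl
  rw [h, hk', ← hg']
  exact g.symm_apply_apply _

lemma InOrbit.of_moves {gs : List Mono} (hgs : ∀ g ∈ gs, Mono.InGroup g H) {M N : GVec}
    (h : Moves gs M N) (hN : InOrbit H N) : InOrbit H M := by
  induction gs generalizing M with
  | nil => exact h ▸ hN
  | cons g gs ih =>
    have hgs' : ∀ g ∈ gs, Mono.InGroup g H := fun g hg => hgs g (List.mem_cons_of_mem _ hg)
    rcases h with h | h
    · exact ih hgs' h
    · exact (ih hgs' h).of_act (hgs g (List.mem_cons_self ..))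

lemma InOrbit.of_smul (hi : scalarI.InGroup H) {u : ℕ} {M : GVec} (h : InOrbit H (i ^ u • M)) :
    InOrbit H M := by
  induction u with
  | zero => rwa [pow_zero, one_smul] at h
  | succ u ih =>
    rw [pow_succ', mul_smul, ← act_scalarI] at h
    exact ih (h.of_act hi)

lemma InOrbit.smul (hi : scalarI.InGroup H) (u : ℕ) {M : GVec} (h : InOrbit H M) :
    InOrbit H (i ^ u • M) := by
  induction u with
  | zero => rwa [pow_zero, one_smul]
  | succ u ih =>
    rw [pow_succ', mul_smul, ← act_scalarI]
    exact ih.act hi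

lemma InOrbit.foldr {w : List Mono} (hw : ∀ g ∈ w, Mono.InGroup g H) {M : GVec}
    (hM : InOrbit H M) : InOrbit H (w.foldr ConwayWales.act M) := by
  induction w with
  | nil => exact hM
  | cons g w ih =>
    exact (ih fun g hg => hw g (List.mem_cons_of_mem _ hg)).act (hw g (List.mem_cons_self ..))

/-- The vector encoded by `n` is congruent modulo `4` to a small vector in the orbit. -/
def InOrbitMod (H : Subgroup (V ≃ₗᵢ[ℂ] V)) (n : ℕ) : Prop :=
  ∃ M, InOrbit H M ∧ Small M ∧ ∀ p, 4 ∣ dec n p - M p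

lemma Small.eq_of_dvd {M N : GVec} (hM : Small M) (hN : Small N) (h : ∀ p, 4 ∣ N p - M p) :
    N = M := by
  funext p
  have h1 := hM p
  have h2 := hN p
  obtain ⟨h3, h4⟩ := four_dvd_iff.1 (h p)
  rw [Zsqrtd.re_sub] at h3
  rw [Zsqrtd.im_sub] at h4
  rw [Zsqrtd.norm_def] at h1 h2
  have b1 : (M p).re * (M p).re ≤ 1 := by nlinarith [mul_self_nonneg (M p).im]
  have b2 : (M p).im * (M p).im ≤ 1 := by nlinarith [mul_self_nonneg (M p).re]
  have b3 : (N p).re * (N p).re ≤ 1 := by nlinarith [mul_self_nonneg (N p).im]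
  have b4 : (N p).im * (N p).im ≤ 1 := by nlinarith [mul_self_nonneg (N p).re]
  have c : ∀ x : ℤ, x * x ≤ 1 → -1 ≤ x ∧ x ≤ 1 := fun x hx => ⟨by nlinarith, by nlinarith⟩
  have c1 := c _ b1
  have c2 := c _ b2
  have c3 := c _ b3
  have c4 := c _ b4
  apply Zsqrtd.ext <;> omega

lemma Small.act {M : GVec} (hM : Small M) (m : Mono) : Small (act m M) := fun p => by
  rw [ConwayWales.act, Zsqrtd.norm_mul, norm_i_pow, one_mul]
  exact hM _

lemma images_cons (g : Mono) (gs : List Mono) (l : List ℕ) :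
    images (g :: gs) l = images gs l ++ (images gs l).map (actCode g) :=
  forceL_eq _ _

lemma InOrbitMod.of_mem_images {gs : List Mono} (hgs : ∀ g ∈ gs, Mono.InGroup g H)
    (hi : ∀ g ∈ gs, Mono.IsIndex g) {l : List ℕ} (hl : ∀ n ∈ l, InOrbitMod H n) {n : ℕ}
    (hn : n ∈ images gs l) : InOrbitMod H n := by
  induction gs generalizing n with
  | nil => exact hl n hn
  | cons g gs ih =>
    have hgs' : ∀ g ∈ gs, Mono.InGroup g H := fun g hg => hgs g (List.mem_cons_of_mem _ hg)
    have hi' : ∀ g ∈ gs, Mono.IsIndex g := fun g hg => hi g (List.mem_cons_of_mem _ hg)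
    rw [images_cons, List.mem_append, List.mem_map] at hn
    rcases hn with hn | ⟨n', hn', rfl⟩
    · exact ih hgs' hi' hn
    · obtain ⟨M, hM, hs, hd⟩ := ih hgs' hi' hn'
      refine ⟨ConwayWales.act g M, hM.act (hgs g (List.mem_cons_self ..)), hs.act g, fun p => ?_⟩
      have h1 := dec_actCode (hi g (List.mem_cons_self ..)) n' p
      have h2 := (hd (g.src p)).mul_left (i ^ g.pow p)
      convert dvd_add h1 h2 using 1
      simp only [ConwayWales.act]
      ring

/-! ### Words in the monomial transformations -/

/-- Products that map the coordinate vector `λ_*` to the other coordinate vectors. -/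
def frameWords : List (List Mono) :=
  [[rowShift4, rowShift2], [rowTwist2, rowShift4, rowShift2], [rowTwist5, rowTwist1, rowShift4,
   rowShift2], [rowTwist3, rowTwist1, rowShift4, rowShift2], [], [rowTwist3], [rowTwist6,
   rowTwist2], [rowTwist4, rowTwist2], [rowShift], [rowTwist4, rowShift], [rowTwist3, rowTwist0,
   rowShift], [rowTwist5, rowTwist3, rowShift], [rowShift2], [rowTwist5, rowShift2], [rowTwist4,
   rowTwist1, rowShift2], [rowTwist6, rowTwist4, rowShift2], [rowShift2, rowShift], [rowTwist6,
   rowShift2, rowShift], [rowTwist5, rowTwist2, rowShift2, rowShift], [rowTwist0, rowTwist5,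
   rowShift2, rowShift], [rowShift4], [rowTwist0, rowShift4], [rowTwist6, rowTwist3, rowShift4],
   [rowTwist1, rowTwist6, rowShift4], [rowShift4, rowShift], [rowTwist1, rowShift4, rowShift],
   [rowTwist4, rowTwist0, rowShift4, rowShift], [rowTwist2, rowTwist0, rowShift4, rowShift]]

/-- Products that map the first column of the stabilizing automorphism to the vectors with the codes
in `blockCodes`. -/
def blockWords : List (List Mono) :=
  [[rowTwist2, rowTwist1, rowSign2, rowSign0], [rowTwist1, rowSign2, scalarI], [rowTwist4,
   rowTwist2, rowTwist1, rowSign2], [rowTwist0, rowTwist6, rowSign2], [rowTwist6, rowTwist2,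
   rowTwist1], [rowTwist1, rowTwist6, scalarI], [rowTwist2, rowTwist0, rowSign3, scalarI],
   [rowTwist0, rowSign0], [rowTwist5, rowTwist6, rowTwist2, rowSign2], [rowTwist6, rowSign2],
   [rowTwist2, rowTwist1, rowTwist0], [rowTwist0, rowTwist1, scalarI], [rowTwist2, rowSign3,
   rowSign2, scalarI], [rowSign2, rowSign0], [rowTwist3, rowTwist2, scalarI], [rowTwist4,
   rowSign3]]

/-- Products that map a vector to the vectors with the codes in `mixedCodes`. -/
def mixedWords : List (List Mono) :=
  [[rowTwist5, rowTwist0, scalarI, scalarI, scalarI, rowShift2], [rowTwist5, rowTwist1, rowTwist0,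
   rowSign1, scalarI, rowShift2]]

/-- The code of the image of the shifted first column under the stabilizing automorphism. -/
def mixedCode : ℕ := 0x3304030330000340c10c1134040

/-- The vector `λ₁`. -/
def lambdaOne : GVec := i • dec (genCode 27)

lemma frameWords_eq :
    ∀ p : Fin 28, (frameWords.getD p []).foldr act (frame 4) = frame p := by
  decide +kernel

lemma blockWords_eq : (blockWords.map fun w => w.foldr act (stabCol 0)) = blockCodes.map dec := by
  decide +kernel

lemma mixedWords_eq : (mixedWords.map fun w => w.foldr act (dec mixedCode)) = mixedCodes.map dec := by
  decide +kernel

lemma isImage_mixed : IsImage (act rowShift (stabCol 0)) (dec mixedCode) := by decide +kernel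


end

section
/-- A subgroup of the automorphism group of the lattice which contains all elements with certain
values on `λ_*`. -/
structure ContainsFibers (H : Subgroup (V ≃ₗᵢ[ℂ] V)) : Prop where
  le : H ≤ autLattice
  fixed : ∀ g ∈ autLattice, g (vec (frame 4)) = vec (frame 4) → g ∈ H
  neg : ∀ g ∈ autLattice, g (vec (frame 4)) = vec (-frame 4) → g ∈ H
  one : ∀ g ∈ autLattice, g (vec (frame 4)) = vec lambdaOne → g ∈ H

section
variable {H : Subgroup (V ≃ₗᵢ[ℂ] V)}

lemma InOrbit.map {g : V ≃ₗᵢ[ℂ] V} (hg : g ∈ H) {M N : GVec} (h : g (vec M) = vec N)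
    (hM : InOrbit H M) : InOrbit H N := by
  obtain ⟨k, hk, hk'⟩ := hM
  exact ⟨g * k, H.mul_mem hg hk, by rw [← h, ← hk']; rfl⟩

lemma InOrbit.of_map {g : V ≃ₗᵢ[ℂ] V} (hg : g ∈ H) {M N : GVec} (h : g (vec M) = vec N)
    (hN : InOrbit H N) : InOrbit H M := by
  refine hN.map (H.inv_mem hg) ?_
  rw [← h]
  exact g.symm_apply_apply _

lemma inOrbit_frame : InOrbit H (frame 4) := ⟨1, H.one_mem, rfl⟩

lemma ContainsFibers.inGroup (hH : ContainsFibers H) {m : Mono} (hm : m.IsSym)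
    (h : InOrbit H (act m (frame 4))) : m.InGroup H := by
  obtain ⟨a, ha, ha'⟩ := hm.exists_aut
  obtain ⟨g, hg, hg'⟩ := h
  refine ⟨a, ?_, ha'⟩
  have h1 : g⁻¹ * a ∈ H := by
    refine hH.fixed _ (autLattice.mul_mem (autLattice.inv_mem (hH.le hg)) ha) ?_
    have h2 : (g⁻¹ * a) (vec (frame 4)) = g⁻¹ (a (vec (frame 4))) := rfl
    rw [h2, ha', ← hg']
    exact g.symm_apply_apply _
  have h2 := H.mul_mem hg h1
  rwa [mul_inv_cancel_left] at h2

lemma ContainsFibers.inGroup_of_fixed (hH : ContainsFibers H) {m : Mono} (hm : m.IsSym)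
    (h : act m (frame 4) = frame 4) : m.InGroup H :=
  hH.inGroup hm (by rw [h]; exact inOrbit_frame)

lemma ContainsFibers.inGroup_of_neg (hH : ContainsFibers H) {m : Mono} (hm : m.IsSym)
    (h : act m (frame 4) = -frame 4) : m.InGroup H := by
  obtain ⟨a, ha, ha'⟩ := hm.exists_aut
  exact ⟨a, hH.neg a ha (h ▸ ha' (frame 4)), ha'⟩

/-- An automorphism that maps `λ_*` to `λ₁`, and another vector whose image is known. -/
lemma exists_apply_eq_lambdaOne : ∃ w ∈ autLattice, w (vec (frame 4)) = vec lambdaOne ∧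
    w (vec (i ^ 3 • frame 9)) = vec (act rowSign2 (-lambdaOne)) := by
  obtain ⟨t, ht, ht'⟩ := exists_stabilizer
  obtain ⟨r, hr, hr'⟩ := rowShift_isSym.exists_aut
  obtain ⟨a, ha, ha'⟩ := rowTwist2_isSym.exists_aut
  obtain ⟨b, hb, hb'⟩ := rowTwist6_isSym.exists_aut
  have h : ∀ F A X, IsImage (act rowShift (act rowTwist2 F)) A →
      IsImage X (act rowShift (act rowShift A)) →
      (r * b * t⁻¹ * r * r * t * r * a) (vec F) = vec (act rowShift (act rowTwist6 X)) := by
    intro F A X h1 h2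
    have h3 : (r * b * t⁻¹ * r * r * t * r * a) (vec F) =
        r (b (t.symm (r (r (t (r (a (vec F)))))))) := rfl
    rw [h3, ha', hr', ht' _ _ h1, hr', hr', ← ht' _ _ h2, t.symm_apply_apply, hb', hr']
  have hm : r * b * t⁻¹ * r * r * t * r * a ∈ autLattice :=
    autLattice.mul_mem (autLattice.mul_mem (autLattice.mul_mem (autLattice.mul_mem
      (autLattice.mul_mem (autLattice.mul_mem (autLattice.mul_mem hr hb)
        (autLattice.inv_mem ht)) hr) hr) ht) hr) ha
  refine ⟨_, hm, ?_, ?_⟩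
  · rw [h (frame 4) (dec 0xc44cc13c13440000c141) (dec 0x3c4c040c0cc030c000cc3400100c)
      (by decide +kernel) (by decide +kernel)]
    exact congrArg vec (by decide +kernel)
  · rw [h (i ^ 3 • frame 9) (dec 0x4444c334314400004143) (dec 0x14c4040c0cc030c0004434003004)
      (by decide +kernel) (by decide +kernel)]
    exact congrArg vec (by decide +kernel)

lemma vec_neg (M : GVec) : vec (-M) = -vec M := map_neg vecL M

lemma ContainsFibers.rowShift_inGroup (hH : ContainsFibers H) : rowShift.InGroup H := by
  obtain ⟨w, hw, h1, h2⟩ := exists_apply_eq_lambdaOne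
  have hw' := hH.one w hw h1
  have hs1 := hH.inGroup_of_neg rowSign1_isSym (by decide +kernel)
  have hs2 := hH.inGroup_of_fixed rowSign2_isSym (by decide +kernel)
  have ht := hH.inGroup_of_neg rowTwist5_isSym (by decide +kernel)
  refine hH.inGroup rowShift_isSym ?_
  have h3 : InOrbit H (-frame 4) := by
    have h := (inOrbit_frame (H := H)).act hs1
    rwa [show act rowSign1 (frame 4) = -frame 4 by decide +kernel] at h
  have h4 : InOrbit H (-lambdaOne) := h3.map hw' (by rw [vec_neg, map_neg, h1, vec_neg])
  have h5 := ((h4.act hs2).of_map hw' h2).act ht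
  rwa [show act rowTwist5 (i ^ 3 • frame 9) = act rowShift (frame 4) by decide +kernel] at h5

/-- The monomial transformations used in the classification of the sacred vectors. -/
structure ContainsMonos (H : Subgroup (V ≃ₗᵢ[ℂ] V)) : Prop where
  shift : ∀ g ∈ shiftMoves, Mono.InGroup g H
  twist : ∀ g ∈ [rowTwist0, rowTwist1, rowTwist2, rowTwist3, rowTwist4, rowTwist5, rowTwist6],
    Mono.InGroup g H
  sign : ∀ g ∈ [rowSign0, rowSign1, rowSign2, rowSign3], Mono.InGroup g H
  scalar : scalarI.InGroup H

lemma ContainsFibers.monos (hH : ContainsFibers H) : ContainsMonos H := by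
  have h1 := hH.rowShift_inGroup
  have e2 : rowShift2 = rowShift.comp rowShift := by decide +kernel
  have e4 : rowShift4 = rowShift2.comp rowShift2 := by decide +kernel
  have h2 : rowShift2.InGroup H := e2 ▸ h1.comp rowShift_isSym.index h1
  have h4 : rowShift4.InGroup H := e4 ▸ h2.comp rowShift2_isSym.index h2
  have h6 : (rowShift4.comp rowShift2).InGroup H := h4.comp rowShift4_isSym.index h2
  have ht : ∀ {m : Mono}, m.IsSym → m.InGroup H →
      ((rowShift.comp m).comp (rowShift4.comp rowShift2)).InGroup H := fun {m} hs hm =>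
    Mono.InGroup.comp (rowShift_isSym.comp hs).index (h1.comp rowShift_isSym.index hm) h6
  have t0 := hH.inGroup_of_neg rowTwist0_isSym (by decide +kernel)
  have t1 := rowTwist1_eq ▸ ht rowTwist0_isSym t0
  have t2 := rowTwist2_eq ▸ ht rowTwist1_isSym t1
  have t3 := rowTwist3_eq ▸ ht rowTwist2_isSym t2
  have t4 := rowTwist4_eq ▸ ht rowTwist3_isSym t3
  have t5 := rowTwist5_eq ▸ ht rowTwist4_isSym t4
  have t6 := rowTwist6_eq ▸ ht rowTwist5_isSym t5
  have s0 := hH.inGroup_of_fixed rowSign0_isSym (by decide +kernel)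
  have s1 := hH.inGroup_of_neg rowSign1_isSym (by decide +kernel)
  have s2 := hH.inGroup_of_fixed rowSign2_isSym (by decide +kernel)
  have s3 := hH.inGroup_of_fixed rowSign3_isSym (by decide +kernel)
  refine ⟨?_, ?_, ?_, ?_⟩
  · simp only [shiftMoves, List.forall_mem_cons]
    exact ⟨h1, h2, h4, by simp⟩
  · simp only [List.forall_mem_cons]
    exact ⟨t0, t1, t2, t3, t4, t5, t6, by simp⟩
  · simp only [List.forall_mem_cons]
    exact ⟨s0, s1, s2, s3, by simp⟩
  · refine hH.inGroup scalarI_isSym ?_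
    have h := ((inOrbit_frame (H := H)).act s1).act t6
    rwa [show act rowTwist6 (act rowSign1 (frame 4)) = act scalarI (frame 4) by decide +kernel] at h

lemma signMoves_isIndex : (∀ g ∈ [rowSign1, rowSign2, rowSign3], Mono.IsIndex g) ∧
    ∀ g ∈ [rowSign2, rowSign3], Mono.IsIndex g := by
  simp only [List.forall_mem_cons]
  exact ⟨⟨rowSign1_isSym.index, rowSign2_isSym.index, rowSign3_isSym.index, by simp⟩,
    rowSign2_isSym.index, rowSign3_isSym.index, by simp⟩

/-- The orbit of `λ_*` under such a subgroup consists of all sacred vectors. -/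
theorem ContainsFibers.inOrbit (hH : ContainsFibers H) {M : GVec} (hM : IsSacred M) :
    InOrbit H M := by
  have h := hH.monos
  obtain ⟨t, ht, ht'⟩ := exists_stabilizer
  have htH : t ∈ H := hH.fixed t ht (ht' _ _ (by decide +kernel))
  have hall : ∀ g ∈ shiftMoves ++
      [rowTwist0, rowTwist1, rowTwist2, rowTwist3, rowTwist4, rowTwist5, rowTwist6] ++
      [rowSign0, rowSign1, rowSign2, rowSign3] ++ [scalarI], Mono.InGroup g H := by
    simp only [List.forall_mem_append]
    exact ⟨⟨⟨h.shift, h.twist⟩, h.sign⟩, by simpa using h.scalar⟩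
  have hframe : ∀ p, InOrbit H (frame p) := fun p => by
    rw [← frameWords_eq p]
    refine inOrbit_frame.foldr fun g hg => hall g ?_
    revert g hg
    revert p
    decide +kernel
  have hcol : InOrbit H (stabCol 0) := (hframe 0).map htH (ht' _ _ (by decide +kernel))
  have hblock : ∀ n ∈ blockCodes, InOrbitMod H n := by
    intro n hn
    refine ⟨dec n, ?_, ?_, fun p => by simp⟩
    · have h1 := List.mem_map_of_mem (f := dec) hn
      rw [← blockWords_eq, List.mem_map] at h1
      obtain ⟨w, hw, hw'⟩ := h1
      rw [← hw']
      refine hcol.foldr fun g hg => hall g ?_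
      clear hw'
      revert w g
      decide +kernel
    · revert n hn
      unfold Small
      decide +kernel
  have hmixed : ∀ n ∈ mixedCodes, InOrbitMod H n := by
    intro n hn
    refine ⟨dec n, ?_, ?_, fun p => by simp⟩
    · have h1 := List.mem_map_of_mem (f := dec) hn
      rw [← mixedWords_eq, List.mem_map] at h1
      obtain ⟨w, hw, hw'⟩ := h1
      rw [← hw']
      have h2 : InOrbit H (dec mixedCode) :=
        (hcol.act (hall _ (by simp [shiftMoves]))).map htH (ht' _ _ isImage_mixed)
      refine h2.foldr fun g hg => hall g ?_
      clear hw'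
      revert w g
      decide +kernel
    · revert n hn
      unfold Small
      decide +kernel
  rcases sacred_cases hM with ⟨u, p, rfl⟩ | ⟨u, N, h1, h2, n, h3, rfl⟩ | ⟨u, N, h1, h2, n, h3, rfl⟩
  · exact (hframe p).smul h.scalar u
  · obtain ⟨N, h4, h5, h6⟩ := InOrbitMod.of_mem_images (H := H) (fun g hg => h.sign g (by
      revert g; simp)) signMoves_isIndex.1 hmixed h3
    rw [h5.eq_of_dvd h2 h6] at h1
    refine (InOrbit.of_moves (fun g hg => hall g ?_) h1 h4).of_smul h.scalar
    revert g
    decide +kernel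
  · obtain ⟨N, h4, h5, h6⟩ := InOrbitMod.of_mem_images (H := H) (fun g hg => h.sign g (by
      revert g; simp)) signMoves_isIndex.2 hblock h3
    rw [h5.eq_of_dvd h2 h6] at h1
    refine (InOrbit.of_moves (fun g hg => hall g ?_) h1 h4).of_smul h.scalar
    revert g
    decide +kernel

end

end

/-! ## The right partner of `B_*` -/

/-- The vectors of `B_*`. -/
def betaVec (k : Fin 13) : GVec := flat (betaArr k)

/-- The vectors of `C_*`. -/
def gammaVec (k : Fin 13) : GVec := flat (gammaArr k)

/-- The products of the vectors of `B_*` and `C_*`. -/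
def partnerInt : Fin 13 → GaussianInt := ![-i, -i, 0, 0, i, -i, 0, 0, 0, 0, -i, i, 0]

lemma ipv_beta_gamma : ∀ j k, ipv (betaVec j) (gammaVec k) = 4 * partnerInt (j + k) := by
  decide +kernel

lemma frame_ne_gamma : ∀ p s, ∃ k, (betaVec k p).norm ≠ (partnerInt (k + s)).norm := by
  decide +kernel

/-! ### Inverse transformations -/

/-- The inverse of a monomial transformation. -/
def Mono.inv (m : Mono) : Mono := (List.range 28).map fun q =>
  let p := m.findIdx fun x => Nat.beq x.1 q
  (p, (4 - (m.getD p (0, 0)).2) % 4)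

instance (m : Mono) : Decidable m.IsIndex := by unfold Mono.IsIndex; infer_instance

/-- Checks that `m.inv` is the inverse of `m`. -/
def Mono.invCheck (m : Mono) : Bool :=
  decide (m.inv.IsIndex ∧ m.inv.comp m = (List.range 28).map fun p => (p, 0))

lemma act_inv {m : Mono} (h : m.invCheck = true) (M : GVec) : act m.inv (act m M) = M := by
  obtain ⟨h1, h2⟩ := of_decide_eq_true h
  rw [← act_comp h1, h2]
  have h3 : ∀ p : Fin 28, Mono.src ((List.range 28).map fun p => (p, 0)) p = p ∧
      Mono.pow ((List.range 28).map fun p => (p, 0)) p = 0 := by decide +kernel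
  funext p
  rw [act, (h3 p).1, (h3 p).2, pow_zero, one_mul]

/-- Evaluates the entries of a monomial transformation before it is substituted into `k`. -/
def forceMono {α : Type} (m : Mono) (k : Mono → α) : α :=
  List.rec (motive := fun _ => (Mono → α) → α) (fun k => k [])
    (fun x _ ih k => force x.1 fun a => force x.2 fun b => ih fun m' => k ((a, b) :: m')) m k

lemma forceMono_eq {α : Type} (m : Mono) (k : Mono → α) : forceMono m k = k m := by
  induction m generalizing k with
  | nil => rfl
  | cons x m ih =>
    have h : forceMono (x :: m) k =
      force x.1 fun a => force x.2 fun b => forceMono m fun m' => k ((a, b) :: m') := rfl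
    rw [h, force_eq, force_eq, ih]

/-- The codes of the vectors that can be moved to vectors with given codes. -/
def preimages (gs : List Mono) (l : List ℕ) : List ℕ :=
  List.rec l (fun g _ ih => forceMono g.inv fun g' => forceL ih fun ws =>
    ws ++ ws.map (actCode g')) gs

lemma preimages_cons (g : Mono) (gs : List Mono) (l : List ℕ) : preimages (g :: gs) l =
    preimages gs l ++ (preimages gs l).map (actCode g.inv) := by
  have h : preimages (g :: gs) l = forceMono g.inv fun g' => forceL (preimages gs l) fun ws =>
    ws ++ ws.map (actCode g') := rfl
  rw [h, forceMono_eq, forceL_eq]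

lemma Moves.exists_preimage {gs : List Mono} (hgs : ∀ g ∈ gs, Mono.invCheck g = true)
    {l : List ℕ} {M N : GVec} (h : Moves gs M N) {n : ℕ} (hn : n ∈ l) (hN : N = dec n) :
    ∃ n' ∈ preimages gs l, ∀ p, 4 ∣ dec n' p - M p := by
  induction gs generalizing M with
  | nil =>
    have h1 : M = N := h
    exact ⟨n, hn, fun p => by rw [h1, hN, sub_self]; exact dvd_zero _⟩
  | cons g gs ih =>
    have hgs' : ∀ g ∈ gs, Mono.invCheck g = true := fun g hg => hgs g (List.mem_cons_of_mem _ hg)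
    have hg := hgs g (List.mem_cons_self ..)
    rw [preimages_cons]
    rcases h with h | h
    · obtain ⟨n', h1, h2⟩ := ih hgs' h
      exact ⟨n', List.mem_append_left _ h1, h2⟩
    · obtain ⟨n', h1, h2⟩ := ih hgs' h
      refine ⟨_, List.mem_append_right _ (List.mem_map_of_mem h1), fun p => ?_⟩
      have h3 := dec_actCode (of_decide_eq_true hg).1 n' p
      have h4 := (h2 (g.inv.src p)).mul_left (i ^ g.inv.pow p)
      have h5 := congrFun (act_inv hg M) p
      rw [← h5]
      convert dvd_add h3 h4 using 1
      simp only [act]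
      ring

lemma mixedMoves_inv : ∀ g ∈ mixedMoves, Mono.invCheck g = true := by decide +kernel

lemma shiftMoves_inv : ∀ g ∈ shiftMoves, Mono.invCheck g = true := by decide +kernel

/-! ### A hash function -/

/-- The coefficients of a linear combination of the vectors of `B_*`. -/
def hashCoeff : Fin 13 → GaussianInt :=
  ![⟨668835601, 274281998⟩, ⟨796487718, 384974575⟩, ⟨853832589, 741361655⟩, ⟨1011948282,
   903565516⟩, ⟨794460042, 700113703⟩, ⟨990338920, 569125961⟩, ⟨31144123, 902316927⟩, ⟨499958518,
   833179165⟩, ⟨1012921565, 267418253⟩, ⟨696831125, 55677006⟩, ⟨967334542, 168417827⟩, ⟨121553981,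
   399210079⟩, ⟨503659048, 932486208⟩]

/-- A linear combination of the vectors of `B_*`. -/
def hashVec : GVec := fun p => ∑ k, hashCoeff k * betaVec k p

/-- Tables of the products of the entries of `hashVec` with small Gaussian integers, modulo
`2 ^ 32`. -/
def hashRows : List ℕ :=
  [0x231f25eedb15daff9dc39ea46071624901caff13b9c1b4247c6f77c93f1d3b6e623c615c1a33166ddce0da129f8e9db7c2adc3a57aa478b63d523c5b00000000,
   0x40225fe2ecead2bab352ac7279ba862ad2f2cd647fbb403c462319f40c8af3ac4cad538ef975c666bfdda01e864579d6c667d9b873304c903998264800000000,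
   0xd46d4f6a7f5fc639f10ef3f462be21afac32ea5d5725612cc8d48ee73a83bca20ef10c0cb9e382db2b92b0969d41de5171af2dbb1ca1a48a8e50d24500000000,
   0x36a04b205ea3f5d7514d679a43f6d95d6abbbf0992bf69c08568db8378124d46aeb29866d6b6431dc95fb4e0bc0926a3f2a971c31aad1c7a0d568e3d00000000,
   0x0,
   0x7660d0fbe51b62741587dca145f456cea483cc91133e5e0a43aad83774175264ea78235f5932b4d8899f2f05ba0ba932306c7a2d9f270ba6cf9385d300000000,
   0x4da6999baf8ad5d08ee96c696e48030202ce909564b2ccca44116363236ff9fc71169397d2facfccb259666591b7fcfedf5e96994142d2ce20a1696700000000,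
   0xa1cab66e2875e91f50e782e479591ca935bf6073bc6a9324e4dc2ce90d4dc6aeaf187d1c35c3afcd5e35499286a6e357287199c5af1ccc76d78e663b00000000,
   0x220784240f63c229c04502d27126437bce94b9b3bbf0f7b86cd238611db3790a3fbafd2e2d173b33ddf87bdc8ed9bc85b0e140a99e3d7eae4f1ebf5700000000,
   0xaf3ba3e8dd0fd092cdc91704be825d7673b48b86a188b8309241fea282fb45143236e8fc600b15a650c45c18417da28af0b946721e8d731c0f46b98e00000000,
   0xed8107d5097406c9aacdb1cd4c275cd1090af16224fdf056c6579b5a67b1465e55324e3371254d27127ef82bb3d8a32fa159ab04bd4ca9f85ea654fc00000000,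
   0x3a68e4f9123de51bca4c3a65825a8fafb35935ec8b2e360e433c8b58fb4ae0a235b3c59b0d88c5bdc5971b077da57051b80e554a8fe3556c47f1aab600000000,
   0xfc41c01ce450a2e341a101f69ef161091f6d9d01077c7fc864ccdedbc21d3deebe5efe0aa66de0d103be3fe4610e9ef75d505f13455f41daa2afa0ed00000000,
   0xc4d6db489167b00bf7e213ca5e5c7789a9c174ad76524970dcccad2f434710ee081dec36d4aec0f93b2924b8a1a38877667a63bf330b388299859c4100000000,
   0xe1c8653f51cf79e781cd1dafb1cac177cc6820da3c6f35826c6cd94a9c6a7d127e32e251ee39f6f91e379ac14e353e892ffda3c8a004b870d0025c3800000000,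
   0x8f5a74879d3b9bcb989b395f93fad6f3d369efaee14b16f2dcaab486d80a521a6764c6a17545ede570a58b796c05290dfb5f9d940940c4d804a0626c00000000,
   0x539e1544f27bf59168320022dde80ab3b9e5f52b58c3d578ce79e009442fea9a97cdffde36abe02bac61eabc2217f54d75b60a911493eade8a49f56f00000000,
   0xcd669aef1d39909fad48940f3d57977f155fd4726532ca22f541cd928550d10252b76bf1a28a61a132996511c2a86881900f0370dfe1f9206ff0fc9000000000,
   0x8169689ca261a8bb97643e068c66d351dc34eea9fd2d2ec8f22fc413e732595e689bc1fa899402197e96976473992caff502954b15fad56a0afd6ab500000000,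
   0xba8352e55d96239cd1e5335f46344322e7e6897f8af95a36ff4869f9739779bc2e1acca1d12d9d58457cad1bb9cbbcde744f0fc31761e07a8bb0f03d00000000,
   0xea8ca9d65b4de89235b828fe1022696aba256d982ae6ac540550ecc0dfbb2d2cca47d7023b0915be1573562aefdd9696da6a406c4b2b7f282595bf9400000000,
   0xf2f73e7125f98b8dbfa371d9594d5825e70f36021a11831eb3bb696a4d654fb6405c8e27735edb430d08c18fa6b2a7db99a9e64cccac3368665619b400000000,
   0xb7ebaac562913d7e29af61ebf0cd8658e58317bd9028aa765746cee31e64f350d6509e1580f630ce4814553b0f3279a8c71e246d71c3b72638e1db9300000000,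
   0x4c30b6c2ea153f3cb573bc6680d2399cc9ba0a1f679e928932fd0fb2fe5b8ce34a8c43a5e870cc1fb3cf49497f2dc679cb5e7d3c694305a634a182d00000000,
   0xcf500b0473125c3591d1967ab090d0bfbd9d98c7615fe9f8801f243d9ede5e826e2e698611f0bab730aff4fc4f6f2f411ebf3a45c2818b76e140c5bb00000000,
   0xd8273d9f11e85b92fea7fc41eb679cf015f066cf4fb184c23c7125712930c620015803bf3b1921b227d8c26114986310ecbfa0af2680bea213405f5100000000,
   0x995796cc2df2b2f7a714543e2035f58538b5b63dcd50d268467273afbf9414f658ebabc2ed86c7ed66a86934dfca0a7b7921a1470dbcbd7286de5eb900000000,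
   0xa941ab65148ab33cf0c7b09fcd04ae024233a15fad7ca93689b9a69965f6a3fc0f384f617a81573856be549b32fb51fedc3cfd634786053a23c3029d00000000]

/-- Up to a multiple of `2 ^ 32`, the real part of the product of `hashVec` and a small vector. -/
def hash (rows : List ℕ) (n : ℕ) : ℕ :=
  List.rec (motive := fun _ => ℕ → ℕ) (fun _ => 0)
    (fun row _ ih n => Nat.add (Nat.shiftRight row (Nat.mul 32 (Nat.land n 15)))
      (force (Nat.shiftRight n 4) ih)) rows n

lemma hash_cons (row : ℕ) (rows : List ℕ) (n : ℕ) :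
    hash (row :: rows) n = row >>> (32 * (n &&& 15)) + hash rows (n >>> 4) := by
  have h : hash (row :: rows) n = Nat.add (Nat.shiftRight row (Nat.mul 32 (Nat.land n 15)))
      (force (Nat.shiftRight n 4) (hash rows)) := rfl
  rw [h, force_eq]
  rfl

lemma hash_eq_sum (rows : List ℕ) (n : ℕ) : hash rows n =
    ∑ j : Fin rows.length, rows[(j : ℕ)] >>> (32 * (n >>> (4 * (j : ℕ)) &&& 15)) := by
  induction rows generalizing n with
  | nil => rfl
  | cons row rows ih =>
    rw [hash_cons, ih]
    refine Eq.trans ?_ (Fin.sum_univ_succ (n := rows.length) _).symm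
    congr 1
    refine Finset.sum_congr rfl fun j _ => ?_
    simp only [Fin.val_succ, List.getElem_cons_succ]
    rw [← Nat.shiftRight_add, show 4 + 4 * (j : ℕ) = 4 * (j + 1) by ring]

lemma hashRows_length : hashRows.length = 28 := by decide +kernel

lemma hashRows_ok : ∀ (p : Fin 28) (d : Fin 16),
    ((hashRows.getD p 0 >>> (32 * (d : ℕ)) : ℕ) : ℤ) % 2 ^ 32 =
      (hashVec p * star (decNib d)).re % 2 ^ 32 := by
  decide +kernel

lemma hash_congr (n : ℕ) :
    (hash hashRows n : ℤ) ≡ (ipv hashVec (dec n)).re [ZMOD 2 ^ 32] := by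
  rw [hash_eq_sum, ipv, sum_re, Nat.cast_sum, ← (finCongr hashRows_length).sum_comp]
  refine Int.ModEq.sum fun j _ => ?_
  have h1 : n >>> (4 * (j : ℕ)) &&& 15 < 16 := by rw [and_fifteen]; omega
  have h2 := hashRows_ok (finCongr hashRows_length j) ⟨_, h1⟩
  have h3 : decNib (n >>> (4 * (j : ℕ)) &&& 15) = dec n (finCongr hashRows_length j) := by
    rw [and_fifteen, decNib_mod, Nat.shiftRight_eq_div_pow, pow_mul]
    rfl
  rw [h3] at h2
  have h4 : hashRows.getD (finCongr hashRows_length j : Fin 28) 0 = hashRows[(j : ℕ)] :=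
    (List.getElem_eq_getD 0).symm
  rw [h4] at h2
  exact h2

/-- The codes of the associates of the vectors of `C_*`, with their hash values. -/
def targets : List (ℕ × ℕ) :=
  [(0x46ec878c, 0x1c0010044c410303c00430401100), (0xaa49ea68, 0x4100400331340c0c1003c0304400),
   (0xb9137874, 0x3400300cc4c30101400c10c03300), (0x55b61598, 0xc300c001131c040430014010cc00),
   (0xd4546b50, 0x410c131101010030304130000c3), (0x5ccd40c0, 0x34014c44040400c0c034c00001c),
   (0x2bab94b0, 0xc30431330303001010c31000041), (0xa332bf40, 0x1c03c4cc0c0c0040401c4000034),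
   (0x96a816cc, 0x4c003c001004c3c43010013030c0), (0xf9e0c798, 0x3100c10040031c13c04004c0c010),
   (0x6957e934, 0xc4001400300c414c103003101040), (0x61f3868, 0x13004300c001343140c00c404030),
   (0x6330b468, 0x1004414c1030013030c04c001400), (0x69043ed4, 0x4003343140c004c0c01031004300),
   (0x9ccf4b98, 0x300cc3c4301003101040c4003c00), (0x96fbc12c, 0xc0011c13c0400c4040301300c100),
   (0x604da2d0, 0xcc001c000140c333040c03104010), (0xc492480c, 0x1100410004301ccc03010c403040),
   (0x9fb25d30, 0x4400340003c041110c040130c030), (0x3b6db7f4, 0x3300c3000c103444010304c010c0),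
   (0x60aa35cc, 0x4040c0040c03c4000034034014c4), (0x5c4acbe0, 0x30301003010c130000c30c304313),
   (0x9f55ca34, 0xc0c0400c04014c00001c01c03c4c), (0xa3b53420, 0x101030010304310000410410c131),
   (0xa4c695a4, 0x1c40011c44c0c00c4010c00033), (0x6ae6c880, 0x413004413310100130401000cc),
   (0x5b396a5c, 0x34c00334cc404004c030400011), (0x95193780, 0xc3100cc31130300310c0300044),
   (0x54e6df4, 0xc40043100434cc30100330c010), (0x172bfcc0, 0x13003c4003c311c0400cc01040),
   (0xfab1920c, 0x4c00c1300c1c44103001104030), (0xe8d40340, 0x310014c001413340c0044030c0),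
   (0x5306c320, 0xc3011411030300310c044004100), (0xf1aa0544, 0x1c0443440c0c00c401033003400),
   (0xacf93ce0, 0x41033c3301010013040cc00c300), (0xe55fabc, 0x340cc1cc0404004c03011001c00),
   (0xa72870a4, 0x14c001c1440303033030401300), (0xaf8132f4, 0x43100414330c0c0cc0c0304c00),
   (0x58d78f5c, 0x3c400343cc0101011010c03100), (0x507ecd0c, 0xc1300c3c11040404404010c400),
   (0xdd115e08, 0x403000cc1c0003c04344101004c0), (0xf57412a8, 0x30c0001141000c103c3340400310),
   (0x22eea1f8, 0xc010004434000140c1cc30300c40), (0xa8bed58, 0x10400033c30004301411c0c00130),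
   (0x14a0264c, 0x4c000043100414330c0c0cc0c030), (0xfac5309c, 0x3100003c400343cc0101011010c0),
   (0xeb5fd9b4, 0xc40000c1300c3c11040404404010), (0x53acf64, 0x13000014c001c144030303303040),
   (0xdcd5e0ec, 0x10300c4001043100c30003c0441c), (0xb652e394, 0x40c001300403c4001c000c103341),
   (0x232a1f14, 0x301004c0030c130041000140cc34), (0x49ad1c6c, 0xc04003100c014c003400043011c3)]

lemma targets_ok : ∀ (s : Fin 13) (u : Fin 4), ∃ t ∈ targets,
    dec t.2 = i ^ (u : ℕ) • gammaVec s ∧ t.1 = hash hashRows t.2 % 2 ^ 32 := by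
  have h : ∀ (s : Fin 13) (u : Fin 4), targets.getD (4 * s + u) (0, 0) ∈ targets ∧
      dec (targets.getD (4 * s + u) (0, 0)).2 = i ^ (u : ℕ) • gammaVec s ∧
      (targets.getD (4 * s + u) (0, 0)).1 =
        hash hashRows (targets.getD (4 * s + u) (0, 0)).2 % 2 ^ 32 := by
    decide +kernel
  exact fun s u => ⟨_, h s u⟩

/-- Checks that only the given codes have the given hash values. -/
def hashCheck (l : List ℕ) : Bool := l.all fun n =>
  force (Nat.mod (hash hashRows n) 4294967296) fun v =>
    targets.all fun t => !(Nat.beq t.1 v) || Nat.beq t.2 n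


lemma hashCheck_mixed : (forceL (images [rowSign1, rowSign2, rowSign3] mixedCodes) fun l =>
    forceL (preimages mixedMoves l) hashCheck) = true := by
  decide +kernel

lemma hashCheck_block : (forceL (images [rowSign2, rowSign3] blockCodes) fun l =>
    forceL (preimages shiftMoves l) hashCheck) = true := by
  decide +kernel

lemma Small.dec_eq {M : GVec} (hM : Small M) {n : ℕ} (h : ∀ p, 4 ∣ dec n p - M p) : dec n = M := by
  funext p
  have h1 := hM p
  obtain ⟨h3, h4⟩ := four_dvd_iff.1 (h p)
  rw [Zsqrtd.re_sub] at h3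
  rw [Zsqrtd.im_sub] at h4
  rw [Zsqrtd.norm_def] at h1
  have b1 : (M p).re * (M p).re ≤ 1 := by nlinarith [mul_self_nonneg (M p).im]
  have b2 : (M p).im * (M p).im ≤ 1 := by nlinarith [mul_self_nonneg (M p).re]
  have c : ∀ x : ℤ, x * x ≤ 1 → -1 ≤ x ∧ x ≤ 1 := fun x hx => ⟨by nlinarith, by nlinarith⟩
  have c1 := c _ b1
  have c2 := c _ b2
  have e1 : -1 ≤ (dec n p).re ∧ (dec n p).re ≤ 2 := by
    simp only [dec, decNib]
    split <;> omega
  have e2 : -1 ≤ (dec n p).im ∧ (dec n p).im ≤ 2 := by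
    simp only [dec, decNib]
    split <;> omega
  apply Zsqrtd.ext <;> omega

lemma Moves.small {gs : List Mono} (hgs : ∀ g ∈ gs, Mono.invCheck g = true) {M N : GVec}
    (h : Moves gs M N) (hN : Small N) : Small M := by
  induction gs generalizing M with
  | nil => exact h ▸ hN
  | cons g gs ih =>
    have hgs' : ∀ g ∈ gs, Mono.invCheck g = true := fun g hg => hgs g (List.mem_cons_of_mem _ hg)
    rcases h with h | h
    · exact ih hgs' h
    · have h1 := (ih hgs' h).act g.inv
      rwa [act_inv (hgs g (List.mem_cons_self ..))] at h1

lemma i_smul_cancel {u : ℕ} {M N : GVec} (h : i ^ u • M = i ^ u • N) : M = N := by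
  funext p
  exact (isUnit_i_pow u).mul_left_cancel (congrFun h p)

lemma eq_gamma_of_moves {gs : List Mono} (hgs : ∀ g ∈ gs, Mono.invCheck g = true) {l : List ℕ}
    (hc : hashCheck (preimages gs l) = true) {u : ℕ} {M N : GVec} (hm : Moves gs (i ^ u • M) N)
    (hN : Small N) {n : ℕ} (hn : n ∈ l) (hn' : N = dec n) {s : Fin 13}
    (h : ipv hashVec (i ^ u • M) = ipv hashVec (i ^ u • gammaVec s)) : M = gammaVec s := by
  obtain ⟨n', h1, h2⟩ := hm.exists_preimage hgs hn hn'
  have h3 := (hm.small hgs hN).dec_eq h2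
  obtain ⟨t, ht, h4, h5⟩ := targets_ok s ⟨u % 4, Nat.mod_lt _ (by norm_num)⟩
  rw [Fin.val_mk, i_pow_mod] at h4
  have h6 : hash hashRows t.2 % 2 ^ 32 = hash hashRows n' % 2 ^ 32 := by
    have h7 := (hash_congr t.2).trans ((by rw [h4, h3, h] :
      (ipv hashVec (dec t.2)).re = (ipv hashVec (dec n')).re) ▸ (hash_congr n').symm)
    exact_mod_cast Int.natCast_modEq_iff.1 (by exact_mod_cast h7)
  have h7 := List.all_eq_true.1 hc n' h1
  rw [force_eq] at h7
  have h8 := List.all_eq_true.1 h7 t ht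
  have h9 : ∀ x : ℕ, Nat.mod x 4294967296 = x % 2 ^ 32 := fun x =>
    congrArg (x % ·) (by norm_num : 4294967296 = 2 ^ 32)
  rw [h5, h6, h9, Nat.beq_refl, Bool.not_true, Bool.false_or] at h8
  rw [← Nat.eq_of_beq_eq_true h8, h4] at h3
  exact (i_smul_cancel h3).symm

/-- The sacred vectors in the right partner of `B_*`. -/
theorem eq_gamma {M : GVec} (hM : IsSacred M) {s : Fin 13}
    (h : ∀ k, ipv (betaVec k) M = 4 * partnerInt (k + s)) : M = gammaVec s := by
  have h1 : ∀ N, ipv hashVec N = ∑ k, hashCoeff k * ipv (betaVec k) N := by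
    intro N
    simp only [ipv, hashVec, Finset.mul_sum, Finset.sum_mul]
    rw [Finset.sum_comm]
    exact Finset.sum_congr rfl fun k _ => Finset.sum_congr rfl fun p _ => by ring
  have h2 : ∀ u, ipv hashVec (i ^ u • M) = ipv hashVec (i ^ u • gammaVec s) := by
    intro u
    rw [h1, h1]
    exact Finset.sum_congr rfl fun k _ => by
      rw [ipv_smul_right, ipv_smul_right, h, ipv_beta_gamma]
  rcases sacred_cases hM with ⟨u, p, rfl⟩ | ⟨u, N, h3, h4, n, h5, h6⟩ | ⟨u, N, h3, h4, n, h5, h6⟩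
  · obtain ⟨k, hk⟩ := frame_ne_gamma p s
    have h3 := congrArg Zsqrtd.norm (h k)
    rw [ipv_smul_right, ipv_frame, Zsqrtd.norm_mul, Zsqrtd.norm_mul, Zsqrtd.norm_mul] at h3
    have h4 : (star (i ^ u)).norm = 1 := by rw [Zsqrtd.norm_conj, norm_i_pow]
    have h5 : (4 : GaussianInt).norm = 16 := rfl
    rw [h4, h5] at h3
    omega
  · have hc := hashCheck_mixed
    rw [forceL_eq, forceL_eq] at hc
    exact eq_gamma_of_moves mixedMoves_inv hc h3 h4 h5 h6 (h2 u)
  · have hc := hashCheck_block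
    rw [forceL_eq, forceL_eq] at hc
    exact eq_gamma_of_moves shiftMoves_inv hc h3 h4 h5 h6 (h2 u)

section
/-! ## The action of automorphisms and units on the graph `Ξ` -/

lemma conj_mul_toComplex_unit (u : GaussianIntˣ) :
    conj (GaussianInt.toComplex u) * GaussianInt.toComplex u = 1 := by
  have h1 : (u : GaussianInt).norm = 1 := by
    have h2 := (Zsqrtd.norm_eq_one_iff' (d := -1) (by norm_num) (u : GaussianInt)).2 u.isUnit
    exact h2
  rw [← GaussianInt.toComplex_star, ← map_mul, mul_comm, ← Zsqrtd.norm_eq_mul_conj, h1]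
  simp

lemma toComplex_unit_ne_zero (u : GaussianIntˣ) : GaussianInt.toComplex u ≠ 0 := fun h => by
  have := conj_mul_toComplex_unit u
  rw [h, mul_zero] at this
  exact zero_ne_one this

lemma herm_smul_left (c : ℂ) (x y : V) : herm (c • x) y = c * herm x y := inner_smul_right ..

lemma herm_smul_right (c : ℂ) (x y : V) : herm x (c • y) = conj c * herm x y := inner_smul_left ..

/-- The multiplication with a unit. -/
def unitIso (u : GaussianIntˣ) : V ≃ₗᵢ[ℂ] V where
  toLinearEquiv := LinearEquiv.smulOfNeZero ℂ V _ (toComplex_unit_ne_zero u)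
  norm_map' x := by
    have h1 := congrArg norm (conj_mul_toComplex_unit u)
    rw [norm_mul, RCLike.norm_conj, norm_one] at h1
    have h2 : ‖GaussianInt.toComplex u‖ = 1 := by nlinarith [norm_nonneg (GaussianInt.toComplex u)]
    change ‖GaussianInt.toComplex u • x‖ = ‖x‖
    rw [norm_smul, h2, one_mul]

lemma unitIso_apply (u : GaussianIntˣ) (x : V) : unitIso u x = GaussianInt.toComplex u • x := rfl

lemma unitIso_mem (u : GaussianIntˣ) : unitIso u ∈ autLattice := by
  have h : ∀ (u : GaussianIntˣ) x, x ∈ lattice → unitIso u x ∈ lattice :=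
    fun u x hx => lattice.smul_mem (u : GaussianInt) hx
  refine fun x => ⟨fun hx => ?_, h u x⟩
  have h1 := h u⁻¹ _ hx
  rw [unitIso_apply, unitIso_apply, smul_smul, ← map_mul, Units.inv_mul, map_one, one_smul] at h1
  exact h1

lemma sacred_map {g : V ≃ₗᵢ[ℂ] V} (hg : g ∈ autLattice) {x : V} : g x ∈ sacred ↔ x ∈ sacred :=
  and_congr (hg x) (by rw [herm_map])

section
variable {g h : V ≃ₗᵢ[ℂ] V} {B C : Set V}

lemma IsMSet.image (hB : IsMSet B) (hg : g ∈ autLattice) : IsMSet (g '' B) := by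
  let e : B ≃ g '' B := g.toEquiv.image B
  have he : ∀ x, (e x : V) = g x := fun _ => rfl
  refine ⟨?_, ?_, ?_⟩
  · rintro _ ⟨x, hx, rfl⟩
    exact (sacred_map hg).2 (hB.subset hx)
  · obtain ⟨n, T, h1, h2, ⟨f⟩⟩ := hB.gamma
    refine ⟨n, T, h1, h2, ⟨RelIso.trans (RelIso.symm ⟨e, ?_⟩) f⟩⟩
    intro x y
    change (e x ≠ e y ∧ herm (e x) (e y) = 1) ↔ (x ≠ y ∧ herm (x : V) y = 1)
    rw [he, he, herm_map, e.injective.ne_iff]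
  · obtain ⟨f, hf⟩ := hB.delta
    refine ⟨f.trans e, fun j k => ?_⟩
    rw [← hf]
    change herm (e (f j)) (e (f k)) = _ ↔ herm (f j : V) (f k) = _
    rw [he, he, herm_map]

lemma IsNeighbor.image {μ : V} (hμ : IsNeighbor μ B) (hg : g ∈ autLattice) :
    IsNeighbor (g μ) (g '' B) := by
  refine ⟨(sacred_map hg).2 hμ.1, ?_⟩
  rintro _ ⟨x, hx, rfl⟩
  rw [herm_map, hμ.2 x hx]

lemma AreNeighbors.image {μ μ' : V} (hμ : AreNeighbors μ μ' B) (hg : g ∈ autLattice) :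
    AreNeighbors (g μ) (g μ') (g '' B) :=
  ⟨hμ.1.image hg, hμ.2.1.image hg, by rw [herm_map, hμ.2.2]⟩

lemma IsFirstNeighbor.image {μ : V} (hμ : IsFirstNeighbor μ B) (hg : g ∈ autLattice) :
    IsFirstNeighbor (g μ) (g '' B) := by
  obtain ⟨μ', h⟩ := hμ
  exact ⟨g μ', h.image hg⟩

lemma IsOrientedLabeling.image {b : Fin 13 → V} (hb : IsOrientedLabeling b B) :
    IsOrientedLabeling (fun k => g (b k)) (g '' B) :=
  ⟨g.injective.comp hb.injective, by
    rw [← hb.range_eq, ← Set.range_comp]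
    rfl, fun k => by
    rw [herm_map]
    exact hb.oriented k⟩

lemma IsRightPartner.image (hC : IsRightPartner C B) (hg : g ∈ autLattice) :
    IsRightPartner (g '' C) (g '' B) := by
  obtain ⟨b, hb, rfl⟩ := hC
  refine ⟨_, hb.image, ?_⟩
  ext y
  obtain ⟨x, rfl⟩ := g.surjective y
  rw [g.injective.mem_set_image]
  simp only [Set.mem_ofPred_eq, herm_map, sacred_map hg]

variable {c : ℂ}

lemma herm_twist (hc : ∀ x, h x = c • g x) (x y : V) : herm (g x) (h y) = conj c * herm x y := by
  rw [hc, herm_smul_right, herm_map]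

lemma IsComplement.image {x : V} (hx : IsComplement x B) (hg : g ∈ autLattice)
    (hc : ∀ x, h x = c • g x) : IsComplement (g x) (h '' B) := by
  refine ⟨(sacred_map hg).2 hx.1, ?_⟩
  rintro _ ⟨y, hy, rfl⟩
  rw [hc, herm_smul_left, herm_map, hx.2 y hy, mul_zero]

lemma ratio_image (hc0 : c ≠ 0) (hc : ∀ x, h x = c • g x) (x μ μ' : V) :
    herm (g x) (h μ) / herm (g x) (h μ') = herm x μ / herm x μ' := by
  rw [herm_twist hc, herm_twist hc, mul_div_mul_left _ _ (by simpa using hc0)]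

lemma IsPosComplement.image {x : V} (hx : IsPosComplement x B) (hg : g ∈ autLattice)
    (hh : h ∈ autLattice) (hc0 : c ≠ 0) (hc : ∀ x, h x = c • g x) :
    IsPosComplement (g x) (h '' B) := by
  obtain ⟨h1, μ, μ', h2, h3⟩ := hx
  exact ⟨h1.image hg hc, h μ, h μ', h2.image hh, by rw [ratio_image hc0 hc, h3]⟩

lemma IsNegComplement.image {x : V} (hx : IsNegComplement x B) (hg : g ∈ autLattice)
    (hh : h ∈ autLattice) (hc0 : c ≠ 0) (hc : ∀ x, h x = c • g x) :
    IsNegComplement (g x) (h '' B) := by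
  obtain ⟨h1, μ, μ', h2, h3⟩ := hx
  exact ⟨h1.image hg hc, h μ, h μ', h2.image hh, by rw [ratio_image hc0 hc, h3]⟩

end

/-- The vertex `[g λ, u g B]`, for an automorphism `g` and a unit `u`. -/
def XiVertex.map (g : autLattice) (u : GaussianIntˣ) (v : XiVertex) : XiVertex where
  vec := (g : V ≃ₗᵢ[ℂ] V) v.vec
  set := (unitIso u * (g : V ≃ₗᵢ[ℂ] V)) '' v.set
  isMSet := v.isMSet.image (autLattice.mul_mem (unitIso_mem u) g.2)
  isPos := v.isPos.image g.2 (autLattice.mul_mem (unitIso_mem u) g.2) (toComplex_unit_ne_zero u)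
    fun _ => rfl

lemma reachable_of_rel {v w : XiVertex} (h : Xi1 v w ∨ Xi2 v w ∨ Xi3 v w) : Xi.Reachable v w := by
  by_cases hvw : v = w
  · rw [hvw]
  · exact SimpleGraph.Adj.reachable ((SimpleGraph.fromRel_adj ..).2 ⟨hvw, Or.inl h⟩)

lemma rel_map (g : autLattice) (u : GaussianIntˣ) {v w : XiVertex}
    (h : Xi1 v w ∨ Xi2 v w ∨ Xi3 v w) :
    Xi1 (v.map g u) (w.map g u) ∨ Xi2 (v.map g u) (w.map g u) ∨ Xi3 (v.map g u) (w.map g u) := by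
  have hh := autLattice.mul_mem (unitIso_mem u) g.2
  have hc : ∀ x, (unitIso u * (g : V ≃ₗᵢ[ℂ] V)) x = GaussianInt.toComplex u • (g : V ≃ₗᵢ[ℂ] V) x :=
    fun _ => rfl
  rcases h with ⟨t, h1, h2⟩ | ⟨h1, μ, μ', h2, h3, h4⟩ | ⟨h1, h2, h3⟩
  · refine Or.inl ⟨t, ?_, ?_⟩
    · change (g : V ≃ₗᵢ[ℂ] V) v.vec = _ • (g : V ≃ₗᵢ[ℂ] V) w.vec
      rw [h1, map_smul]
    · change (unitIso u * (g : V ≃ₗᵢ[ℂ] V)) '' v.set = _ '' ((unitIso u * (g : V ≃ₗᵢ[ℂ] V)) '' w.set)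
      rw [h2, Set.image_image, Set.image_image]
      exact Set.image_congr fun x _ => map_smul _ _ _
  · refine Or.inr (Or.inl ⟨congrArg (g : V ≃ₗᵢ[ℂ] V) h1, _, _, h2.image hh, h3.image hh, ?_⟩)
    change herm ((g : V ≃ₗᵢ[ℂ] V) v.vec) _ = herm ((g : V ≃ₗᵢ[ℂ] V) v.vec) _
    rw [herm_twist hc, herm_twist hc, h4]
  · exact Or.inr (Or.inr ⟨h1.image g.2 hh (toComplex_unit_ne_zero u) hc,
      (herm_map ..).trans h2, h3.image hh⟩)

lemma reachable_map (g : autLattice) (u : GaussianIntˣ) {v w : XiVertex} (h : Xi.Reachable v w) :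
    Xi.Reachable (v.map g u) (w.map g u) := by
  rw [SimpleGraph.reachable_iff_reflTransGen] at h
  induction h with
  | refl => rfl
  | tail _ hxy ih =>
    refine ih.trans ?_
    rcases ((SimpleGraph.fromRel_adj ..).1 hxy).2 with h | h
    · exact reachable_of_rel (rel_map g u h)
    · exact (reachable_of_rel (rel_map g u h)).symm

lemma map_map (g g' : autLattice) (u u' : GaussianIntˣ) (v : XiVertex) :
    (v.map g' u').map g u = v.map (g * g') (u * u') := by
  apply XiVertex.ext
  · rfl
  · change (unitIso u * (g : V ≃ₗᵢ[ℂ] V)) '' ((unitIso u' * (g' : V ≃ₗᵢ[ℂ] V)) '' v.set) =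
      (unitIso (u * u') * ((g * g' : autLattice) : V ≃ₗᵢ[ℂ] V)) '' v.set
    rw [Set.image_image]
    refine Set.image_congr fun x _ => ?_
    change GaussianInt.toComplex u • (g : V ≃ₗᵢ[ℂ] V) (GaussianInt.toComplex u' •
      (g' : V ≃ₗᵢ[ℂ] V) x) = GaussianInt.toComplex ((u * u' : GaussianIntˣ) : GaussianInt) •
        (g : V ≃ₗᵢ[ℂ] V) ((g' : V ≃ₗᵢ[ℂ] V) x)
    rw [map_smul, smul_smul, Units.val_mul, map_mul]

lemma map_one_one (v : XiVertex) : v.map 1 1 = v := by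
  apply XiVertex.ext
  · rfl
  · change (unitIso 1 * (1 : V ≃ₗᵢ[ℂ] V)) '' v.set = v.set
    have h : ∀ x, (unitIso 1 * (1 : V ≃ₗᵢ[ℂ] V)) x = x := fun x => by
      change GaussianInt.toComplex ((1 : GaussianIntˣ) : GaussianInt) • x = x
      rw [Units.val_one, map_one, one_smul]
    simp only [h, Set.image_id']

/-- Vertices with the same vector, and with the same product of this vector and the first
neighbor. -/
lemma reachable_of_vec_eq {v w : XiVertex} (h : v.vec = w.vec) {μ μ' : V}
    (hμ : IsFirstNeighbor μ v.set) (hμ' : IsFirstNeighbor μ' w.set)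
    (h' : herm v.vec μ = herm w.vec μ') : Xi.Reachable v w :=
  reachable_of_rel (Or.inr (Or.inl ⟨h, μ, μ', hμ, hμ', h'.trans (by rw [h])⟩))

/-- Vertices with opposite vectors. -/
lemma reachable_of_vec_neg {v w : XiVertex} (h : w.vec = -v.vec) {μ μ' : V}
    (hμ : IsFirstNeighbor μ v.set) (hμ' : IsFirstNeighbor μ' w.set)
    (h' : herm v.vec μ = herm w.vec μ') : Xi.Reachable v w := by
  have hn : GaussianInt.toComplex ((-1 : GaussianIntˣ) : GaussianInt) = -1 := by simp
  have hv : ∀ x, unitIso (-1) x = -x := fun x => by rw [unitIso_apply, hn, neg_one_smul]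
  let e : autLattice := ⟨unitIso (-1), unitIso_mem _⟩
  have h1 : (w.map e 1).vec = v.vec := by
    change unitIso (-1) w.vec = v.vec
    rw [hv, h, neg_neg]
  have hs : (w.map e 1).set = unitIso (-1) '' w.set := by
    refine Set.image_congr fun x _ => ?_
    change GaussianInt.toComplex ((1 : GaussianIntˣ) : GaussianInt) • unitIso (-1) x = _
    rw [Units.val_one, map_one, one_smul]
  have h2 : IsFirstNeighbor (unitIso (-1) μ') (w.map e 1).set := hs ▸ hμ'.image (unitIso_mem _)
  refine (reachable_of_vec_eq h1.symm hμ h2 ?_).trans (reachable_of_rel (Or.inl ⟨-1, ?_, ?_⟩))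
  · have h3 : (w.map e 1).vec = unitIso (-1) w.vec := rfl
    rw [h3, herm_map, h']
  · rw [hn, neg_one_smul, h1, h, neg_neg]
  · rw [hs]
    refine Set.image_congr fun x _ => ?_
    rw [hv, hn]
    simp

end

/-! ## The neighborhood of `[λ_*, B_*]` -/

lemma toComplex_i : GaussianInt.toComplex i = Complex.I := by simp [GaussianInt.toComplex_def]

lemma IsMSet.of_gram {c : Fin 13 → V} (hc : ∀ k, c k ∈ sacred)
    (hg : ∀ j k, herm (c j) (c k) = GaussianInt.toComplex (betaSeq (k - j))) :
    IsMSet (Set.range c) := by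
  have hinj : Function.Injective c := by
    intro j k h
    have h0 : ∀ j k : Fin 13, betaSeq (j - j) = betaSeq (k - j) → j = k := by decide +kernel
    have h1 := hg j k
    rw [← h, hg, GaussianInt.toComplex_inj] at h1
    exact h0 j k h1
  let e := Equiv.ofInjective c hinj
  refine ⟨?_, ?_, ?_⟩
  · rintro _ ⟨k, rfl⟩
    exact hc k
  · refine ⟨13, strip, strip_isMobiusBand, by decide +kernel, ⟨RelIso.symm ⟨e, ?_⟩⟩⟩
    intro j k
    have h : ∀ j k : Fin 13, (j ≠ k ∧ betaSeq (k - j) = 1) ↔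
        (j ≠ k ∧ ∃ t ∈ strip, j ∈ t ∧ k ∈ t) := by
      decide +kernel
    change e j ≠ e k ∧ herm (c j) (c k) = 1 ↔ _
    rw [hg, ← map_one GaussianInt.toComplex, GaussianInt.toComplex_inj, e.injective.ne_iff]
    exact h j k
  · refine ⟨e, fun j k => ?_⟩
    have h : ∀ j k : Fin 13, betaSeq (k - j) = i ↔ k = j + 1 := by decide +kernel
    change herm (c j) (c k) = Complex.I ↔ _
    rw [hg, ← toComplex_i, GaussianInt.toComplex_inj]
    exact h j k

lemma betaVec_eq (k : Fin 13) : vec (betaVec k) = toV (betaArr k) := vec_flat _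

lemma gammaVec_sacred (k : Fin 13) : IsSacred (gammaVec k) := by
  rw [gammaVec, flat_gamma]
  refine ⟨gen_mem _, ?_⟩
  revert k
  decide +kernel

lemma herm_gamma (j k : Fin 13) : herm (vec (gammaVec j)) (vec (gammaVec k)) =
    GaussianInt.toComplex (betaSeq (k - j)) := by
  refine herm_vec _ _ _ ?_
  revert j k
  decide +kernel

/-- The set `C_*`. -/
def CStar : Set V := Set.range fun k => vec (gammaVec k)

lemma partnerSeq_eq (k : Fin 13) : partnerSeq k = GaussianInt.toComplex (partnerInt k) := by
  fin_cases k <;> simp [partnerSeq, partnerInt, GaussianInt.toComplex_def]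

lemma BStar_labeling : IsOrientedLabeling (fun k => vec (betaVec k)) BStar := by
  have h : (fun k => vec (betaVec k)) = fun k => toV (betaArr k) := funext betaVec_eq
  rw [h]
  refine ⟨beta_injective, rfl, fun k => ?_⟩
  have h1 : ∀ k : Fin 12, betaSeq (k.succ - k.castSucc) = i := by decide +kernel
  simp only [herm_beta, h1, toComplex_i]

lemma CStar_rightPartner : IsRightPartner CStar BStar := by
  refine ⟨_, BStar_labeling, ?_⟩
  ext x
  constructor
  · rintro ⟨s, rfl⟩
    refine ⟨vec_mem_sacred.2 (gammaVec_sacred s), s, fun k => ?_⟩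
    rw [herm_vec _ _ _ (ipv_beta_gamma k s), partnerSeq_eq]
  · rintro ⟨hx, s, hs⟩
    obtain ⟨M, hM, rfl⟩ := exists_vec_of_sacred hx
    refine ⟨s, congrArg vec (eq_gamma hM fun k => ipv_of_herm _ _ _ ?_).symm⟩
    rw [hs, partnerSeq_eq]

lemma gen_sacred {k : Fin 28} (h : ipv (dec (genCode k)) (dec (genCode k)) = 16) :
    vec (dec (genCode k)) ∈ sacred := vec_mem_sacred.2 ⟨gen_mem k, h⟩

lemma lambdaOne_sacred : IsSacred lambdaOne :=
  ⟨D.smul_mem _ (gen_mem 27), by decide +kernel⟩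

lemma BStar_neighbors : AreNeighbors (vec (dec (genCode 25))) (vec (dec (genCode 26))) BStar := by
  refine ⟨⟨gen_sacred (by decide +kernel), ?_⟩, ⟨gen_sacred (by decide +kernel), ?_⟩, ?_⟩
  · rintro _ ⟨k, rfl⟩
    change herm (toV (betaArr k)) _ = 1
    rw [← betaVec_eq, herm_vec _ _ 1 (by revert k; decide +kernel), map_one]
  · rintro _ ⟨k, rfl⟩
    change herm (toV (betaArr k)) _ = 1
    rw [← betaVec_eq, herm_vec _ _ 1 (by revert k; decide +kernel), map_one]
  · rw [herm_vec _ _ i (by decide +kernel), toComplex_i]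

lemma CStar_neighbors : AreNeighbors (vec (dec (genCode 26))) (vec (-dec (genCode 25))) CStar := by
  refine ⟨⟨gen_sacred (by decide +kernel), ?_⟩,
    ⟨vec_mem_sacred.2 ⟨D.neg_mem (gen_mem _), by decide +kernel⟩, ?_⟩, ?_⟩
  · rintro _ ⟨k, rfl⟩
    rw [herm_vec _ _ 1 (by revert k; decide +kernel), map_one]
  · rintro _ ⟨k, rfl⟩
    rw [herm_vec _ _ 1 (by revert k; decide +kernel), map_one]
  · rw [herm_vec _ _ i (by decide +kernel), toComplex_i]

/-- The vertex `[λ₁, C_*]`. -/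
def xiOne : XiVertex where
  vec := vec lambdaOne
  set := CStar
  isMSet := IsMSet.of_gram (fun k => vec_mem_sacred.2 (gammaVec_sacred k)) herm_gamma
  isPos := by
    refine ⟨⟨vec_mem_sacred.2 lambdaOne_sacred, ?_⟩, _, _, CStar_neighbors, ?_⟩
    · rintro _ ⟨k, rfl⟩
      rw [herm_vec _ _ 0 (by revert k; decide +kernel), map_zero]
    · rw [herm_vec _ _ (-i) (by decide +kernel), herm_vec _ _ (-i) (by decide +kernel)]
      simp [GaussianInt.toComplex_def]

lemma xiStar_vec : xiStar.vec = vec (frame 4) := by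
  rw [← flat_lambda, vec_flat]
  rfl

lemma herm_xiStar : herm xiStar.vec (vec (dec (genCode 25))) = GaussianInt.toComplex (-i) := by
  rw [xiStar_vec]
  exact herm_vec _ _ _ (by decide +kernel)

lemma reachable_xiOne : Xi.Reachable xiStar xiOne := by
  refine reachable_of_rel (Or.inr (Or.inr ⟨⟨⟨vec_mem_sacred.2 lambdaOne_sacred, ?_⟩, _, _,
    BStar_neighbors, ?_⟩, ?_, CStar_rightPartner⟩))
  · rintro _ ⟨k, rfl⟩
    have h : herm (vec (betaVec k)) (vec lambdaOne) = GaussianInt.toComplex 0 :=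
      herm_vec _ _ _ (by revert k; decide +kernel)
    rw [betaVec_eq, map_zero] at h
    exact h
  · change herm (vec lambdaOne) _ / herm (vec lambdaOne) _ = -1
    rw [herm_vec _ _ i (by decide +kernel), herm_vec _ _ (-i) (by decide +kernel)]
    simp [GaussianInt.toComplex_def]
  · rw [xiStar_vec]
    change herm _ (vec lambdaOne) = _
    rw [herm_vec _ _ (-i) (by decide +kernel), map_neg, toComplex_i]

/-- The automorphisms that map `[λ_*, B_*]` to a vertex of the same component. -/
def xiGroup : Subgroup (V ≃ₗᵢ[ℂ] V) where
  carrier := {g | ∃ hg : g ∈ autLattice, Xi.Reachable xiStar (xiStar.map ⟨g, hg⟩ 1)}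
  one_mem' := ⟨autLattice.one_mem, by
    have h := map_one_one xiStar
    exact h.symm ▸ SimpleGraph.Reachable.refl _⟩
  mul_mem' := by
    rintro g h ⟨hg, hg'⟩ ⟨hh, hh'⟩
    refine ⟨autLattice.mul_mem hg hh, hg'.trans ?_⟩
    have h1 := reachable_map ⟨g, hg⟩ 1 hh'
    rw [map_map, mul_one] at h1
    exact h1
  inv_mem' := by
    rintro g ⟨hg, hg'⟩
    refine ⟨autLattice.inv_mem hg, ?_⟩
    have h1 := reachable_map ⟨g, hg⟩⁻¹ 1 hg'
    rw [map_map, mul_one, inv_mul_cancel, map_one_one] at h1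
    exact h1.symm

lemma map_one_neighbor (g : autLattice) {μ : V} {v : XiVertex} (h : IsFirstNeighbor μ v.set) :
    IsFirstNeighbor ((g : V ≃ₗᵢ[ℂ] V) μ) (v.map g 1).set := by
  have h1 := h.image (autLattice.mul_mem (unitIso_mem 1) g.2)
  have h2 : (unitIso 1 * (g : V ≃ₗᵢ[ℂ] V)) μ = (g : V ≃ₗᵢ[ℂ] V) μ := by
    change GaussianInt.toComplex ((1 : GaussianIntˣ) : GaussianInt) • (g : V ≃ₗᵢ[ℂ] V) μ = _
    rw [Units.val_one, map_one, one_smul]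
  rw [h2] at h1
  exact h1

lemma containsFibers_xiGroup : ContainsFibers xiGroup := by
  have hμ : IsFirstNeighbor (vec (dec (genCode 25))) xiStar.set := ⟨_, BStar_neighbors⟩
  have hm : ∀ g : autLattice, (xiStar.map g 1).vec = (g : V ≃ₗᵢ[ℂ] V) (vec (frame 4)) :=
    fun g => congrArg (g : V ≃ₗᵢ[ℂ] V) xiStar_vec
  have hp : ∀ g : autLattice, herm (xiStar.map g 1).vec
      ((g : V ≃ₗᵢ[ℂ] V) (vec (dec (genCode 25)))) = herm xiStar.vec (vec (dec (genCode 25))) :=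
    fun g => herm_map ..
  refine ⟨fun g hg => hg.1, fun g hg h => ⟨hg, ?_⟩, fun g hg h => ⟨hg, ?_⟩, fun g hg h => ⟨hg, ?_⟩⟩
  · exact reachable_of_vec_eq ((hm ⟨g, hg⟩).trans h |>.trans xiStar_vec.symm).symm hμ
      (map_one_neighbor ⟨g, hg⟩ hμ) (hp _).symm
  · exact reachable_of_vec_neg ((hm ⟨g, hg⟩).trans h |>.trans (by rw [vec_neg, xiStar_vec])) hμ
      (map_one_neighbor ⟨g, hg⟩ hμ) (hp _).symm
  · refine reachable_xiOne.trans (reachable_of_vec_eq ((hm ⟨g, hg⟩).trans h).symm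
      ⟨_, CStar_neighbors⟩ (map_one_neighbor ⟨g, hg⟩ hμ) ?_)
    rw [hp, herm_xiStar]
    exact herm_vec _ _ _ (by decide +kernel)

/-- Every sacred vector is the image of `λ_*` under an automorphism in the group. -/
lemma exists_xiGroup {x : V} (hx : x ∈ sacred) : ∃ g ∈ xiGroup, g (vec (frame 4)) = x := by
  obtain ⟨M, hM, rfl⟩ := exists_vec_of_sacred hx
  exact containsFibers_xiGroup.inOrbit hM

lemma mem_xiGroup {g : V ≃ₗᵢ[ℂ] V} (hg : g ∈ autLattice) : g ∈ xiGroup := by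
  have h4 : vec (frame 4) ∈ sacred := xiStar_vec ▸ xiStar.isPos.1.1
  obtain ⟨k, hk, hk'⟩ := exists_xiGroup ((sacred_map hg).2 h4)
  have h1 : k⁻¹ * g ∈ xiGroup := by
    refine containsFibers_xiGroup.fixed _
      (autLattice.mul_mem (autLattice.inv_mem hk.1) hg) ?_
    change k⁻¹ (g (vec (frame 4))) = _
    rw [← hk']
    exact k.symm_apply_apply _
  have h2 := xiGroup.mul_mem hk h1
  rwa [mul_inv_cancel_left] at h2

/-! ## Products of sacred vectors -/

lemma sacred_entry {M : GVec} (hM : IsSacred M) (p : Fin 28) :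
    M p = 0 ∨ (∃ u, M p = i ^ u) ∨ ∃ u, M = i ^ u • frame p := by
  have hs : ∀ {u : ℕ}, Small (i ^ u • M) → M p = 0 ∨ (∃ u, M p = i ^ u) := fun {u} h => by
    have h1 := h p
    rw [Pi.smul_apply, smul_eq_mul, Zsqrtd.norm_mul, norm_i_pow, one_mul] at h1
    have h2 := norm_nonneg' (M p)
    have h3 : (M p).norm = 0 ∨ (M p).norm = 1 := by omega
    exact h3.imp eq_zero_of_norm eq_i_pow_of_norm
  rcases sacred_cases hM with ⟨u, q, rfl⟩ | ⟨u, N, h3, h4, -⟩ | ⟨u, N, h3, h4, -⟩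
  · by_cases hq : q = p
    · exact Or.inr (Or.inr ⟨u, by rw [hq]⟩)
    · left
      rw [Pi.smul_apply, frame, Pi.single_eq_of_ne (Ne.symm hq), smul_zero]
  · exact (hs (h3.small mixedMoves_inv h4)).imp_right Or.inl
  · exact (hs (h3.small shiftMoves_inv h4)).imp_right Or.inl

/-- Products of sacred vectors on different lines are zero or units. -/
lemma herm_sacred {x y : V} (hx : x ∈ sacred) (hy : y ∈ sacred) :
    herm x y = 0 ∨ (∃ u : GaussianIntˣ, herm x y = GaussianInt.toComplex u) ∨
      ∃ c : ℂ, y = c • x := by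
  obtain ⟨g, hg, rfl⟩ := exists_xiGroup hx
  obtain ⟨z, rfl⟩ := g.surjective y
  rw [sacred_map hg.1] at hy
  obtain ⟨M, hM, rfl⟩ := exists_vec_of_sacred hy
  have h : ∀ N, ipv (frame 4) N = 4 * star (N 4) := fun N => by
    rw [← star_ipv, ipv_frame, star_mul', star_ofNat]
  rw [herm_map, herm_vec _ _ _ (h M)]
  rcases sacred_entry hM 4 with h | ⟨u, h⟩ | ⟨u, h⟩
  · exact Or.inl (by rw [h, star_zero, map_zero])
  · obtain ⟨v, hv⟩ := (isUnit_i_pow u).star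
    exact Or.inr (Or.inl ⟨v, by rw [hv, h]⟩)
  · exact Or.inr (Or.inr ⟨GaussianInt.toComplex (i ^ u), by rw [h, vec_smul, map_smul]⟩)

/-- Every vertex can be joined with an image of `[λ_*, B_*]`. -/
lemma exists_reachable_map (v : XiVertex) : ∃ g u, Xi.Reachable v (xiStar.map g u) := by
  obtain ⟨⟨hv, hv0⟩, μ, μ', hμ, hr⟩ := v.isPos
  obtain ⟨g, hg, hg'⟩ := exists_xiGroup hv
  have hne : herm v.vec μ ≠ 0 := fun h => by
    rw [h, zero_div] at hr
    exact zero_ne_one hr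
  have hu : ∃ u : GaussianIntˣ, herm v.vec μ = GaussianInt.toComplex u := by
    rcases herm_sacred hv hμ.1.1 with h | h | ⟨c, h⟩
    · exact absurd h hne
    · exact h
    · obtain ⟨b, hb⟩ := v.isMSet.exists_labeling
      have hb0 : b 0 ∈ v.set := hb.range_eq ▸ Set.mem_range_self 0
      have h1 := hμ.1.2 _ hb0
      rw [h, herm_smul_right, hv0 _ hb0, mul_zero] at h1
      exact absurd h1 zero_ne_one
  obtain ⟨u, hu⟩ := hu
  obtain ⟨w, hw⟩ : ∃ w : GaussianIntˣ, conj (GaussianInt.toComplex w) *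
      GaussianInt.toComplex (-i) = GaussianInt.toComplex u := by
    have h1 : IsUnit (star ((u : GaussianInt) * i)) :=
      (u.isUnit.mul (by simpa using isUnit_i_pow 1)).star
    obtain ⟨w, hw⟩ := h1
    refine ⟨w, ?_⟩
    rw [← GaussianInt.toComplex_star, ← map_mul, hw, star_star, mul_assoc,
      show i * -i = 1 by decide, mul_one]
  refine ⟨⟨g, hg.1⟩, w, ?_⟩
  have h1 : IsFirstNeighbor (vec (dec (genCode 25))) xiStar.set := ⟨_, BStar_neighbors⟩
  refine reachable_of_vec_eq ?_ ⟨_, hμ⟩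
    (h1.image (autLattice.mul_mem (unitIso_mem w) hg.1)) ?_
  · rw [← hg', ← xiStar_vec]
    rfl
  · change _ = herm (g xiStar.vec) ((unitIso w * g) (vec (dec (genCode 25))))
    rw [herm_twist (c := GaussianInt.toComplex w) fun _ => rfl, herm_xiStar, hw, hu]

theorem reachable_map_self (g : autLattice) (v : XiVertex) : Xi.Reachable v (v.map g 1) := by
  obtain ⟨h, u, hv⟩ := exists_reachable_map v
  have h1 : Xi.Reachable (xiStar.map h 1) (xiStar.map (g * h) 1) :=
    (mem_xiGroup h.2).2.symm.trans (mem_xiGroup (g * h).2).2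
  have h2 := reachable_map 1 u h1
  rw [map_map, map_map, one_mul, one_mul, mul_one] at h2
  have h3 := reachable_map g 1 hv
  rw [map_map, one_mul] at h3
  exact hv.trans (h2.trans h3.symm)

/-! ## The invariance of `ϱ` -/

lemma map_one_set (g : autLattice) (v : XiVertex) :
    (v.map g 1).set = (g : V ≃ₗᵢ[ℂ] V) '' v.set := by
  refine Set.image_congr fun x _ => ?_
  change GaussianInt.toComplex ((1 : GaussianIntˣ) : GaussianInt) • (g : V ≃ₗᵢ[ℂ] V) x = _
  rw [Units.val_one, map_one, one_smul]

lemma R_le : R ≤ autLattice := autLattice.commutator_le_self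

lemma extRep_wedge (g : R) (v : XiVertex) : extRep g (wedge v) = wedge (v.map ⟨g, R_le g.2⟩ 1) := by
  obtain ⟨b, hb⟩ := v.isMSet.exists_labeling
  have hb' : IsOrientedLabeling (fun k => (g : V ≃ₗᵢ[ℂ] V) (b k)) (v.map ⟨g, R_le g.2⟩ 1).set := by
    rw [map_one_set]
    exact hb.image
  rw [wedge_eq v hb, wedge_eq _ hb']
  refine (exteriorPower.map_apply_ιMulti ..).trans (congrArg _ ?_)
  funext k
  refine Fin.cases rfl (fun k => rfl) k

lemma extRep_rho (g : R) : extRep g rho = rho := by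
  let a : autLattice := ⟨g, R_le g.2⟩
  rw [rho, map_sum]
  simp only [extRep_wedge]
  have hmem : ∀ (k : autLattice) (v : XiVertex), v ∈ XiStar → v.map k 1 ∈ XiStar := by
    intro k v hv
    refine (SimpleGraph.ConnectedComponent.sound ?_).trans hv
    exact (reachable_map_self k v).symm
  have hinv : ∀ (k : autLattice) (v : XiVertex), (v.map k 1).map k⁻¹ 1 = v := fun k v => by
    rw [map_map, mul_one, inv_mul_cancel, map_one_one]
  refine Finset.sum_nbij' (fun v => v.map a 1) (fun v => v.map a⁻¹ 1) ?_ ?_ ?_ ?_ ?_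
  · intro v hv
    rw [Set.Finite.mem_toFinset] at hv ⊢
    exact hmem a v hv
  · intro v hv
    rw [Set.Finite.mem_toFinset] at hv ⊢
    exact hmem a⁻¹ v hv
  · exact fun v _ => hinv a v
  · intro v _
    have h := hinv a⁻¹ v
    rwa [inv_inv] at h
  · exact fun v _ => rfl

end ConwayWales
end

open ConwayWales
theorem mainTheorem4 :
    (∀ g ∈ R, ∀ v : XiVertex, ∃ w : XiVertex,
      w.vec = g v.vec ∧ w.set = g '' v.set ∧ Xi.Reachable v w) ∧
    (∀ g : Ru, ruRep g rho = rho) := by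
  refine ⟨fun g hg v => ⟨v.map ⟨g, R_le hg⟩ 1, rfl, map_one_set _ v, reachable_map_self _ v⟩, ?_⟩
  intro g
  obtain ⟨g, rfl⟩ := QuotientGroup.mk_surjective g
  exact extRep_rho g
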